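/- **Conventions.** A promise problem is a pair $A=(A_{\rm yes},A_{\rm no})$ of disjoint subsets of $\{0,1\}^*$; it is a decision problem if $A_{\rm yes}\cup A_{\rm no}=\{0,1\}^*$; $A$ is a subproblem of $B$ if $A_{\rm yes}\subseteq B_{\rm yes}$ and $A_{\rm no}\subseteq B_{\rm no}$. A DTM is a deterministic one-tape Turing machine over $\{0,1,\square\}$ with a two-way infinite tape; it starts on the first symbol of its input, halts in its final states, and its output is the string between the head position and the next blank. An input $(x,y)$ is written as $x\square y$. A probabilistic Turing machine (PTM) chooses in every step from a finite set of transitions. Polynomial runtime means that on all inputs the machine (for a PTM: every branch) halts in a number of steps that is bounded by a polynomial in the length of the (computational) input. A function $f:\mathbb N_0\to\mathbb N_0$ is in $\mathrm{poly}$ if it is polynomially bounded and some DTM of polynomial runtime outputs the binary representation of $f(n)$ on every input of length $n$. A class $C$ of promise problems is *recursively presentable* if there is a sequence $M_0,M_1,\dots$ of DTMs that halt on all inputs, with $i\mapsto$ (Gödel number of $M_i$) computable, such that $A\in C$ if and only if some $M_i$ totally decides $A$, i.e. $M_i(x)=1$ for all $x\in A_{\rm yes}$, $M_i(x)=0$ for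 all $x\in A_{\rm no}$, and $M_i(x)=10$ for all other $x$. $\mathsf P$ is the class of decision problems decided by DTMs of polynomial runtime. $\mathsf{NP}$ is the class of decision problems $A$ for which there are a DTM $M$ of polynomial runtime and $m\in\mathrm{poly}$ such that for $x\in A_{\rm yes}$ there is $y\in\{0,1\}^{m(|x|)}$ with $M(x,y)=1$, and for $x\in A_{\rm no}$ all $y\in\{0,1\}^{m(|x|)}$ satisfy $M(x,y)=0$. The machines of the other classes, with acceptance probabilities $P_{\rm acc}$, are the following. * PromiseBPP: PTMs of polynomial runtime, run on $x$ (no witness). * PromiseMA: PTMs of polynomial runtime with some $m\in\mathrm{poly}$, run on $(x,y)$ with witnesses $y\in\{0,1\}^{m(|x|)}$. * BQP: families $(U_x)_x$ of circuits of Hadamard, $T$ and CNOT gates, whose encodings are output on input $x$ by a DTM of polynomial runtime (an output that is not a valid encoding stands for a circuit that never accepts); $P_{\rm acc}=\langle 0^k|U_x^\dagger\Pi_{\rm acc}U_x|0^k\rangle$ with $\Pi_{\rm acc}$ the projection onto the value $1$ of the first qubit (no witness). * QCMA and QMA: such families on $k(|x|)+m(|x|)$ qubits with $k+m\in\mathrm{poly}$,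 where the DTM also outputs $m(|x|)$, and the initial state is $|\psi\rangle\otimes|0^{k}\rangle$. The witnesses $|\psi\rangle$ are the computational basis states of $m(|x|)$ qubits for QCMA, and all unit vectors in $\mathbb C^{2^{m(|x|)}}$ for QMA. Such a machine decides a promise problem $A$ if for all $x\in A_{\rm yes}$ some witness gives $P_{\rm acc}\ge\frac23$ and for all $x\in A_{\rm no}$ all witnesses give $P_{\rm acc}\le\frac13$. The *extremal problem* of a machine is the problem decided by it of which all problems decided by it are subproblems. For $C\in\mathcal C=\{\mathrm{PromiseBPP},\mathrm{PromiseMA},\mathrm{BQP},\mathrm{QCMA},\mathrm{QMA}\}$ let $C^*$ be the class of the extremal problems of all $C$-machines. For PTMs, $P_{\rm acc}$ may be read either as the number of accepting branches divided by the number of all branches, or as the probability of reaching an accepting final state if every choice of a transition is uniform. **Lemma.** The classes $\mathsf P$, $\mathsf{NP}$ and $C^*$ for every $C\in\mathcal C$ are recursively presentable; for PromiseBPP$^*$ and PromiseMA$^*$ this holds with either reading of $P_{\rm acc}$. -/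

import Mathlib

open scoped Matrix

/-! Promise problems over binary strings. -/

/-- A promise problem: disjoint sets of yes- and no-instances among the binary strings. -/
@[ext]
structure PromiseProblem where
  yes : Set (List Bool)
  no : Set (List Bool)
  disj : Disjoint yes no

/-- `A ≤ B` means that `A` is a subproblem of `B`. -/
instance PromiseProblem.instPartialOrder : PartialOrder PromiseProblem where
  le A B := A.yes ⊆ B.yes ∧ A.no ⊆ B.no
  le_refl _ := ⟨subset_rfl, subset_rfl⟩
  le_trans _ _ _ h h' := ⟨h.1.trans h'.1, h.2.trans h'.2⟩
  le_antisymm _ _ h h' := PromiseProblem.ext (h.1.antisymm h'.1) (h.2.antisymm h'.2)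

/-- A decision problem is a promise problem whose promise holds for all strings. -/
def PromiseProblem.IsDecision (A : PromiseProblem) : Prop := A.yes ∪ A.no = Set.univ

/-! Tapes, configurations and Turing machines over `{0, 1, blank}`.
A tape symbol is an `Option Bool`; the blank is `none`. -/

/-- A transition to a new state, a symbol to write, and a head movement (`none`: do not move). -/
abbrev Transition (n : ℕ) : Type := Fin (n + 1) × Option Bool × Option Turing.Dir

/-- A configuration of a machine with states `0, …, n`. -/
structure TMConfig (n : ℕ) where
  state : Fin (n + 1)
  tape : Turing.Tape (Option Bool)

/-- The configuration after performing a transition: write, move, change the state. -/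
def TMConfig.act {n : ℕ} (c : TMConfig n) (a : Transition n) : TMConfig n where
  state := a.1
  tape := match a.2.2 with
    | none => c.tape.write a.2.1
    | some d => (c.tape.write a.2.1).move d

/-- The initial configuration: state `0`, head on the first cell of the given tape content. -/
def TMConfig.init (n : ℕ) (u : List (Option Bool)) : TMConfig n where
  state := 0
  tape := Turing.Tape.mk₁ u

/-- The string from the head position up to the next blank is `w`. -/
def TMConfig.Output {n : ℕ} (c : TMConfig n) (w : List Bool) : Prop :=
  ∀ i : ℕ, i ≤ w.length → c.tape.nth (i : ℤ) = w[i]?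

/-- Tape content for the input `x`. -/
def tapeInput (x : List Bool) : List (Option Bool) := x.map some

/-- Tape content for the input `(x, y)`: the two strings separated by one blank. -/
def tapeInput₂ (x y : List Bool) : List (Option Bool) := x.map some ++ none :: y.map some

/-- A deterministic Turing machine with states `0, …, n` and initial state `0`. -/
structure DTM where
  n : ℕ
  final : Fin (n + 1) → Bool
  δ : Fin (n + 1) → Option Bool → Transition n

/-- One computational step; a final configuration does not change any more. -/
def DTM.step (M : DTM) (c : TMConfig M.n) : TMConfig M.n :=
  if M.final c.state then c else c.act (M.δ c.state c.tape.head)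

/-- The configuration after `t` steps on tape content `u`. -/
def DTM.config (M : DTM) (u : List (Option Bool)) (t : ℕ) : TMConfig M.n :=
  M.step^[t] (TMConfig.init M.n u)

/-- `M` halts on `u` after at most `t` steps. -/
def DTM.HaltsWithin (M : DTM) (u : List (Option Bool)) (t : ℕ) : Prop :=
  M.final (M.config u t).state = true

/-- `M` halts on `u` after at most `t` steps with output `w`. -/
def DTM.OutputsWithin (M : DTM) (u : List (Option Bool)) (t : ℕ) (w : List Bool) : Prop :=
  M.HaltsWithin u t ∧ (M.config u t).Output w

/-- `M` halts on `u`. -/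
def DTM.Halts (M : DTM) (u : List (Option Bool)) : Prop := ∃ t, M.HaltsWithin u t

/-- `M` halts on `u` with output `w`. -/
def DTM.Outputs (M : DTM) (u : List (Option Bool)) (w : List Bool) : Prop :=
  ∃ t, M.OutputsWithin u t w

/-- Numerical code of a transition. -/
def transitionCode {n : ℕ} (a : Transition n) : ℕ × Option Bool × ℕ :=
  (a.1, a.2.1, match a.2.2 with
    | none => 0
    | some Turing.Dir.left => 1
    | some Turing.Dir.right => 2)

/-- The Gödel number of a machine: it encodes the number of states, the list of the flags that
mark the final states, and the table of the transition function. -/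
def DTM.godelNumber (M : DTM) : ℕ :=
  Encodable.encode
    (M.n, (List.finRange (M.n + 1)).map M.final,
      (List.finRange (M.n + 1)).map fun q =>
        [none, some false, some true].map fun a => transitionCode (M.δ q a))

/-- `M` totally decides `A`: output `1` on yes-instances, `0` on no-instances and
`10` on all other strings. -/
def DTM.TotallyDecides (M : DTM) (A : PromiseProblem) : Prop :=
  (∀ x ∈ A.yes, M.Outputs (tapeInput x) [true]) ∧
  (∀ x ∈ A.no, M.Outputs (tapeInput x) [false]) ∧
  (∀ x, x ∉ A.yes ∪ A.no → M.Outputs (tapeInput x) [true, false])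

/-- A class of promise problems is recursively presentable if there is a computable series of
always halting deterministic machines such that the class consists of exactly those problems
that are totally decided by a machine of the series. -/
def RecursivelyPresentable (C : Set PromiseProblem) : Prop :=
  ∃ M : ℕ → DTM, Computable (fun i => (M i).godelNumber) ∧
    (∀ i x, (M i).Halts (tapeInput x)) ∧
    ∀ A : PromiseProblem, A ∈ C ↔ ∃ i, (M i).TotallyDecides A

/-! The functions in `poly`. -/

/-- Binary representation, most significant digit first, without leading zeros. -/
def binaryRep (k : ℕ) : List Bool := if k = 0 then [false] else k.bits.reverse

/-- `f ∈ poly`: `f` is polynomially bounded, and some machine outputs the binary representation of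
`f n` in polynomial time on every input of length `n`. -/
def InPoly (f : ℕ → ℕ) : Prop :=
  (∃ p : Polynomial ℕ, ∀ n, f n ≤ p.eval n) ∧
  ∃ (M : DTM) (p : Polynomial ℕ), ∀ x : List Bool,
    M.OutputsWithin (tapeInput x) (p.eval x.length) (binaryRep (f x.length))

/-! The classes P and NP. -/

/-- The class P of decision problems. -/
def classP : Set PromiseProblem :=
  {A | A.IsDecision ∧ ∃ M : DTM,
    (∃ p : Polynomial ℕ, ∀ x : List Bool, M.HaltsWithin (tapeInput x) (p.eval x.length)) ∧
    (∀ x ∈ A.yes, M.Outputs (tapeInput x) [true]) ∧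
    (∀ x ∈ A.no, M.Outputs (tapeInput x) [false])}

/-- The class NP of decision problems. -/
def classNP : Set PromiseProblem :=
  {A | A.IsDecision ∧ ∃ (M : DTM) (m : ℕ → ℕ),
    (∃ p : Polynomial ℕ, ∀ x y : List Bool,
      M.HaltsWithin (tapeInput₂ x y) (p.eval (x.length + y.length))) ∧
    InPoly m ∧
    (∀ x ∈ A.yes, ∃ y : List Bool, y.length = m x.length ∧
      M.Outputs (tapeInput₂ x y) [true]) ∧
    (∀ x ∈ A.no, ∀ y : List Bool, y.length = m x.length →
      M.Outputs (tapeInput₂ x y) [false])}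

/-! Extremal problems. -/

/-- The problems decided by some machine of a given kind, where `dec M A` says that
the machine `M` decides `A`. -/
def machineClass {Mach : Type} (dec : Mach → PromiseProblem → Prop) : Set PromiseProblem :=
  {A | ∃ M, dec M A}

/-- `A` is the extremal problem of `M`: it is decided by `M`, and all problems that are decided
by `M` are subproblems of it. -/
def IsExtremalProblem {Mach : Type} (dec : Mach → PromiseProblem → Prop) (M : Mach)
    (A : PromiseProblem) : Prop :=
  IsGreatest {B | dec M B} A

/-- The restriction of a machine-based class to its extremal problems. -/
def extremalClass {Mach : Type} (dec : Mach → PromiseProblem → Prop) : Set PromiseProblem :=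
  {A ∈ machineClass dec | ∃ M, IsExtremalProblem dec M A}

/-! Probabilistic Turing machines. -/

/-- A probabilistic Turing machine with states `0, …, n` and initial state `0`; every
computational step branches over a set of transitions. -/
structure PTM where
  n : ℕ
  final : Fin (n + 1) → Bool
  δ : Fin (n + 1) → Option Bool → Finset (Transition n)

/-- The transitions that are possible in a configuration. -/
def PTM.choices (M : PTM) (c : TMConfig M.n) : Finset (Transition M.n) :=
  M.δ c.state c.tape.head

/-- From `c`, every branch reaches a final state after at most `t` steps. -/
def PTM.HaltsWithinFrom (M : PTM) : ℕ → TMConfig M.n → Prop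
  | 0, c => M.final c.state = true
  | t + 1, c => M.final c.state = true ∨
      ((M.choices c).Nonempty ∧ ∀ a ∈ M.choices c, M.HaltsWithinFrom t (c.act a))

/-- On tape content `u`, every branch halts after at most `t` steps. -/
def PTM.HaltsWithin (M : PTM) (u : List (Option Bool)) (t : ℕ) : Prop :=
  M.HaltsWithinFrom t (TMConfig.init M.n u)

/-- `M.BranchFrom c l c'`: a branch starting in `c` makes the successive choices `l` and
thereby halts in the final configuration `c'`. -/
def PTM.BranchFrom (M : PTM) : TMConfig M.n → List (Transition M.n) → TMConfig M.n → Prop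
  | c, [], c' => M.final c.state = true ∧ c' = c
  | c, a :: l, c' => M.final c.state = false ∧ a ∈ M.choices c ∧ M.BranchFrom (c.act a) l c'

/-- All (halting) branches on tape content `u`. -/
def PTM.branches (M : PTM) (u : List (Option Bool)) : Set (List (Transition M.n)) :=
  {l | ∃ c, M.BranchFrom (TMConfig.init M.n u) l c}

/-- The accepting branches on tape content `u`: those with output `1`. -/
def PTM.acceptingBranches (M : PTM) (u : List (Option Bool)) : Set (List (Transition M.n)) :=
  {l | ∃ c, M.BranchFrom (TMConfig.init M.n u) l c ∧ c.Output [true]}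

/-- The number of accepting branches divided by the number of all branches. -/
noncomputable def PTM.acceptFraction (M : PTM) (u : List (Option Bool)) : ℚ :=
  ((M.acceptingBranches u).ncard : ℚ) / ((M.branches u).ncard : ℚ)

/-- The probability of the sequence `l` of choices if each choice is made uniformly. -/
def PTM.branchWeight (M : PTM) : TMConfig M.n → List (Transition M.n) → ℚ
  | _, [] => 1
  | c, a :: l => (1 / ((M.choices c).card : ℚ)) * M.branchWeight (c.act a) l

/-- The probability that a random branch is accepting if each choice is made uniformly. -/
noncomputable def PTM.acceptProbability (M : PTM) (u : List (Option Bool)) : ℚ :=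
  ∑ᶠ l ∈ M.acceptingBranches u, M.branchWeight (TMConfig.init M.n u) l

/-- How the acceptance of a probabilistic machine is measured, as a function of the machine and
the tape content. It is instantiated by `PTM.acceptFraction` and `PTM.acceptProbability`. -/
abbrev AcceptanceMeasure : Type := PTM → List (Option Bool) → ℚ

/-- PromiseBPP-machines: probabilistic machines of polynomial runtime. -/
structure BPPMachine where
  M : PTM
  polyTime : ∃ p : Polynomial ℕ, ∀ x : List Bool, M.HaltsWithin (tapeInput x) (p.eval x.length)

def BPPMachine.Decides (P : AcceptanceMeasure) (V : BPPMachine) (A : PromiseProblem) : Prop :=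
  (∀ x ∈ A.yes, P V.M (tapeInput x) ≥ 2 / 3) ∧
  (∀ x ∈ A.no, P V.M (tapeInput x) ≤ 1 / 3)

/-- PromiseMA-machines: probabilistic machines of polynomial runtime with a witness length. -/
structure MAMachine where
  M : PTM
  m : ℕ → ℕ
  polyTime : ∃ p : Polynomial ℕ, ∀ x y : List Bool,
    M.HaltsWithin (tapeInput₂ x y) (p.eval (x.length + y.length))
  inPoly : InPoly m

def MAMachine.Decides (P : AcceptanceMeasure) (V : MAMachine) (A : PromiseProblem) : Prop :=
  (∀ x ∈ A.yes, ∃ y : List Bool, y.length = V.m x.length ∧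
    P V.M (tapeInput₂ x y) ≥ 2 / 3) ∧
  (∀ x ∈ A.no, ∀ y : List Bool, y.length = V.m x.length →
    P V.M (tapeInput₂ x y) ≤ 1 / 3)

/-! Quantum circuits over Hadamard, T and CNOT. Qubits are numbered from `0` here. -/

inductive QGate where
  | H (i : ℕ)
  | T (i : ℕ)
  | CNOT (control target : ℕ) (h : control ≠ target)

/-- The gate acts on the qubits `0, …, K - 1`. -/
def QGate.ActsOn (K : ℕ) : QGate → Prop
  | .H i => i < K
  | .T i => i < K
  | .CNOT i j _ => i < K ∧ j < K

/-- The least number of qubits that the gate needs. -/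
def QGate.width : QGate → ℕ
  | .H i => i + 1
  | .T i => i + 1
  | .CNOT i j _ => max (i + 1) (j + 1)

/-- Computational basis states of `K` qubits. -/
abbrev QBasis (K : ℕ) : Type := Fin K → Bool

/-- The value of qubit `i` in a basis state. -/
def QBasis.bit {K : ℕ} (b : QBasis K) (i : ℕ) : Bool := if h : i < K then b ⟨i, h⟩ else false

noncomputable def hadamardMatrix : Matrix Bool Bool ℂ :=
  Matrix.of fun a b => (1 / (Real.sqrt 2 : ℂ)) * (if a && b then -1 else 1)

noncomputable def tMatrix : Matrix Bool Bool ℂ :=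
  Matrix.diagonal fun a => if a then Complex.exp (Complex.I * (Real.pi : ℂ) / 4) else 1

/-- The one-qubit gate `G` on qubit `i`, the identity on the other qubits. -/
noncomputable def onQubit (K i : ℕ) (G : Matrix Bool Bool ℂ) : Matrix (QBasis K) (QBasis K) ℂ :=
  Matrix.of fun b b' =>
    if ∀ l : Fin K, (l : ℕ) ≠ i → b l = b' l then G (b.bit i) (b'.bit i) else 0

/-- CNOT with control `i` and target `j`, the identity on the other qubits. -/
noncomputable def cnotMatrix (K i j : ℕ) : Matrix (QBasis K) (QBasis K) ℂ :=
  Matrix.of fun b b' =>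
    if ∀ l : Fin K, b l = (if (l : ℕ) = j then xor (b' l) (b'.bit i) else b' l) then 1 else 0

/-- The unitary of a gate on `K` qubits. -/
noncomputable def QGate.matrix (K : ℕ) : QGate → Matrix (QBasis K) (QBasis K) ℂ
  | .H i => onQubit K i hadamardMatrix
  | .T i => onQubit K i tMatrix
  | .CNOT i j _ => cnotMatrix K i j

/-- The unitary of a series of gates; the head of the list is applied first. -/
noncomputable def circuitMatrix (K : ℕ) : List QGate → Matrix (QBasis K) (QBasis K) ℂ
  | [] => 1
  | g :: gs => circuitMatrix K gs * g.matrix K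

/-- The projection onto the states in which the first qubit is `1`. -/
noncomputable def acceptProjection (K : ℕ) : Matrix (QBasis K) (QBasis K) ℂ :=
  Matrix.diagonal fun b => if b.bit 0 then 1 else 0

/-- The acceptance probability of a circuit on `K` qubits with initial state `v`. -/
noncomputable def circuitAccept (K : ℕ) (gs : List QGate) (v : QBasis K → ℂ) : ℝ :=
  (star v ⬝ᵥ
    (((circuitMatrix K gs)ᴴ * acceptProjection K * circuitMatrix K gs) *ᵥ v)).re

/-- The state `ψ ⊗ 0^k`. -/
noncomputable def withAncillas (m k : ℕ) (ψ : QBasis m → ℂ) : QBasis (m + k) → ℂ :=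
  fun b => if ∀ j : Fin k, b (Fin.natAdd m j) = false then ψ (fun i => b (Fin.castAdd k i)) else 0

/-! Encodings of circuits as binary strings: the gate types are `01`, `10` and `11`, the qubit with
index `i` (counted from one) is `1^i`, and all these blocks are separated by `0`. -/

def QGate.encode : QGate → List Bool
  | .H i => [false, true] ++ false :: List.replicate (i + 1) true
  | .T i => [true, false] ++ false :: List.replicate (i + 1) true
  | .CNOT i j _ => [true, true] ++ false :: List.replicate (i + 1) true ++
      false :: List.replicate (j + 1) true

def encodeGates (gs : List QGate) : List Bool :=
  List.intercalate [false] (gs.map QGate.encode)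

/-- A circuit together with its number `m` of witness qubits: `1^m` is put in front. -/
def encodeWitnessCircuit (c : ℕ × List QGate) : List Bool :=
  List.replicate c.1 true ++ false :: encodeGates c.2

/-- BQP-machines: families of circuits whose encodings are output by a deterministic machine of
polynomial runtime. `circuit x = none` means that the output is not a valid encoding. -/
structure BQPMachine where
  circuit : List Bool → Option (List QGate)
  generated : ∃ (D : DTM) (p : Polynomial ℕ), ∀ x : List Bool, ∃ s : List Bool,
    D.OutputsWithin (tapeInput x) (p.eval x.length) s ∧
    ∀ gs, circuit x = some gs ↔ encodeGates gs = s

/-- The number of qubits of a circuit: the largest index that occurs, and at least one. -/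
def numQubits (gs : List QGate) : ℕ := (gs.map QGate.width).foldr max 1

/-- The acceptance probability on input `x`, with all qubits initially `0`; an invalid encoding
stands for a circuit that never accepts. -/
noncomputable def BQPMachine.accept (V : BQPMachine) (x : List Bool) : ℝ :=
  match V.circuit x with
  | none => 0
  | some gs => circuitAccept (numQubits gs) gs (Pi.single (fun _ => false) 1)

def BQPMachine.Decides (V : BQPMachine) (A : PromiseProblem) : Prop :=
  (∀ x ∈ A.yes, V.accept x ≥ 2 / 3) ∧
  (∀ x ∈ A.no, V.accept x ≤ 1 / 3)

/-- QCMA- and QMA-machines: families of circuits on `m + k` qubits, of which the first `m` hold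
the witness, together with a deterministic machine of polynomial runtime that outputs encodings of
the circuits and of `m`. `circuit x = none` means that the output is not a valid encoding. -/
structure QVerifier where
  circuit : List Bool → Option (ℕ × List QGate)
  m : ℕ → ℕ
  k : ℕ → ℕ
  inPoly : InPoly (fun n => k n + m n)
  actsOn : ∀ x c, circuit x = some c →
    c.1 = m x.length ∧ ∀ g ∈ c.2, g.ActsOn (m x.length + k x.length)
  generated : ∃ (D : DTM) (p : Polynomial ℕ), ∀ x : List Bool, ∃ s : List Bool,
    D.OutputsWithin (tapeInput x) (p.eval x.length) s ∧
    ∀ c, circuit x = some c ↔ encodeWitnessCircuit c = s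

/-- The acceptance probability on input `x` with witness state `ψ`. -/
noncomputable def QVerifier.accept (V : QVerifier) (x : List Bool)
    (ψ : QBasis (V.m x.length) → ℂ) : ℝ :=
  match V.circuit x with
  | none => 0
  | some c => circuitAccept (V.m x.length + V.k x.length) c.2
      (withAncillas (V.m x.length) (V.k x.length) ψ)

/-- Deciding with classical witnesses, i.e. computational basis states. -/
def QVerifier.DecidesClassical (V : QVerifier) (A : PromiseProblem) : Prop :=
  (∀ x ∈ A.yes, ∃ y : QBasis (V.m x.length), V.accept x (Pi.single y 1) ≥ 2 / 3) ∧
  (∀ x ∈ A.no, ∀ y : QBasis (V.m x.length), V.accept x (Pi.single y 1) ≤ 1 / 3)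

/-- Deciding with quantum witnesses, i.e. arbitrary unit vectors. -/
def QVerifier.DecidesQuantum (V : QVerifier) (A : PromiseProblem) : Prop :=
  (∀ x ∈ A.yes, ∃ ψ : QBasis (V.m x.length) → ℂ, ∑ b, ‖ψ b‖ ^ 2 = 1 ∧
    V.accept x ψ ≥ 2 / 3) ∧
  (∀ x ∈ A.no, ∀ ψ : QBasis (V.m x.length) → ℂ, ∑ b, ‖ψ b‖ ^ 2 = 1 →
    V.accept x ψ ≤ 1 / 3)

/-! The classes of extremal problems. -/

def PromiseBPPStar (P : AcceptanceMeasure) : Set PromiseProblem :=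
  extremalClass (BPPMachine.Decides P)

def PromiseMAStar (P : AcceptanceMeasure) : Set PromiseProblem :=
  extremalClass (MAMachine.Decides P)

def BQPStar : Set PromiseProblem := extremalClass BQPMachine.Decides

def QCMAStar : Set PromiseProblem := extremalClass QVerifier.DecidesClassical

def QMAStar : Set PromiseProblem := extremalClass QVerifier.DecidesQuantum

/-! Each class turns out to be the set of all problems `problemOf (F i)` for a jointly primitive
recursive `F`, and `presentable_of_primrec` converts such an `F` into a presentation. A single
machine `U` evaluates `F i x` on the word `1^(i+1) 0 x`; the machine with index `i` first writes
`1^(i+1) 0` in front of its input and then runs `U`. Its transition table is explicit in `i`, hence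
so is its Gödel number. `U` comes from Mathlib's translation of computable functions into stack
machines and then into machines over a Boolean alphabet (`exists_dtm_of_computable`); what has to be
added is the conversion between words and the tape format of that translation.

The obstacle is that one cannot decide whether a machine, together with an exponent `c` of a time
bound `(n + 2) ^ c`, is a legal machine of the class. But legality is a conjunction over all `n` of
decidable checks. In `presentable_of_checked`, `F i x` makes all checks `n ≤ |x|`, gives the value
of the machine if they succeed, and `no` otherwise. A legal index yields its own problem. An illegal
index yields a problem with only `no` on all long inputs; this still belongs to the class, because a
machine of constant runtime can look up the finitely many remaining answers.

By `extremalClass_eq`, the starred classes consist of explicit problems: `yes` means that some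
witness reaches `2/3`, `no` that all witnesses stay below or at `1/3`. It remains to decide these
conditions for clocked machines. For P and NP this is simulation and a search over witnesses. For
probabilistic machines the tree of configurations is expanded, with the product of the branching
numbers recorded at each node (`RawPTM.total_eq`); both readings of acceptance are then rational
numbers that can be computed.

For circuits, let `ω` be the primitive eighth root of unity and `h` the number of Hadamard gates. Up
to the factor `2^(-h/2)`, all amplitudes are sums of powers of `ω`, so `2^h` times the matrix of
acceptance probabilities can be stored as lists of exponents (`PathSum.toMat_gram`). The sign of a
real part `a + b √2 / 2` with integers `a`, `b` is found by comparing squares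
(`PathSum.re_ev_nonneg`), which settles BQP and QCMA. For QMA, with `G` the scaled matrix, all unit
vectors have acceptance at most `1/3` iff `2^h - 3 G` is positive semidefinite, and some unit vector
reaches `2/3` iff `2 * 2^h - 3 G` is not positive definite. The signs of the eigenvalues of a
Hermitian matrix are visible in their elementary symmetric polynomials
(`Multiset.forall_nonneg_iff_esymm`), and Newton's identities express these by the traces of the
powers of the matrix (`PathSum.ev_newton`). -/

/-! Machines with an arbitrary finite state type, and their composition. -/

/-- A deterministic machine with a finite type of states; it halts where `δ` is `none`. -/
structure Mach where
  S : Type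
  [fin : Fintype S]
  start : S
  δ : S → Option Bool → Option (S × Option Bool × Option Turing.Dir)

attribute [instance] Mach.fin

/-- Write a symbol and move. -/
def actTape (T : Turing.Tape (Option Bool)) (a : Option Bool) (d : Option Turing.Dir) :
    Turing.Tape (Option Bool) :=
  match d with
  | none => T.write a
  | some d => (T.write a).move d

namespace Mach

/-- From state `q` and tape `T`, the machine halts after exactly `t` steps with tape `T'`. -/
inductive RunsFrom (M : Mach) : ℕ → M.S → Turing.Tape (Option Bool) →
    Turing.Tape (Option Bool) → Prop
  | halt {q T} : M.δ q T.head = none → RunsFrom M 0 q T T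
  | step {q T q' a d t T'} : M.δ q T.head = some (q', a, d) →
      RunsFrom M t q' (actTape T a d) T' → RunsFrom M (t + 1) q T T'

/-- The machine, started on tape `T`, halts after exactly `t` steps with tape `T'`. -/
def RunsIn (M : Mach) (t : ℕ) (T T' : Turing.Tape (Option Bool)) : Prop :=
  M.RunsFrom t M.start T T'

/-- The machine, started on tape `T`, halts with tape `T'`. -/
def Runs (M : Mach) (T T' : Turing.Tape (Option Bool)) : Prop := ∃ t, M.RunsIn t T T'

/-- Perform one action. -/
def act (w : Option Bool → Option Bool) (d : Option Turing.Dir) : Mach where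
  S := Bool
  start := false
  δ q a := if q then none else some (true, w a, d)

theorem act_runsIn (w d T) : (act w d).RunsIn 1 T (actTape T (w T.head) d) :=
  .step (q' := true) (by simp [act]) (.halt (by simp [act]))

@[simp] theorem actTape_head (T : Turing.Tape (Option Bool)) : actTape T T.head none = T :=
  Turing.Tape.write_self T

/-- Transfers of control between submachines cost one step that rewrites the scanned symbol without
a move. -/
theorem RunsFrom.jump {M : Mach} {t q q' T T'} (h : M.δ q T.head = some (q', T.head, none))
    (h' : M.RunsFrom t q' T T') : M.RunsFrom (t + 1) q T T' :=
  .step h (by simpa using h')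

/-- Sequential composition. -/
def seq (A B : Mach) : Mach where
  S := A.S ⊕ B.S
  start := .inl A.start
  δ q a := match q with
    | .inl q => match A.δ q a with
      | some (q', b, d) => some (.inl q', b, d)
      | none => some (.inr B.start, a, none)
    | .inr q => (B.δ q a).map fun (q', b, d) => (.inr q', b, d)

theorem RunsFrom.seq_right {A B : Mach} {t q T T'} (h : B.RunsFrom t q T T') :
    (seq A B).RunsFrom t (.inr q) T T' := by
  induction h with
  | halt h => exact .halt (by simp [seq, h])
  | step h _ ih => exact .step (by simp [seq, h]) ih

theorem RunsFrom.seq_left {A B : Mach} {t q T T' t' T''} (h : A.RunsFrom t q T T')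
    (h' : B.RunsIn t' T' T'') : (seq A B).RunsFrom (t + (t' + 1)) (.inl q) T T'' := by
  induction h with
  | halt h =>
    rw [Nat.zero_add]
    exact .jump (by simp [seq, h]) h'.seq_right
  | @step _ _ _ _ _ t _ h _ ih =>
    rw [Nat.add_right_comm]
    exact .step (by simp [seq, h]) (ih h')

theorem RunsIn.seq {A B : Mach} {t T T' t' T''} (h : A.RunsIn t T T')
    (h' : B.RunsIn t' T' T'') : (seq A B).RunsIn (t + (t' + 1)) T T'' :=
  RunsFrom.seq_left h h'

theorem Runs.seq {A B : Mach} {T T' T''} (h : A.Runs T T') (h' : B.Runs T' T'') :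
    (A.seq B).Runs T T'' := by
  obtain ⟨t, h⟩ := h
  obtain ⟨t', h'⟩ := h'
  exact ⟨_, h.seq h'⟩

/-- Branch on the symbol under the head. -/
def ite (p : Option Bool → Bool) (A B : Mach) : Mach where
  S := Option (A.S ⊕ B.S)
  start := none
  δ q a := match q with
    | none => if p a then some (some (.inl A.start), a, none) else some (some (.inr B.start), a, none)
    | some (.inl q) => (A.δ q a).map fun (q', b, d) => (some (.inl q'), b, d)
    | some (.inr q) => (B.δ q a).map fun (q', b, d) => (some (.inr q'), b, d)

theorem RunsFrom.ite_left {p} {A B : Mach} {t q T T'} (h : A.RunsFrom t q T T') :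
    (ite p A B).RunsFrom t (some (.inl q)) T T' := by
  induction h with
  | halt h => exact .halt (by simp [ite, h])
  | step h _ ih => exact .step (by simp [ite, h]) ih

theorem RunsFrom.ite_right {p} {A B : Mach} {t q T T'} (h : B.RunsFrom t q T T') :
    (ite p A B).RunsFrom t (some (.inr q)) T T' := by
  induction h with
  | halt h => exact .halt (by simp [ite, h])
  | step h _ ih => exact .step (by simp [ite, h]) ih

theorem RunsIn.ite_true {p} {A B : Mach} {t T T'} (hp : p T.head = true) (h : A.RunsIn t T T') :
    (ite p A B).RunsIn (t + 1) T T' :=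
  .jump (by simp [ite, hp]) (RunsFrom.ite_left h)

theorem RunsIn.ite_false {p} {A B : Mach} {t T T'} (hp : p T.head = false) (h : B.RunsIn t T T') :
    (ite p A B).RunsIn (t + 1) T T' :=
  .jump (by simp [ite, hp]) (RunsFrom.ite_right h)

theorem Runs.ite_true {p} {A B : Mach} {T T'} (hp : p T.head = true) (h : A.Runs T T') :
    (ite p A B).Runs T T' := by
  obtain ⟨t, h⟩ := h
  exact ⟨_, h.ite_true hp⟩

theorem Runs.ite_false {p} {A B : Mach} {T T'} (hp : p T.head = false) (h : B.Runs T T') :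
    (ite p A B).Runs T T' := by
  obtain ⟨t, h⟩ := h
  exact ⟨_, h.ite_false hp⟩

/-- Repeat as long as the symbol under the head satisfies `p`. -/
def loop (p : Option Bool → Bool) (A : Mach) : Mach where
  S := Option A.S
  start := none
  δ q a := match q with
    | none => if p a then some (some A.start, a, none) else none
    | some q => match A.δ q a with
      | some (q', b, d) => some (some q', b, d)
      | none => some (none, a, none)

theorem Runs.loop_false {p} {A : Mach} {T} (hp : p T.head = false) : (loop p A).Runs T T :=
  ⟨0, .halt (by simp [loop, hp])⟩

theorem RunsFrom.loop {p} {A : Mach} {t q T T' t' T''} (h : A.RunsFrom t q T T')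
    (h' : (loop p A).RunsIn t' T' T'') : (loop p A).RunsFrom (t + (t' + 1)) (some q) T T'' := by
  induction h with
  | halt h =>
    rw [Nat.zero_add]
    exact .jump (by simp [Mach.loop, h]) h'
  | @step _ _ _ _ _ t _ h _ ih =>
    rw [Nat.add_right_comm]
    exact .step (by simp [Mach.loop, h]) (ih h')

theorem Runs.loop_true {p} {A : Mach} {T T' T''} (hp : p T.head = true) (h : A.Runs T T')
    (h' : (loop p A).Runs T' T'') : (loop p A).Runs T T'' := by
  obtain ⟨t, h⟩ := h
  obtain ⟨t', h'⟩ := h'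
  exact ⟨_, .jump (by simp [loop, hp]) (RunsFrom.loop h h')⟩

/-! Conversion into a `DTM`. -/

/-- The additional state `none` serves as the final state that a `DTM` needs; the swap moves the
start state to `0`. -/
theorem exists_equiv (M : Mach) :
    ∃ n : ℕ, ∃ e : Option M.S ≃ Fin (n + 1), e (some M.start) = 0 := by
  classical
  have hc : Fintype.card (Option M.S) = Fintype.card M.S + 1 := Fintype.card_option
  let e := Fintype.equivFinOfCardEq hc
  exact ⟨_, e.trans (Equiv.swap (e (some M.start)) 0), by simp⟩

/-- A `Mach` stops where its transition is undefined; the one extra step is the passage to the final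
state. -/
theorem exists_dtm (M : Mach) : ∃ D : DTM, ∀ t T T', M.RunsIn t T T' →
    ∃ q, D.final q = true ∧ D.step^[t + 1] ⟨0, T⟩ = ⟨q, T'⟩ := by
  obtain ⟨n, e, he⟩ := M.exists_equiv
  let D : DTM :=
    { n := n
      final := fun q => (e.symm q).isNone
      δ := fun q a => match e.symm q with
        | none => (q, a, none)
        | some s => match M.δ s a with
          | none => (e none, a, none)
          | some (s', b, d) => (e (some s'), b, d) }
  refine ⟨D, fun t T T' h => ⟨e none, by simp [D], ?_⟩⟩
  have key : ∀ t q T T', M.RunsFrom t q T T' →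
      D.step^[t + 1] ⟨e (some q), T⟩ = ⟨e none, T'⟩ := by
    intro t q T T' h
    induction h with
    | @halt q T h =>
      simp only [Function.iterate_succ, Function.iterate_zero, Function.comp, id]
      simp only [DTM.step, D, Equiv.symm_apply_apply, Option.isNone_some, TMConfig.act, h]
      simp
    | @step q T q' a d t T' h _ ih =>
      rw [Function.iterate_succ_apply]
      have : D.step ⟨e (some q), T⟩ = ⟨e (some q'), actTape T a d⟩ := by
        simp only [DTM.step, D, Equiv.symm_apply_apply, Option.isNone_some, TMConfig.act, h]
        cases d <;> rfl
      rw [this, ih]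
  rw [← he]
  exact key _ _ _ _ h

end Mach

/-! ### Stability of halting and uniqueness of outputs -/

theorem DTM.step_final (M : DTM) {c : TMConfig M.n} (h : M.final c.state = true) :
    M.step c = c := by simp [DTM.step, h]

theorem DTM.iterate_final (M : DTM) {c : TMConfig M.n} (h : M.final c.state = true) (t : ℕ) :
    M.step^[t] c = c := Function.iterate_fixed (M.step_final h) t

theorem DTM.config_mono (M : DTM) {u t} (h : M.HaltsWithin u t) {t'} (ht : t ≤ t') :
    M.config u t' = M.config u t := by
  obtain ⟨s, rfl⟩ := Nat.exists_eq_add_of_le ht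
  rw [Nat.add_comm]
  simp only [DTM.config, Function.iterate_add_apply]
  exact M.iterate_final h s

theorem DTM.HaltsWithin.mono {M : DTM} {u t} (h : M.HaltsWithin u t) {t'} (ht : t ≤ t') :
    M.HaltsWithin u t' := by
  simpa only [DTM.HaltsWithin, M.config_mono h ht] using h

theorem DTM.OutputsWithin.mono {M : DTM} {u t w} (h : M.OutputsWithin u t w) {t'} (ht : t ≤ t') :
    M.OutputsWithin u t' w := by
  refine ⟨h.1.mono ht, ?_⟩
  rw [M.config_mono h.1 ht]
  exact h.2

theorem TMConfig.Output.unique {n} {c : TMConfig n} {w w'} (h : c.Output w) (h' : c.Output w') :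
    w = w' := by
  have key : ∀ {w w'}, c.Output w → c.Output w' → w.length ≤ w'.length := by
    intro w w' h h'
    by_contra hl
    -- At this position `w'` demands the blank that ends it, whereas a longer `w` demands a symbol.
    have h1 := h w'.length (by omega)
    have h2 := h' w'.length le_rfl
    rw [h1] at h2
    simp at h2
    omega
  have hl := le_antisymm (key h h') (key h' h)
  refine List.ext_getElem? fun i => ?_
  by_cases hi : i ≤ w.length
  · rw [← h i hi, ← h' i (hl ▸ hi)]
  · rw [List.getElem?_eq_none (by omega), List.getElem?_eq_none (by omega)]

theorem DTM.Outputs.unique {M : DTM} {u w w'} (h : M.Outputs u w) (h' : M.Outputs u w') :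
    w = w' := by
  obtain ⟨t, h⟩ := h
  obtain ⟨t', h'⟩ := h'
  have h1 := h.mono (le_max_left t t')
  have h2 := h'.mono (le_max_right t t')
  exact h1.2.unique h2.2

/-! Tapes given by lists, and writing a word. -/

abbrev tp (l r : List (Option Bool)) : Turing.Tape (Option Bool) := Turing.Tape.mk₂ l r

@[simp] theorem tp_head_cons (l a r) : (tp l (a :: r)).head = a := rfl
@[simp] theorem tp_head_nil (l) : (tp l []).head = none := rfl

/-- Half-tapes are lists up to trailing blanks, so a scanned blank can always be made explicit. -/
theorem tp_nil (l) : tp l [] = tp l [none] := by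
  simp only [tp, Turing.Tape.mk₂]
  congr 1
  exact (Turing.ListBlank.cons_mk none []) ▸ (by
    apply Turing.ListBlank.ext; intro i; cases i <;> simp [Turing.ListBlank.nth_mk] <;> rfl)

@[simp] theorem actTape_right (l a r b) :
    actTape (tp l (a :: r)) b (some .right) = tp (b :: l) r := by
  simp [actTape, tp, Turing.Tape.mk₂, ← Turing.ListBlank.cons_mk]

@[simp] theorem actTape_left (c l a r b) :
    actTape (tp (c :: l) (a :: r)) b (some .left) = tp l (c :: b :: r) := by
  simp [actTape, tp, Turing.Tape.mk₂, ← Turing.ListBlank.cons_mk]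

@[simp] theorem actTape_stay (l a r b) : actTape (tp l (a :: r)) b none = tp l (b :: r) := by
  simp [actTape, tp, Turing.Tape.mk₂, ← Turing.ListBlank.cons_mk]

@[simp] theorem actTape_left_nil (a r b) :
    actTape (tp [] (a :: r)) b (some .left) = tp [] (none :: b :: r) := by
  simp [actTape, tp, Turing.Tape.mk₂, ← Turing.ListBlank.cons_mk]
  congr 1

theorem init_eq_tp (n u) : TMConfig.init n u = ⟨0, tp [] u⟩ := rfl

/-- The word `w` is written from the head position on, followed by a blank. -/
def HasOutput (T : Turing.Tape (Option Bool)) (w : List Bool) : Prop :=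
  ∃ l r, T = tp l (w.map some ++ none :: r)

theorem HasOutput.output {n} {c : TMConfig n} {w} (h : HasOutput c.tape w) : c.Output w := by
  obtain ⟨l, r, h⟩ := h
  intro i hi
  rw [h, tp, Turing.Tape.mk₂, Turing.Tape.mk'_nth_nat, Turing.ListBlank.nth_mk,
    List.getI_eq_getElem?_getD]
  rcases hi.lt_or_eq with hi | rfl
  · rw [List.getElem?_append_left (by simpa using hi)]
    simp [hi]
  · simp

theorem exists_cons_of_tp (l r) : ∃ a r', tp l r = tp l (a :: r') := by
  cases r with
  | nil => exact ⟨none, [], tp_nil l⟩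
  | cons a r => exact ⟨a, r, rfl⟩

theorem exists_actTape_left (l a r b) :
    ∃ c l', actTape (tp l (a :: r)) b (some .left) = tp l' (c :: b :: r) := by
  cases l with
  | nil => exact ⟨_, _, actTape_left_nil a r b⟩
  | cons c l => exact ⟨_, _, actTape_left c l a r b⟩

namespace Mach

/-- Write the symbols of a word leftwards. -/
def putLeft : List (Option Bool) → Mach
  | [] => act id (some .right)
  | c :: cs => (act (fun _ => c) (some .left)).seq (putLeft cs)

/-- The number of steps depends only on the word and not on the tape; the constant runtime of the
lookup machines rests on this order of the quantifiers. -/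
theorem putLeft_runs (cs : List (Option Bool)) : ∃ t, ∀ l a r, ∃ c l',
    (putLeft cs).RunsIn t (tp l (a :: r)) (tp (c :: l') (cs.reverse ++ r)) := by
  induction cs with
  | nil => exact ⟨1, fun l a r => ⟨a, l, by simpa [putLeft] using act_runsIn id (some .right) (tp l (a :: r))⟩⟩
  | cons c cs ih =>
    obtain ⟨t, ih⟩ := ih
    refine ⟨1 + (t + 1), fun l a r => ?_⟩
    obtain ⟨d, l', h⟩ := exists_actTape_left l a r c
    obtain ⟨e, l'', h'⟩ := ih l' d (c :: r)
    refine ⟨e, l'', ?_⟩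
    have h1 := act_runsIn (fun _ => c) (some .left) (tp l (a :: r))
    rw [h] at h1
    simpa [putLeft] using h1.seq h'

/-- Write a word such that the result can be read off from the head position. -/
def writeWord (w : List Bool) : Mach := putLeft (none :: w.reverse.map some)

theorem writeWord_runs (w : List Bool) : ∃ t, ∀ l r, ∃ T',
    (writeWord w).RunsIn t (tp l r) T' ∧ HasOutput T' w := by
  -- The closing blank is written first and the word follows from its last symbol on; the final move
  -- to the right puts the head on the first symbol.
  obtain ⟨t, h⟩ := putLeft_runs (none :: w.reverse.map some)
  refine ⟨t, fun l r => ?_⟩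
  obtain ⟨a, r', hr⟩ := exists_cons_of_tp l r
  obtain ⟨c, l', h⟩ := h l a r'
  exact ⟨_, hr ▸ h, ⟨c :: l', r', by simp [← List.map_reverse]⟩⟩

/-- A machine that computes a function that only depends on a bounded prefix of the input. -/
theorem exists_lookup (N : ℕ) (g : List Bool → List Bool) : ∃ (M : Mach) (B : ℕ),
    ∀ (x : List Bool) (l v), (v = [] ∨ ∃ v', v = none :: v') → ∃ t ≤ B, ∃ T',
      M.RunsIn t (tp l (x.map some ++ v)) T' ∧ HasOutput T' (g (x.take N)) := by
  induction N generalizing g with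
  | zero =>
    obtain ⟨t, h⟩ := writeWord_runs (g [])
    exact ⟨_, t, fun x l v _ => ⟨t, le_rfl, by simpa using h l _⟩⟩
  | succ N ih =>
    obtain ⟨M₁, B₁, h₁⟩ := ih fun x => g (true :: x)
    obtain ⟨M₀, B₀, h₀⟩ := ih fun x => g (false :: x)
    obtain ⟨t, h⟩ := writeWord_runs (g [])
    -- Each level of the recursion reads one symbol and remembers it in the finite control. A blank
    -- ends the prefix early, so a second input behind it is never seen.
    refine ⟨ite (· == none) (writeWord (g [])) (ite (· == some true)
      ((act id (some .right)).seq M₁) ((act id (some .right)).seq M₀)),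
      t + B₁ + B₀ + 10, fun x l v hv => ?_⟩
    match x with
    | [] =>
      obtain ⟨T', h, h'⟩ := h l v
      refine ⟨t + 1, by omega, T', ?_, by simpa using h'⟩
      exact RunsIn.ite_true (by rcases hv with rfl | ⟨v', rfl⟩ <;> simp) (by simpa using h)
    | true :: x =>
      obtain ⟨s, hs, T', h, h'⟩ := h₁ x (some true :: l) v hv
      refine ⟨1 + (s + 1) + 1 + 1, by omega, T', ?_, by simpa using h'⟩
      refine RunsIn.ite_false (by simp) (RunsIn.ite_true (by simp) ((act_runsIn _ _ _).seq ?_))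
      simpa using h
    | false :: x =>
      obtain ⟨s, hs, T', h, h'⟩ := h₀ x (some false :: l) v hv
      refine ⟨1 + (s + 1) + 1 + 1, by omega, T', ?_, by simpa using h'⟩
      refine RunsIn.ite_false (by simp) (RunsIn.ite_false (by simp) ((act_runsIn _ _ _).seq ?_))
      simpa using h

end Mach

/-- `exists_lookup` for a `DTM`. -/
theorem DTM.exists_lookup (N : ℕ) (g : List Bool → List Bool) : ∃ (M : DTM) (B : ℕ),
    ∀ (x : List Bool) (v), (v = [] ∨ ∃ v', v = none :: v') →
      M.OutputsWithin (x.map some ++ v) B (g (x.take N)) := by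
  obtain ⟨M, B, h⟩ := Mach.exists_lookup N g
  obtain ⟨D, hD⟩ := M.exists_dtm
  refine ⟨D, B + 1, fun x v hv => ?_⟩
  obtain ⟨t, ht, T', h, h'⟩ := h x [] v hv
  obtain ⟨q, hq, h⟩ := hD _ _ _ h
  refine DTM.OutputsWithin.mono (t := t + 1) ⟨?_, ?_⟩ (by omega)
  · rw [DTM.HaltsWithin, DTM.config, init_eq_tp, h]
    exact hq
  · rw [DTM.config, init_eq_tp, h]
    exact h'.output

theorem inPoly_const (c : ℕ) : InPoly fun _ => c := by
  refine ⟨⟨Polynomial.C c, fun n => by simp⟩, ?_⟩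
  obtain ⟨M, B, h⟩ := DTM.exists_lookup 0 fun _ => binaryRep c
  exact ⟨M, Polynomial.C B, fun x => by simpa [tapeInput] using h x [] (.inl rfl)⟩

/-! ### Simulation of machines over the Boolean alphabet -/

namespace Mach

/-- The Boolean tape alphabet of `TM0`-machines inside of our alphabet. -/
def ofBit (b : Bool) : Option Bool := if b then some true else none

def ofBitMap : Turing.PointedMap Bool (Option Bool) := ⟨ofBit, rfl⟩

open Classical in
/-- A `TM0`-machine over the Boolean alphabet with finite support. -/
noncomputable def ofTM0 {Λ : Type} [Inhabited Λ] (M : Turing.TM0.Machine Bool Λ) (S : Finset Λ)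
    (h : default ∈ S) : Mach where
  S := S
  start := ⟨default, h⟩
  δ q a := (M q.1 a.isSome).bind fun r =>
    if h : r.1 ∈ S then
      match r.2 with
      | .move d => some (⟨r.1, h⟩, a, some d)
      | .write b => some (⟨r.1, h⟩, ofBit b, none)
    else none

/-- Since `ofBit` maps the Boolean blank `false` to the blank, it commutes with moves and writes,
and the simulation is step by step. The support `S` supplies the finite state set. -/
theorem ofTM0_runsFrom {Λ : Type} [Inhabited Λ] (M : Turing.TM0.Machine Bool Λ) (S : Finset Λ)
    (hS : Turing.TM0.Supports M S) {c c' : Turing.TM0.Cfg Bool Λ}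
    (h : c' ∈ StateTransition.eval (Turing.TM0.step M) c) (hc : c.q ∈ S) :
    ∃ t, (ofTM0 M S hS.1).RunsFrom t ⟨c.q, hc⟩ (c.Tape.map ofBitMap) (c'.Tape.map ofBitMap) := by
  obtain ⟨h', hf⟩ := StateTransition.mem_eval.1 h
  clear h
  induction h' using Relation.ReflTransGen.head_induction_on with
  | refl =>
    refine ⟨0, .halt ?_⟩
    obtain ⟨q, T⟩ := c'
    simp only [Turing.TM0.step, Option.map_eq_none_iff] at hf
    have : (ofBitMap.f T.head).isSome = T.head := by cases T.head <;> rfl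
    simp [ofTM0, Turing.Tape.map_fst, this, hf]
  | @head c d hcd _ ih =>
    obtain ⟨q, T⟩ := c
    simp only [Turing.TM0.step, Option.mem_def, Option.map_eq_some_iff] at hcd
    obtain ⟨⟨q', s⟩, hM, rfl⟩ := hcd
    have hq' : q' ∈ S := hS.2 hM hc
    obtain ⟨t, ih⟩ := ih hq'
    have : (ofBitMap.f T.head).isSome = T.head := by cases T.head <;> rfl
    cases s with
    | move d =>
      refine ⟨t + 1, .step (q' := (⟨q', hq'⟩ : S)) (a := (T.map ofBitMap).head) (d := some d) ?_ ?_⟩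
      · simp [ofTM0, Turing.Tape.map_fst, this, hM, hq']
      · simp only [actTape, Turing.Tape.write_self, ← Turing.Tape.map_move]
        exact ih
    | write b =>
      refine ⟨t + 1, .step (q' := (⟨q', hq'⟩ : S)) (a := ofBit b) (d := none) ?_ ?_⟩
      · simp [ofTM0, Turing.Tape.map_fst, this, hM, hq']
      · simp only [actTape]
        rw [Turing.Tape.map_write] at ih
        exact ih

end Mach

/-! ### Computable functions through Mathlib's stack machines -/

namespace StackSim
open Turing PartrecToTM2

instance : Fintype K' where
  elems := {.main, .rev, .aux, .stack}
  complete k := by cases k <;> decide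

abbrev Sym := TM2to1.Γ' K' fun _ => PartrecToTM2.Γ'

/-- A column of the stack tape with one symbol on the main stack. -/
def col (s : PartrecToTM2.Γ') : K' → Option PartrecToTM2.Γ' :=
  Function.update (fun _ => none) K'.main (some s)

/-- The tape that represents the number `a` on the main stack. -/
def cells (a : ℕ) : List Sym :=
  (true, col .cons) :: (trNat a).reverse.map ((fun s => (false, s)) ∘ col)

theorem exists_code {f : ℕ → ℕ} (hf : Computable f) :
    ∃ c : ToPartrec.Code, ∀ a, c.eval [a] = pure [f a] := by
  have h : Partrec (fun a => (f a : Part ℕ)) := hf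
  obtain ⟨c, hc⟩ := ToPartrec.Code.exists_code (Nat.Partrec'.part_iff₁.2 h)
  exact ⟨c, fun a => by simpa using! hc (a ::ᵥ .nil)⟩

/-- The bit `false` will be a blank, so blocks contain blanks inside. An extra leading bit is set
exactly for the symbols other than the default one; their blocks are thus recognised by their first
cell. -/
theorem exists_code_prefix : ∃ (n : ℕ) (enc : Sym → List.Vector Bool n)
    (dec : List.Vector Bool n → Sym), enc default = List.Vector.replicate n false ∧
    (∀ a, dec (enc a) = a) ∧ 0 < n ∧ ∀ a, a ≠ default → (enc a).toList.head? = some true := by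
  classical
  obtain ⟨n, enc, dec, h0, h⟩ := TM1to1.exists_enc_dec (Γ := Sym)
  refine ⟨n + 1, fun a => if a = default then List.Vector.replicate _ false else true ::ᵥ enc a,
    fun v => if v.head then dec v.tail else default, by simp, fun a => ?_, by simp, fun a ha => ?_⟩
  · by_cases ha : a = default
    · subst ha
      simp [List.Vector.replicate_succ]
    · simp [ha, h]
  · simp [ha]

/-- The simulation describes the final tape only through its projections to the stacks; as all
stacks except the main one are empty, these determine the columns. -/
theorem listBlank_eq {L : ListBlank (K' → Option PartrecToTM2.Γ')} {w : List PartrecToTM2.Γ'}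
    (h : ∀ k, L.map (proj k) = ListBlank.mk ((K'.elim w [] [] [] k).map some).reverse) :
    L = ListBlank.mk (w.reverse.map col) := by
  refine ListBlank.ext fun i => funext fun k => ?_
  rw [← proj_map_nth, h k, ListBlank.nth_mk, ListBlank.nth_mk, ← List.map_reverse,
    List.getI_eq_getElem?_getD, List.getI_eq_getElem?_getD, List.getElem?_map, List.getElem?_map]
  cases k <;> simp only [K'.elim, List.reverse_nil] <;> cases w.reverse[i]? <;> simp [col] <;> rfl

theorem map_proj_col (w : List PartrecToTM2.Γ') (k : K') :
    (ListBlank.mk (w.reverse.map col)).map (proj k)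
      = ListBlank.mk ((K'.elim w [] [] [] k).map some).reverse := by
  refine ListBlank.ext fun i => ?_
  rw [proj_map_nth, ListBlank.nth_mk, ListBlank.nth_mk, ← List.map_reverse,
    List.getI_eq_getElem?_getD, List.getI_eq_getElem?_getD, List.getElem?_map, List.getElem?_map]
  cases k <;> simp only [K'.elim, List.reverse_nil] <;> cases w.reverse[i]? <;> simp [col] <;> rfl

/-- The separator `cons` that closes the list `[a]` lies at the bottom of the stack and carries the
bottom mark. Stacks are stored from the bottom, so the digits follow with the most significant one
first. -/
theorem addBottom_col (a : ℕ) :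
    TM2to1.addBottom (ListBlank.mk ((trList [a]).reverse.map col)) = ListBlank.mk (cells a) := by
  have : (trList [a]).reverse = .cons :: (trNat a).reverse := by simp
  rw [this]
  change ListBlank.cons (Γ := Sym) (true, col .cons)
    (ListBlank.mk (((trNat a).reverse.map col).map fun s => ((false, s) : Sym))) = _
  refine (ListBlank.cons_mk (Γ := Sym) _ _).trans (congrArg ListBlank.mk (congrArg (List.cons _) ?_))
  exact List.map_map

/-- The block of bits of a symbol. -/
def block {n : ℕ} (enc : Sym → List.Vector Bool n) (s : Sym) : List (Option Bool) :=
  (enc s).toList.map Mach.ofBit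

/-- This composes Mathlib's reductions from codes to stack machines, to one tape of columns, to a
Boolean tape, and to `TM0`, followed by `ofTM0`. Input and result have the same format, since the
halting configuration keeps the result on the main stack. -/
theorem exists_mach {f : ℕ → ℕ} (hf : Computable f) {n : ℕ} {enc : Sym → List.Vector Bool n}
    {dec : List.Vector Bool n → Sym} (h0 : enc default = List.Vector.replicate n false)
    (hd : ∀ a, dec (enc a) = a) : ∃ M : Mach, ∀ a,
      M.Runs (tp [] ((cells a).flatMap (block enc))) (tp [] ((cells (f a)).flatMap (block enc))) := by
  obtain ⟨c, hc⟩ := exists_code hf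
  let : Inhabited PartrecToTM2.Λ' := ⟨trNormal c Cont'.halt⟩
  have s2 : TM2.Supports PartrecToTM2.tr (codeSupp c Cont'.halt) := tr_supports c _
  have s1 := TM2to1.tr_supports _ s2
  have s1' := TM1to1.tr_supports (enc := enc) (dec := dec) _ s1
  have s0 := TM1to0.tr_supports _ s1'
  refine ⟨Mach.ofTM0 (TM1to0.tr (TM1to1.tr enc dec (TM2to1.tr PartrecToTM2.tr))) _ s0.1, fun a => ?_⟩
  have e2 : PartrecToTM2.halt [f a] ∈ StateTransition.eval (TM2.step PartrecToTM2.tr)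
      (PartrecToTM2.init c [a]) := by
    rw [PartrecToTM2.tr_eval, hc]
    exact (Part.mem_map_iff _).2 ⟨_, Part.mem_some _, rfl⟩
  obtain ⟨b1, hb1, e1⟩ := StateTransition.tr_eval (TM2to1.tr_respects PartrecToTM2.tr)
    (TM2to1.TrCfg.mk (q := some (trNormal c Cont'.halt)) (v := none)
      (S := K'.elim (trList [a]) [] [] []) _ (map_proj_col (trList [a]))) e2
  obtain ⟨b1', rfl, e1'⟩ := StateTransition.tr_eval
    (TM1to1.tr_respects (enc := enc) (dec := dec) (enc0 := h0) _ hd) rfl e1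
  obtain ⟨b0, rfl, e0⟩ := StateTransition.tr_eval (TM1to0.tr_respects _) rfl e1'
  obtain ⟨t, ht⟩ := Mach.ofTM0_runsFrom _ _ s0 e0 s0.1
  refine ⟨t, ?_⟩
  have key : ∀ a, (TM1to1.trTape h0 (Tape.mk' ∅ (ListBlank.mk (cells a)))).map Mach.ofBitMap
      = tp [] ((cells a).flatMap (block enc)) := by
    intro a
    rw [TM1to1.trTape_mk', TM1to1.trTape', Tape.map_mk', ListBlank.flatMap_mk, ListBlank.map_mk,
      List.map_flatMap]
    rfl
  generalize hb : PartrecToTM2.halt [f a] = cc at hb1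
  obtain ⟨L, hL⟩ := hb1
  cases hb
  have hL' := listBlank_eq hL
  subst hL'
  have k1 := key a
  have k2 := key (f a)
  rw [← addBottom_col] at k1 k2
  rw [← k1, ← k2]
  exact ht

end StackSim

/-! ### Conversion of binary words into blocks -/

theorem tp_append_none (l r) : tp l (r ++ [none]) = tp l r := by
  simp only [tp, Turing.Tape.mk₂]
  congr 1
  apply Turing.ListBlank.ext
  intro i
  simp only [Turing.ListBlank.nth_mk, List.getI_eq_getElem?_getD]
  rcases lt_trichotomy i r.length with h | rfl | h
  · rw [List.getElem?_append_left h]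
  · simp; rfl
  · rw [List.getElem?_eq_none (by simp; omega), List.getElem?_eq_none (by omega)]

theorem tp_replicate_none (n : ℕ) (r) : tp (List.replicate n none) r = tp [] r := by
  simp only [tp, Turing.Tape.mk₂]
  congr 1
  apply Turing.ListBlank.ext
  intro i
  simp only [Turing.ListBlank.nth_mk, List.getI_eq_getElem?_getD]
  by_cases h : i < n <;> simp [h]
  rfl

namespace Mach

/-- Do nothing. -/
def skip : Mach := act id none

theorem skip_runs (T) : skip.Runs T T := ⟨1, by simpa [skip] using act_runsIn id none T⟩

theorem act_runs (w d T) : (act w d).Runs T (actTape T (w T.head) d) := ⟨1, act_runsIn w d T⟩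

def moveLeft : ℕ → Mach
  | 0 => skip
  | n + 1 => (act id (some .left)).seq (moveLeft n)

def moveRight : ℕ → Mach
  | 0 => skip
  | n + 1 => (act id (some .right)).seq (moveRight n)

def putRight : List (Option Bool) → Mach
  | [] => skip
  | c :: cs => (act (fun _ => c) (some .right)).seq (putRight cs)

theorem moveLeft_runs (v l x r) :
    (moveLeft v.length).Runs (tp (v ++ l) (x :: r)) (tp l (v.reverse ++ x :: r)) := by
  induction v generalizing x r with
  | nil => exact skip_runs _
  | cons c v ih =>
    refine (act_runs _ _ _).seq ?_
    simpa using ih c (x :: r)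

theorem moveLeft_runs_nil (n x r) :
    (moveLeft n).Runs (tp [] (x :: r)) (tp [] (List.replicate n none ++ x :: r)) := by
  induction n generalizing x r with
  | zero => exact skip_runs _
  | succ n ih =>
    refine (act_runs _ _ _).seq ?_
    rw [List.replicate_succ', List.append_assoc]
    simpa using ih none (x :: r)

theorem moveRight_runs (v l r) :
    (moveRight v.length).Runs (tp l (v ++ r)) (tp (v.reverse ++ l) r) := by
  induction v generalizing l with
  | nil => exact skip_runs _
  | cons c v ih =>
    refine (act_runs _ _ _).seq ?_
    simpa using ih (c :: l)

theorem putRight_runs (u v l r) (h : u.length = v.length) :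
    (putRight v).Runs (tp l (u ++ r)) (tp (v.reverse ++ l) r) := by
  induction v generalizing l u with
  | nil =>
    obtain rfl := List.length_eq_zero_iff.1 h
    exact skip_runs _
  | cons c v ih =>
    obtain ⟨d, u, rfl⟩ := List.exists_cons_of_length_eq_add_one h
    refine (act_runs _ _ _).seq ?_
    simpa using ih u (c :: l) (by simpa using h)

/-- A block of `n` cells whose first cell is not blank. -/
def IsBlock (n : ℕ) (b : List (Option Bool)) : Prop := b.length = n ∧ b.head? = some (some true)

/-- From the cell to the right of an area of blocks of length `n`, go to the position of the next
block to the left of them. -/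
def strideLeft (n : ℕ) : Mach := (moveLeft n).seq (loop Option.isSome (moveLeft n))

/-- After every jump by `n` cells the head is on the first cell of a block, which is not blank, or
on a blank to the left of all blocks. One test per jump is therefore enough, although blocks may
contain blanks. -/
theorem strideLeft_runs {n : ℕ} (hn : 0 < n) (bs : List (List (Option Bool)))
    (hb : ∀ b ∈ bs, IsBlock n b) (x r) : (strideLeft n).Runs
      (tp bs.flatten.reverse (x :: r)) (tp [] (List.replicate n none ++ bs.flatten ++ x :: r)) := by
  -- The first jump is unconditional because the starting cell may be blank; separating it from the
  -- loop lets the induction continue from any scanned symbol.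
  suffices ∃ T, (moveLeft n).Runs (tp bs.flatten.reverse (x :: r)) T ∧
      (loop Option.isSome (moveLeft n)).Runs T
        (tp [] (List.replicate n none ++ bs.flatten ++ x :: r)) by
    obtain ⟨T, h, h'⟩ := this
    exact h.seq h'
  induction bs using List.reverseRecOn generalizing x r with
  | nil =>
    obtain ⟨n, rfl⟩ := Nat.exists_eq_succ_of_ne_zero hn.ne'
    exact ⟨_, by simpa using moveLeft_runs_nil _ x r,
      by simpa [List.replicate_succ] using Runs.loop_false (by simp)⟩
  | append_singleton bs b ih =>
    obtain ⟨hl, hh⟩ := hb b (by simp)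
    obtain ⟨b', rfl⟩ : ∃ b', b = some true :: b' := by
      cases b <;> simp_all
    obtain ⟨T, h, h'⟩ := ih (fun b h => hb b (by simp [h])) (some true) (b' ++ x :: r)
    refine ⟨tp bs.flatten.reverse (some true :: b' ++ x :: r), ?_, ?_⟩
    · have := moveLeft_runs (some true :: b').reverse bs.flatten.reverse x r
      rw [List.length_reverse, hl] at this
      simpa using this
    · refine Runs.loop_true (by simp) h ?_
      simpa using h'

theorem strideRight_runs {n : ℕ} (bs : List (List (Option Bool)))
    (hb : ∀ b ∈ bs, IsBlock n b) (l r) : (loop Option.isSome (moveRight n)).Runs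
      (tp l (bs.flatten ++ none :: r)) (tp (bs.flatten.reverse ++ l) (none :: r)) := by
  induction bs generalizing l with
  | nil => exact Runs.loop_false (by simp)
  | cons b bs ih =>
    obtain ⟨hl, hh⟩ := hb b (by simp)
    have h := moveRight_runs b l (bs.flatten ++ none :: r)
    rw [hl] at h
    refine Runs.loop_true (T' := tp (b.reverse ++ l) (bs.flatten ++ none :: r)) ?_ ?_ ?_
    · cases b <;> simp_all
    · simpa using h
    · simpa using ih (fun b h => hb b (by simp [h])) (b.reverse ++ l)

/-- Write a block to the left of an area of blocks and return to the cell right of them. -/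
def addBlock (n : ℕ) (b : List (Option Bool)) : Mach :=
  (strideLeft n).seq ((putRight b).seq (loop Option.isSome (moveRight n)))

theorem addBlock_runs {n : ℕ} (hn : 0 < n) (bs : List (List (Option Bool)))
    (hb : ∀ b ∈ bs, IsBlock n b) {b} (hb' : IsBlock n b) (r) : (addBlock n b).Runs
      (tp bs.flatten.reverse (none :: r)) (tp (b :: bs).flatten.reverse (none :: r)) := by
  refine (strideLeft_runs hn bs hb none r).seq
    (Runs.seq (T' := tp b.reverse (bs.flatten ++ none :: r)) ?_ ?_)
  · simpa using putRight_runs (List.replicate n none) b [] (bs.flatten ++ none :: r) (by simp [hb'.1])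
  · simpa using strideRight_runs bs hb b.reverse r

/-- Go to the last non-blank symbol in front of the next blank. -/
def goEnd : Mach :=
  (act id (some .right)).seq ((loop Option.isSome (act id (some .right))).seq (act id (some .left)))

/-- The head is on the last symbol of the word that is the reverse of `w`, or on the blank `none` in
front of it if `w` is empty. -/
def endTape (l : List (Option Bool)) : List Bool → Turing.Tape (Option Bool)
  | [] => tp l [none]
  | b :: w => tp (w.map some ++ none :: l) [some b]

theorem scanRight_runs (l) (s : List Bool) : (loop Option.isSome (act id (some .right))).Runs
    (tp l (s.map some)) (tp (s.reverse.map some ++ l) []) := by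
  induction s generalizing l with
  | nil => exact Runs.loop_false (by simp)
  | cons b s ih =>
    refine Runs.loop_true (by simp) (act_runs _ _ _) ?_
    simpa using ih (some b :: l)

theorem goEnd_runs (l) (s : List Bool) :
    goEnd.Runs (tp l (none :: s.map some)) (endTape l s.reverse) := by
  refine (act_runs _ _ _).seq (Runs.seq (T' := tp (s.reverse.map some ++ none :: l) []) ?_ ?_)
  · simpa using scanRight_runs (none :: l) s
  · rw [tp_nil]
    convert! act_runs id (some .left) (tp (s.reverse.map some ++ none :: l) [none]) using 1
    generalize s.reverse = w
    cases w with
    | nil => simpa [endTape] using (tp_append_none l [none]).symm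
    | cons b w => simpa [endTape] using (tp_append_none _ [some b]).symm

theorem scanLeft_runs (l) (w : List Bool) (r) :
    (loop Option.isSome (act id (some .left))).Runs
      (match w with
        | [] => tp l (none :: r)
        | b :: w => tp (w.map some ++ none :: l) (some b :: r))
      (tp l (none :: (w.reverse.map some ++ r))) := by
  induction w generalizing r with
  | nil => exact Runs.loop_false (by simp)
  | cons b w ih =>
    refine Runs.loop_true (by simp) (act_runs _ _ _) ?_
    have := ih (some b :: r)
    cases w with
    | nil => simpa using this
    | cons c w => simpa using this

/-- Convert the last symbol of the word into a block. -/
def convertLast (n : ℕ) (b : List (Option Bool)) : Mach :=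
  (act (fun _ => none) (some .left)).seq
    ((loop Option.isSome (act id (some .left))).seq ((addBlock n b).seq goEnd))

/-- The tape holds the blocks made so far, one blank, and the unread rest of the word. The last
symbol of the rest is erased and its block is put in front of the other blocks, which preserves the
order of the word. -/
theorem convertLast_runs {n : ℕ} (hn : 0 < n) (bs : List (List (Option Bool)))
    (hb : ∀ b ∈ bs, IsBlock n b) {b} (hb' : IsBlock n b) (c : Bool) (w : List Bool) :
    (convertLast n b).Runs (endTape bs.flatten.reverse (c :: w))
      (endTape (b :: bs).flatten.reverse w) := by
  refine (act_runs _ _ _).seq (Runs.seq (T' := tp bs.flatten.reverse (none :: w.reverse.map some)) ?_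
    ((addBlock_runs hn bs hb hb' _).seq (by simpa using goEnd_runs (b :: bs).flatten.reverse w.reverse)))
  have h := scanLeft_runs bs.flatten.reverse w [none]
  rw [← List.cons_append, tp_append_none] at h
  cases w with
  | nil => simpa [endTape] using h
  | cons d w => simpa [endTape] using h

/-- Convert a word to the left of which all cells are blank into a series of blocks. -/
def convert (n : ℕ) (blk : Bool → List (Option Bool)) (b₀ : List (Option Bool)) : Mach :=
  goEnd.seq ((loop Option.isSome
    (ite (· == some true) (convertLast n (blk true)) (convertLast n (blk false)))).seq
      ((addBlock n b₀).seq (strideLeft n |>.seq (moveRight n))))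

theorem convert_runs {n : ℕ} (hn : 0 < n) {blk : Bool → List (Option Bool)} {b₀}
    (hb : ∀ b, IsBlock n (blk b)) (hb₀ : IsBlock n b₀) (s : List Bool) :
    (convert n blk b₀).Runs (tp [] (none :: s.map some))
      (tp [] (b₀ ++ s.flatMap blk)) := by
  have h : ∀ (w : List Bool) (bs : List (List (Option Bool))), (∀ b ∈ bs, IsBlock n b) →
      (loop Option.isSome
        (ite (· == some true) (convertLast n (blk true)) (convertLast n (blk false)))).Runs
        (endTape bs.flatten.reverse w)
        (tp (w.reverse.map blk ++ bs).flatten.reverse [none]) := by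
    intro w
    induction w with
    | nil => exact fun bs _ => Runs.loop_false (by simp [endTape])
    | cons c w ih =>
      intro bs hbs
      refine Runs.loop_true (T' := endTape (blk c :: bs).flatten.reverse w) (by simp [endTape]) ?_ ?_
      · cases c
        · exact Runs.ite_false (by simp [endTape]) (convertLast_runs hn bs hbs (hb _) _ _)
        · exact Runs.ite_true (by simp [endTape]) (convertLast_runs hn bs hbs (hb _) _ _)
      · simpa using ih (blk c :: bs) (by simpa [hb] using hbs)
  have h1 := h s.reverse [] (by simp)
  have hs : ∀ b ∈ s.map blk, IsBlock n b := by
    intro b h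
    obtain ⟨c, -, rfl⟩ := List.mem_map.1 h
    exact hb c
  have hs' : ∀ b ∈ b₀ :: s.map blk, IsBlock n b := by
    intro b h
    rcases List.mem_cons.1 h with rfl | h
    exacts [hb₀, hs b h]
  have h2 := addBlock_runs hn _ hs hb₀ []
  have h3 := strideLeft_runs hn _ hs' none []
  -- `strideLeft` stops one block width to the left of the blocks; the blanks that are crossed on
  -- the way back disappear in the representation of the tape.
  have h4 := moveRight_runs (List.replicate n none) [] ((b₀ :: s.map blk).flatten ++ [none])
  rw [tp_append_none, List.length_replicate, List.reverse_replicate, List.append_nil,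
    tp_replicate_none] at h4
  refine (goEnd_runs [] s).seq (Runs.seq (T' := tp (s.map blk).flatten.reverse [none]) ?_
    (h2.seq (Runs.seq h3 ?_)))
  · simpa using h1
  · simpa [List.flatMap] using h4

end Mach

/-! Primitive recursive functions in the form needed by `fun_prop`. -/

attribute [fun_prop] Primrec

namespace Primrec
variable {α β γ σ : Type*} [Primcodable α] [Primcodable β] [Primcodable γ] [Primcodable σ]

attribute [fun_prop] Primrec.const Primrec.comp

@[fun_prop] theorem id' : Primrec fun a : α => a := Primrec.id

@[fun_prop] theorem prodMk {f : α → β} {g : α → γ} (hf : Primrec f) (hg : Primrec g) :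
    Primrec fun a => (f a, g a) := hf.pair hg

@[fun_prop] theorem fst' {f : α → β × γ} (hf : Primrec f) : Primrec fun a => (f a).1 := fst.comp hf

@[fun_prop] theorem snd' {f : α → β × γ} (hf : Primrec f) : Primrec fun a => (f a).2 := snd.comp hf

@[fun_prop] theorem add' {f g : α → ℕ} (hf : Primrec f) (hg : Primrec g) :
    Primrec fun a => f a + g a := nat_add.comp hf hg

@[fun_prop] theorem mul' {f g : α → ℕ} (hf : Primrec f) (hg : Primrec g) :
    Primrec fun a => f a * g a := nat_mul.comp hf hg

@[fun_prop] theorem sub' {f g : α → ℕ} (hf : Primrec f) (hg : Primrec g) :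
    Primrec fun a => f a - g a := nat_sub.comp hf hg

@[fun_prop] theorem div' {f g : α → ℕ} (hf : Primrec f) (hg : Primrec g) :
    Primrec fun a => f a / g a := nat_div.comp hf hg

@[fun_prop] theorem mod' {f g : α → ℕ} (hf : Primrec f) (hg : Primrec g) :
    Primrec fun a => f a % g a := nat_mod.comp hf hg

@[fun_prop] theorem pow' {f g : α → ℕ} (hf : Primrec f) (hg : Primrec g) :
    Primrec fun a => f a ^ g a :=
  (Primrec₂.unpaired'.1 Nat.Primrec.pow : Primrec₂ fun a b : ℕ => a ^ b).comp hf hg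

@[fun_prop] theorem bodd' {f : α → ℕ} (hf : Primrec f) : Primrec fun a => (f a).bodd :=
  nat_bodd.comp hf

@[fun_prop] theorem decide_eq' [DecidableEq β] {f g : α → β} (hf : Primrec f) (hg : Primrec g) :
    Primrec fun a => decide (f a = g a) := Primrec.eq.decide.comp hf hg

@[fun_prop] theorem ble' {f g : α → ℕ} (hf : Primrec f) (hg : Primrec g) :
    Primrec fun a => (f a).ble (g a) := by
  have h : Primrec fun a => decide (f a ≤ g a) := nat_le.decide.comp hf hg
  refine h.of_eq fun a => ?_
  rw [Bool.eq_iff_iff]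
  simp

@[fun_prop] theorem cond' {c : α → Bool} {f g : α → β} (hc : Primrec c) (hf : Primrec f)
    (hg : Primrec g) : Primrec fun a => bif c a then f a else g a := cond hc hf hg

@[fun_prop] theorem and' {f g : α → Bool} (hf : Primrec f) (hg : Primrec g) :
    Primrec fun a => f a && g a := Primrec.and.comp hf hg

@[fun_prop] theorem or' {f g : α → Bool} (hf : Primrec f) (hg : Primrec g) :
    Primrec fun a => f a || g a := Primrec.or.comp hf hg

@[fun_prop] theorem xor' {f g : α → Bool} (hf : Primrec f) (hg : Primrec g) :
    Primrec fun a => xor (f a) (g a) := (Primrec.dom_bool₂ xor).comp hf hg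

@[fun_prop] theorem not' {f : α → Bool} (hf : Primrec f) : Primrec fun a => !f a :=
  Primrec.not.comp hf

@[fun_prop] theorem some' {f : α → β} (hf : Primrec f) : Primrec fun a => some (f a) :=
  option_some.comp hf

@[fun_prop] theorem isSome' {f : α → Option β} (hf : Primrec f) : Primrec fun a => (f a).isSome :=
  option_isSome.comp hf

@[fun_prop] theorem getD' {f : α → Option β} {g : α → β} (hf : Primrec f) (hg : Primrec g) :
    Primrec fun a => (f a).getD (g a) := option_getD.comp hf hg

@[fun_prop] theorem optionMap' {f : α → Option β} {g : α → β → σ} (hf : Primrec f)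
    (hg : Primrec fun p : α × β => g p.1 p.2) : Primrec fun a => (f a).map (g a) :=
  option_map hf hg

@[fun_prop] theorem optionBind' {f : α → Option β} {g : α → β → Option σ} (hf : Primrec f)
    (hg : Primrec fun p : α × β => g p.1 p.2) : Primrec fun a => (f a).bind (g a) :=
  option_bind hf hg

@[fun_prop] theorem cons' {f : α → β} {g : α → List β} (hf : Primrec f) (hg : Primrec g) :
    Primrec fun a => f a :: g a := list_cons.comp hf hg

@[fun_prop] theorem append' {f g : α → List β} (hf : Primrec f) (hg : Primrec g) :
    Primrec fun a => f a ++ g a := list_append.comp hf hg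

@[fun_prop] theorem reverse' {f : α → List β} (hf : Primrec f) : Primrec fun a => (f a).reverse :=
  list_reverse.comp hf

@[fun_prop] theorem length' {f : α → List β} (hf : Primrec f) : Primrec fun a => (f a).length :=
  list_length.comp hf

@[fun_prop] theorem range' {f : α → ℕ} (hf : Primrec f) : Primrec fun a => List.range (f a) :=
  list_range.comp hf

@[fun_prop] theorem tail' {f : α → List β} (hf : Primrec f) : Primrec fun a => (f a).tail :=
  list_tail.comp hf

@[fun_prop] theorem head?' {f : α → List β} (hf : Primrec f) : Primrec fun a => (f a).head? :=
  list_head?.comp hf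

@[fun_prop] theorem headI' [Inhabited β] {f : α → List β} (hf : Primrec f) :
    Primrec fun a => (f a).headI := list_headI.comp hf

@[fun_prop] theorem take' {f : α → ℕ} {g : α → List β} (hf : Primrec f) (hg : Primrec g) :
    Primrec fun a => (g a).take (f a) := list_take.comp hf hg

@[fun_prop] theorem drop' {f : α → ℕ} {g : α → List β} (hf : Primrec f) (hg : Primrec g) :
    Primrec fun a => (g a).drop (f a) := list_drop.comp hf hg

@[fun_prop] theorem listGetElem?' {f : α → List β} {g : α → ℕ} (hf : Primrec f) (hg : Primrec g) :
    Primrec fun a => (f a)[g a]? := list_getElem?.comp hf hg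

@[fun_prop] theorem listGetD' {f : α → List β} {g : α → ℕ} {d : α → β} (hf : Primrec f)
    (hg : Primrec g) (hd : Primrec d) : Primrec fun a => (f a).getD (g a) (d a) := by
  simp only [List.getD_eq_getElem?_getD]
  fun_prop

@[fun_prop] theorem map' {f : α → List β} {g : α → β → σ} (hf : Primrec f)
    (hg : Primrec fun p : α × β => g p.1 p.2) : Primrec fun a => (f a).map (g a) := list_map hf hg

@[fun_prop] theorem flatMap' {f : α → List β} {g : α → β → List σ} (hf : Primrec f)
    (hg : Primrec fun p : α × β => g p.1 p.2) : Primrec fun a => (f a).flatMap (g a) :=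
  list_flatMap hf hg

@[fun_prop] theorem filter' {f : α → List β} {p : α → β → Bool} (hf : Primrec f)
    (hp : Primrec fun q : α × β => p q.1 q.2) : Primrec fun a => (f a).filter (p a) := by
  have h : Primrec fun a => (f a).flatMap fun b => bif p a b then [b] else [] := by fun_prop
  refine h.of_eq fun a => ?_
  induction f a with
  | nil => rfl
  | cons b l ih => rw [List.flatMap_cons, ih, List.filter_cons]; cases p a b <;> rfl

@[fun_prop] theorem foldr' {f : α → List β} {g : α → σ} {h : α → β → σ → σ} (hf : Primrec f)
    (hg : Primrec g) (hh : Primrec fun p : α × β × σ => h p.1 p.2.1 p.2.2) :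
    Primrec fun a => (f a).foldr (h a) (g a) :=
  list_foldr hf hg (h := fun a p => h a p.1 p.2) hh

@[fun_prop] theorem foldl' {f : α → List β} {g : α → σ} {h : α → σ → β → σ} (hf : Primrec f)
    (hg : Primrec g) (hh : Primrec fun p : α × σ × β => h p.1 p.2.1 p.2.2) :
    Primrec fun a => (f a).foldl (h a) (g a) :=
  list_foldl hf hg (h := fun a p => h a p.1 p.2) hh

@[fun_prop] theorem all' {f : α → List β} {p : α → β → Bool} (hf : Primrec f)
    (hp : Primrec fun q : α × β => p q.1 q.2) : Primrec fun a => (f a).all (p a) := by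
  have h : Primrec fun a => (f a).foldr (fun b c => p a b && c) true := by fun_prop
  refine h.of_eq fun a => ?_
  induction f a with
  | nil => rfl
  | cons b l ih => rw [List.foldr_cons, ih, List.all_cons]

@[fun_prop] theorem any' {f : α → List β} {p : α → β → Bool} (hf : Primrec f)
    (hp : Primrec fun q : α × β => p q.1 q.2) : Primrec fun a => (f a).any (p a) := by
  have h : Primrec fun a => (f a).foldr (fun b c => p a b || c) false := by fun_prop
  refine h.of_eq fun a => ?_
  induction f a with
  | nil => rfl
  | cons b l ih => rw [List.foldr_cons, ih, List.any_cons]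

@[fun_prop] theorem sum' {f : α → List ℕ} (hf : Primrec f) : Primrec fun a => (f a).sum := by
  simp only [List.sum]
  fun_prop

@[fun_prop] theorem replicate' {f : α → ℕ} {g : α → β} (hf : Primrec f) (hg : Primrec g) :
    Primrec fun a => List.replicate (f a) (g a) := by
  have h : Primrec fun a => (List.range (f a)).map fun _ => g a := by fun_prop
  exact h.of_eq fun a => by simp

@[fun_prop] theorem find?' {f : α → List β} {p : α → β → Bool} (hf : Primrec f)
    (hp : Primrec fun q : α × β => p q.1 q.2) : Primrec fun a => (f a).find? (p a) := by
  have h : Primrec fun a => ((f a).filter (p a)).head? := by fun_prop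
  exact h.of_eq fun a => by simp

@[fun_prop] theorem iterate' {f : α → ℕ} {g : α → β} {h : α → β → β} (hf : Primrec f)
    (hg : Primrec g) (hh : Primrec fun p : α × β => h p.1 p.2) :
    Primrec fun a => (h a)^[f a] (g a) := nat_iterate hf hg hh

end Primrec

/-! Binary numbers. -/

/-- The number with the given binary digits, most significant digit first. -/
def bitsVal (s : List Bool) : ℕ := s.foldl (fun a b => 2 * a + bif b then 1 else 0) 0

theorem bitsVal_append (s : List Bool) (b : Bool) :
    bitsVal (s ++ [b]) = Nat.bit b (bitsVal s) := by
  cases b <;> simp [bitsVal, Nat.bit_val]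

@[fun_prop] theorem primrec_bitsVal {α} [Primcodable α] {f : α → List Bool} (hf : Primrec f) :
    Primrec fun a => bitsVal (f a) := by
  unfold bitsVal
  fun_prop

/-- A leading `true` excludes leading zeros, so the word can be recovered from its value. For this
reason the universal machine is only used on words that start with `1`. -/
theorem bits_bitsVal (s : List Bool) : (bitsVal (true :: s)).bits = (true :: s).reverse ∧
    bitsVal (true :: s) ≠ 0 := by
  induction s using List.reverseRecOn with
  | nil => simp [bitsVal]
  | append_singleton s b ih =>
    rw [← List.cons_append, bitsVal_append, Nat.bits_append_bit _ _ fun h => absurd h ih.2]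
    refine ⟨by simp [ih.1], fun h => ih.2 ?_⟩
    exact (Nat.bit_eq_zero_iff.1 h).1

theorem bitsVal_reverse_bits (n : ℕ) : bitsVal n.bits.reverse = n := by
  induction n using Nat.binaryRec' with
  | zero => rfl
  | bit b n h ih => rw [Nat.bits_append_bit _ _ h, List.reverse_cons, bitsVal_append, ih]

theorem bitsVal_binaryRep (n : ℕ) : bitsVal (binaryRep n) = n := by
  unfold binaryRep
  split_ifs with h
  · rw [h]; rfl
  · exact bitsVal_reverse_bits n

@[fun_prop] theorem primrec_bits {α} [Primcodable α] {f : α → ℕ} (hf : Primrec f) :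
    Primrec fun a => (f a).bits := by
  suffices Primrec Nat.bits from this.comp hf
  let step : ℕ × List Bool → ℕ × List Bool := fun p =>
    bif decide (p.1 = 0) then p else (p.1 / 2, p.1.bodd :: p.2)
  -- Every step at least halves a nonzero number, so `n` steps exhaust it, and further steps change
  -- nothing; the digits pile up in reverse order.
  have key : ∀ k n l, n ≤ k → (step^[k] (n, l)).2 = n.bits.reverse ++ l := by
    intro k
    induction k with
    | zero => intro n l h; obtain rfl : n = 0 := by omega
              rfl
    | succ k ih =>
      intro n l h
      rw [Function.iterate_succ_apply]
      by_cases hn : n = 0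
      · subst hn
        exact ih 0 l (by omega)
      · have : step (n, l) = (n / 2, n.bodd :: l) := by simp [step, hn]
        rw [this, ih _ _ (by omega)]
        conv_rhs => rw [← Nat.bit_bodd_div2 n]
        rw [Nat.bits_append_bit _ _ fun h => ?_, Nat.div2_val]
        · simp
        · rw [Nat.div2_val] at h
          obtain rfl : n = 1 := by omega
          rfl
  have h : Primrec fun n => (step^[n] (n, [])).2.reverse := by
    have : Primrec step := by unfold step; fun_prop
    fun_prop
  exact h.of_eq fun n => by simp [key n n [] le_rfl]

@[fun_prop] theorem primrec_binaryRep {α} [Primcodable α] {f : α → ℕ} (hf : Primrec f) :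
    Primrec fun a => binaryRep (f a) := by
  have h : Primrec fun a => bif decide (f a = 0) then [false] else (f a).bits.reverse := by
    fun_prop
  exact h.of_eq fun a => by simp [binaryRep, Bool.cond_decide]

/-! Computable functions by machines over the three-letter alphabet. -/

namespace StackSim
open Turing PartrecToTM2

def bitSym (b : Bool) : PartrecToTM2.Γ' := bif b then .bit1 else .bit0

theorem trNat_eq (n : ℕ) : trNat n = n.bits.map bitSym := by
  induction n using Nat.binaryRec' with
  | zero => rfl
  | bit b n h ih =>
    rw [Nat.bits_append_bit _ _ h, List.map_cons, ← ih]
    unfold trNat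
    rw [← Num.ofNat'_eq, ← Num.ofNat'_eq, Num.ofNat'_bit]
    rcases hn : Num.ofNat' n with _ | p
    · obtain rfl : n = 0 := by
        have := Num.ofNat'_eq n ▸ hn
        simpa using congrArg (fun k : Num => (k : ℕ)) this
      rw [h rfl]; rfl
    · cases b <;> rfl

theorem cells_bitsVal (s : List Bool) : cells (bitsVal (true :: s)) =
    (true, col .cons) :: (true :: s).map fun b => (false, col (bitSym b)) := by
  rw [cells, trNat_eq, (bits_bitsVal s).1, ← List.map_reverse, List.reverse_reverse, List.map_map]
  rfl

theorem flatMap_cells {n : ℕ} (enc : Sym → List.Vector Bool n) (s : List Bool) :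
    (cells (bitsVal (true :: s))).flatMap (block enc) = block enc (true, col .cons) ++
      (true :: s).flatMap fun b => block enc (false, col (bitSym b)) :=
  (congrArg (List.flatMap (block enc)) (cells_bitsVal s)).trans
    (List.flatMap_cons.trans (congrArg _ (List.flatMap_map _ _ _)))

theorem mk_col_ne_default (b : Bool) (s : PartrecToTM2.Γ') : ((b, col s) : Sym) ≠ default := by
  intro h
  have := congrFun (congrArg Prod.snd h) K'.main
  simp [col] at this

end StackSim

/-- The output of a total decider. -/
def answer : ℕ → List Bool
  | 0 => [false]
  | 1 => [true]
  | _ => [true, false]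

open StackSim in
/-- For a computable function there is a machine that gives the answers for all inputs that start
with `1`. -/
theorem exists_dtm_of_computable {f : ℕ → ℕ} (hf : Computable f) (h2 : ∀ n, f n ≤ 2) :
    ∃ D : DTM, ∀ s, D.Outputs (tapeInput (true :: s)) (answer (f (bitsVal (true :: s)))) := by
  obtain ⟨n, enc, dec, h0, hd, hn, he⟩ := exists_code_prefix
  obtain ⟨M, hM⟩ := exists_mach hf h0 hd
  have hblk : ∀ b s, Mach.IsBlock n (block enc (b, col s)) := fun b s => by
    have := he _ (mk_col_ne_default b s)
    exact ⟨by simp [block], by simp [block, this, Mach.ofBit]⟩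
  -- The results `0`, `1`, `2` have the digits `ε`, `1`, `10`, so it suffices to find out whether
  -- zero, one or two blocks follow the bottom mark.
  let post : Mach := (Mach.moveRight n).seq (.ite Option.isSome
    ((Mach.moveRight n).seq (.ite Option.isSome (.writeWord [true, false]) (.writeWord [true])))
    (.writeWord [false]))
  have ww : ∀ w l r, ∃ T', (Mach.writeWord w).Runs (tp l r) T' ∧ HasOutput T' w := fun w l r => by
    obtain ⟨t, h⟩ := Mach.writeWord_runs w
    obtain ⟨T', h, h'⟩ := h l r
    exact ⟨T', ⟨t, h⟩, h'⟩
  have mr : ∀ b s l r, (Mach.moveRight n).Runs (tp l (block enc (b, col s) ++ r))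
      (tp ((block enc (b, col s)).reverse ++ l) r) := fun b s l r => by
    simpa only [(hblk b s).1] using Mach.moveRight_runs (block enc (b, col s)) l r
  have hs : ∀ b s l r, Option.isSome (tp l (block enc (b, col s) ++ r)).head = true := by
    intro b s l r
    have := (hblk b s).2
    rcases h : block enc (b, col s) with _ | ⟨c, t⟩ <;> simp_all
  have hpost : ∀ k ≤ 2, ∃ T', post.Runs (tp [] ((cells k).flatMap (block enc))) T' ∧
      HasOutput T' (answer k) := by
    intro k hk
    rw [cells, trNat_eq]
    obtain rfl | rfl | rfl : k = 0 ∨ k = 1 ∨ k = 2 := by omega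
    · obtain ⟨T', h, h'⟩ := ww [false] ((block enc (true, col .cons)).reverse ++ []) []
      exact ⟨T', (mr true .cons _ _).seq (Mach.Runs.ite_false rfl h), h'⟩
    · obtain ⟨T', h, h'⟩ := ww [true]
        ((block enc (false, col .bit1)).reverse ++ ((block enc (true, col .cons)).reverse ++ [])) []
      refine ⟨T', (mr true .cons _ _).seq (Mach.Runs.ite_true ?_
        ((mr false .bit1 _ _).seq (Mach.Runs.ite_false rfl h))), h'⟩
      exact hs false .bit1 _ _
    · obtain ⟨T', h, h'⟩ := ww [true, false]
        ((block enc (false, col .bit1)).reverse ++ ((block enc (true, col .cons)).reverse ++ []))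
        (block enc (false, col .bit0) ++ [])
      refine ⟨T', (mr true .cons _ _).seq (Mach.Runs.ite_true ?_
        ((mr false .bit1 _ _).seq (Mach.Runs.ite_true ?_ h))), h'⟩
      · exact hs false .bit1 _ _
      · exact hs false .bit0 _ _
  -- `convert` expects the head on the blank in front of the word, hence the initial move to the
  -- left.
  let U : Mach := (Mach.act id (some .left)).seq
    ((Mach.convert n (fun b => block enc (false, col (bitSym b))) (block enc (true, col .cons))).seq
      (M.seq post))
  obtain ⟨D, hD⟩ := U.exists_dtm
  refine ⟨D, fun s => ?_⟩
  obtain ⟨T', h, h'⟩ := hpost _ (h2 (bitsVal (true :: s)))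
  have hM' := hM (bitsVal (true :: s))
  rw [flatMap_cells] at hM'
  have hU : U.Runs (tp [] ((true :: s).map some)) T' := by
    refine (Mach.act_runs _ _ _).seq (.seq ?_ (hM'.seq h))
    simpa using Mach.convert_runs hn (fun b => hblk false (bitSym b)) (hblk true .cons) (true :: s)
  obtain ⟨t, ht⟩ := hU
  obtain ⟨q, hq, ht⟩ := hD _ _ _ ht
  refine ⟨t + 1, ?_, ?_⟩
  · rw [DTM.HaltsWithin, DTM.config, init_eq_tp, tapeInput, ht]
    exact hq
  · rw [DTM.config, init_eq_tp, tapeInput, ht]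
    exact h'.output

/-! Writing the index in front of the input. -/

namespace DTM

/-- The transitions of the states that write `1^(i+1) 0` in front of the input; the states are
given as numbers. -/
def prefixRow (i q : ℕ) (a : Option Bool) : ℕ × Option Bool × Option Turing.Dir :=
  if q = 0 then (1, a, some .left)
  else if q = 1 then (2, some false, some .left)
  else if q = i + 2 then (q + 1, some true, none)
  else (q + 1, some true, some .left)

/-- Write `1^(i+1) 0` in front of the input and then run `U`. -/
def withPrefix (U : DTM) (i : ℕ) : DTM where
  n := U.n + (i + 3)
  final q := if h : q.1 < i + 3 then false else U.final ⟨q.1 - (i + 3), by omega⟩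
  δ q a := if h : q.1 < i + 3 then
      (⟨(prefixRow i q.1 a).1, by unfold prefixRow; split_ifs <;> simp <;> omega⟩,
        (prefixRow i q.1 a).2)
    else
      let r := U.δ ⟨q.1 - (i + 3), by omega⟩ a
      (⟨r.1.1 + (i + 3), by omega⟩, r.2)

variable (U : DTM) (i : ℕ)

/-- A configuration of `U` as a configuration of `U.withPrefix i`. -/
def shift (c : TMConfig U.n) : TMConfig (U.withPrefix i).n :=
  ⟨⟨c.state.1 + (i + 3), by simp only [withPrefix]; omega⟩, c.tape⟩

theorem withPrefix_final (c : TMConfig U.n) :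
    (U.withPrefix i).final (shift U i c).state = U.final c.state := by
  simp [withPrefix, shift]

theorem withPrefix_step (c : TMConfig U.n) :
    (U.withPrefix i).step (shift U i c) = shift U i (U.step c) := by
  unfold DTM.step
  rw [withPrefix_final]
  split_ifs with h
  · rfl
  · simp only [withPrefix, shift, TMConfig.act]
    simp

theorem withPrefix_iterate (c : TMConfig U.n) (t : ℕ) :
    (U.withPrefix i).step^[t] (shift U i c) = shift U i (U.step^[t] c) := by
  induction t generalizing c with
  | zero => rfl
  | succ t ih => rw [Function.iterate_succ_apply, Function.iterate_succ_apply, withPrefix_step, ih]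

theorem withPrefix_step_of_lt {q : ℕ} (hq : q < i + 3) (T) (h : q < (U.withPrefix i).n + 1) :
    (U.withPrefix i).step ⟨⟨q, h⟩, T⟩ =
      ⟨⟨(prefixRow i q T.head).1, by
        unfold prefixRow; split_ifs <;> simp [withPrefix] <;> omega⟩,
        actTape T (prefixRow i q T.head).2.1 (prefixRow i q T.head).2.2⟩ := by
  simp only [DTM.step, withPrefix, hq, dite_true, TMConfig.act, Bool.false_eq_true, if_false]
  refine congrArg (TMConfig.mk _) ?_
  cases (prefixRow i q T.head).2.2 <;> rfl

/-- In state `i - j + 2` there are `j + 1` ones left to write, from right to left. The last one is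
written without a move, and the next state `i + 3` is the shifted initial state of `U`. -/
theorem withPrefix_write (j : ℕ) (hj : j ≤ i) (r) (h : i - j + 2 < (U.withPrefix i).n + 1) :
    (U.withPrefix i).step^[j + 1] ⟨⟨i - j + 2, h⟩, tp [] (none :: r)⟩ =
      shift U i ⟨0, tp [] (List.replicate (j + 1) (some true) ++ r)⟩ := by
  induction j generalizing r with
  | zero =>
    rw [zero_add, Function.iterate_one, withPrefix_step_of_lt U i (by omega)]
    simp [prefixRow, shift]
  | succ j ih =>
    rw [Function.iterate_succ_apply, withPrefix_step_of_lt U i (by omega)]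
    have h1 : i - (j + 1) ≠ i := by omega
    have h2 : i - (j + 1) + 1 = i - j := by omega
    have := ih (by omega) (some true :: r) (by simp [withPrefix]; omega)
    simp only [prefixRow]
    simp [h1]
    rw [List.replicate_succ', List.append_assoc]
    refine Eq.trans ?_ this
    exact congrArg (fun q => (U.withPrefix i).step^[j + 1] ⟨q, _⟩) (Fin.ext (by simp; omega))

/-- Two steps leave the input and write the `0`; the remaining `i + 1` steps write the ones. -/
theorem withPrefix_start (x : List Bool) : ∃ t,
    (U.withPrefix i).step^[t] (TMConfig.init _ (tapeInput x)) =
      shift U i (TMConfig.init _ (tapeInput (List.replicate (i + 1) true ++ false :: x))) := by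
  refine ⟨(i + 1) + 2, ?_⟩
  -- For the empty input the scanned blank has to be made explicit.
  obtain ⟨a, r, hr⟩ := exists_cons_of_tp [] (tapeInput x)
  have h0 := withPrefix_step_of_lt U i (q := 0) (by omega) (tp [] (a :: r)) (by omega)
  have h1 := withPrefix_step_of_lt U i (q := 1) (by omega) (tp [] (none :: a :: r)) (by simp only [withPrefix]; omega)
  have hw := withPrefix_write U i i le_rfl (some false :: a :: r) (by simp only [withPrefix]; omega)
  simp only [prefixRow, tp_head_cons, if_true, actTape_left_nil, one_ne_zero, if_false] at h0 h1
  rw [Function.iterate_add_apply _ (i + 1) 2, init_eq_tp, init_eq_tp, hr]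
  refine (congrArg _ ((congrArg _ h0).trans h1)).trans (Eq.trans ?_ (hw.trans ?_))
  · congr 3
    simp
  · have : tp [] (tapeInput (List.replicate (i + 1) true ++ false :: x)) =
        tp [] (List.replicate (i + 1) (some true) ++ some false :: a :: r) := by
      have h : ∀ (l : List (Option Bool)) (r r'), tp [] r = tp [] r' → tp [] (l ++ r) = tp [] (l ++ r') := by
        intro l r r' h
        have h' : Turing.ListBlank.mk r = Turing.ListBlank.mk r' := by
          have := congrArg Turing.Tape.right₀ h
          simpa [tp, Turing.Tape.mk₂] using this
        simp only [tp, Turing.Tape.mk₂, ← Turing.ListBlank.append_mk, h']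
      have := h (List.replicate (i + 1) (some true) ++ [some false]) _ _ hr
      simpa [tapeInput] using this
    rw [this]

theorem withPrefix_outputs {x w}
    (h : U.Outputs (tapeInput (List.replicate (i + 1) true ++ false :: x)) w) :
    (U.withPrefix i).Outputs (tapeInput x) w := by
  obtain ⟨t, h, h'⟩ := h
  obtain ⟨s, hs⟩ := withPrefix_start U i x
  have : (U.withPrefix i).config (tapeInput x) (t + s) = shift U i (U.config
      (tapeInput (List.replicate (i + 1) true ++ false :: x)) t) := by
    rw [DTM.config, Function.iterate_add_apply, hs, withPrefix_iterate, DTM.config]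
  refine ⟨t + s, ?_, ?_⟩
  · rw [DTM.HaltsWithin, this, withPrefix_final]
    exact h
  · rw [this]
    exact h'

end DTM

/-! Criteria for recursive presentability. -/

namespace DTM

/-- The code of `prefixRow`. -/
def prefixRowCode (i q : ℕ) (a : Option Bool) : ℕ × Option Bool × ℕ :=
  bif decide (q = 0) then (1, a, 1)
  else bif decide (q = 1) then (2, some false, 1)
  else bif decide (q = i + 2) then (q + 1, some true, 0)
  else (q + 1, some true, 1)

/-- Used for the tables of `withPrefix`, which consist of the rows of `m` new states followed by the
old rows. -/
theorem map_finRange_eq {α : Type*} {M N m : ℕ} {l : List α} (d : α) {g : Fin M → α} (hM : M = m + N)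
    {G : ℕ → α} (hl : l.length = N) (h1 : ∀ (q : ℕ) (h : q < m), g ⟨q, by omega⟩ = G q)
    (h2 : ∀ (q : ℕ) (h : q < N), g ⟨q + m, by omega⟩ = l.getD q d) :
    (List.finRange M).map g = (List.range m).map G ++ l := by
  subst hM
  apply List.ext_getElem
  · simp [hl]
  · intro q h h'
    simp only [List.length_map, List.length_finRange] at h
    rw [List.getElem_append]
    split_ifs with hq
    · simp at hq
      simp [h1 q hq]
    · simp at hq
      have := h2 (q - m) (by omega)
      simp only [Nat.sub_add_cancel hq] at this
      simp [this, List.getD_eq_getElem?_getD, List.getElem?_eq_getElem (l := l) (i := q - m) (by omega)]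

/-- The table of `U` is a constant in which only the state numbers are shifted by `i + 3`, and the
new rows are given by a formula in `i`. -/
theorem primrec_godelNumber_withPrefix (U : DTM) :
    Primrec fun i => (U.withPrefix i).godelNumber := by
  let fl := (List.finRange (U.n + 1)).map U.final
  let tb := (List.finRange (U.n + 1)).map fun q =>
    [none, some false, some true].map fun a => transitionCode (U.δ q a)
  have key : Primrec fun i : ℕ => Encodable.encode (U.n + (i + 3),
      (List.range (i + 3)).map (fun _ => false) ++ fl,
      (List.range (i + 3)).map (fun q => [prefixRowCode i q none, prefixRowCode i q (some false),
        prefixRowCode i q (some true)]) ++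
      tb.map fun r => r.map fun c => (c.1 + (i + 3), c.2)) := by
    unfold prefixRowCode
    refine Primrec.encode.comp ?_
    fun_prop
  refine key.of_eq fun i => ?_
  have hn : (U.withPrefix i).n + 1 = (i + 3) + (U.n + 1) := by simp only [withPrefix]; omega
  unfold godelNumber
  congr 2
  congr 1
  · refine (map_finRange_eq false hn (by simp [fl]) (fun q h => ?_) fun q h => ?_).symm
    · simp [withPrefix, h]
    · simp [withPrefix, fl, List.getD_eq_getElem?_getD, h]
  · refine (map_finRange_eq [] hn (by simp [tb]) (fun q h => ?_) fun q h => ?_).symm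
    · have : ∀ a, transitionCode ((U.withPrefix i).δ ⟨q, by omega⟩ a) = prefixRowCode i q a := by
        intro a
        simp only [withPrefix, h, dite_true, prefixRowCode, Bool.cond_decide, prefixRow,
          transitionCode]
        split_ifs <;> rfl
      simp [← this]
    · simp [withPrefix, tb, List.getD_eq_getElem?_getD, h, transitionCode]

end DTM

/-- The promise problem with the answers given by `f`; `none` means that the promise fails. -/
def problemOf (f : List Bool → Option Bool) : PromiseProblem where
  yes := {x | f x = some true}
  no := {x | f x = some false}
  disj := Set.disjoint_left.2 fun x h h' => by simp_all

/-- The number of leading ones. -/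
def leadingOnes (l : List Bool) : ℕ := l.foldr (fun b n => bif b then n + 1 else 0) 0

theorem leadingOnes_replicate (i : ℕ) (x : List Bool) :
    leadingOnes (List.replicate i true ++ false :: x) = i := by
  induction i with
  | zero => rfl
  | succ i ih => simp_all [leadingOnes, List.replicate_succ]

/-- Index and input are packed into one word for a single machine that computes `F`; the machines of
the presentation differ only in the prefix that they write. -/
theorem presentable_of_primrec {C : Set PromiseProblem} {F : ℕ → List Bool → Option Bool}
    (hF : Primrec fun p : ℕ × List Bool => F p.1 p.2)
    (hC : ∀ A, A ∈ C ↔ ∃ i, A = problemOf (F i)) : RecursivelyPresentable C := by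
  let code : Option Bool → ℕ := fun o => (o.map fun b => bif b then 1 else 0).getD 2
  -- Numbers stand for the words of their binary digits. The prefix for index `i` has `i + 1` ones,
  -- so that the word starts with `1` also for `i = 0`; hence the subtraction.
  let f : ℕ → ℕ := fun a => code (F (leadingOnes a.bits.reverse - 1)
    (a.bits.reverse.drop (leadingOnes a.bits.reverse + 1)))
  have hf : Primrec f := by
    have : Primrec fun a : ℕ => F (leadingOnes a.bits.reverse - 1)
        (a.bits.reverse.drop (leadingOnes a.bits.reverse + 1)) := by
      refine hF.comp (g := fun a : ℕ => (leadingOnes a.bits.reverse - 1,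
        a.bits.reverse.drop (leadingOnes a.bits.reverse + 1))) ?_
      unfold leadingOnes
      fun_prop
    simp only [f, code]
    have h (g : ℕ → Option Bool) (hg : Primrec g) :
        Primrec fun a => ((g a).map fun b => bif b then 1 else 0).getD 2 := by fun_prop
    exact h _ this
  obtain ⟨U, hU⟩ := exists_dtm_of_computable hf.to_comp (by
    intro a
    rcases h : F (leadingOnes a.bits.reverse - 1)
      (a.bits.reverse.drop (leadingOnes a.bits.reverse + 1)) with _ | _ | _ <;> simp [f, code, h])
  have hout : ∀ i x, (U.withPrefix i).Outputs (tapeInput x) (answer (code (F i x))) := by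
    intro i x
    refine DTM.withPrefix_outputs U i ?_
    have := hU (List.replicate i true ++ false :: x)
    have hb := (bits_bitsVal (List.replicate i true ++ false :: x)).1
    have hl := leadingOnes_replicate (i + 1) x
    rw [List.replicate_succ, List.cons_append] at hl ⊢
    simp only [f, hb, List.reverse_reverse, hl] at this
    simpa [List.drop_append] using this
  refine ⟨U.withPrefix, (U.primrec_godelNumber_withPrefix).to_comp, fun i x => ?_, fun A => ?_⟩
  · obtain ⟨t, h, -⟩ := hout i x
    exact ⟨t, h⟩
  rw [hC]
  refine exists_congr fun i => ⟨?_, fun h => ?_⟩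
  · rintro rfl
    refine ⟨fun x hx => ?_, fun x hx => ?_, fun x hx => ?_⟩
    · have : F i x = some true := hx
      simpa [this, code, answer] using hout i x
    · have : F i x = some false := hx
      simpa [this, code, answer] using hout i x
    · have : F i x = none := by
        rcases h : F i x with _ | _ | _
        · rfl
        · exact absurd (Or.inr h) hx
        · exact absurd (Or.inl h) hx
      simpa [this, code, answer] using hout i x
  -- Outputs are unique and the three answers differ, so a totally decided problem must agree with
  -- `F i` everywhere.
  · have hval : ∀ x b, (U.withPrefix i).Outputs (tapeInput x) (answer b) → b ≤ 2 →
        code (F i x) = b := by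
      intro x b hb h2
      have := DTM.Outputs.unique (hout i x) hb
      rcases h : F i x with _ | _ | _ <;> simp only [h, code] at this ⊢ <;> interval_cases b <;>
        simp_all [answer]
    have h1 : ∀ x ∈ A.yes, F i x = some true := fun x hx => by
      have := hval x 1 (h.1 x hx) (by norm_num)
      rcases h : F i x with _ | _ | _ <;> simp_all [code]
    have h0 : ∀ x ∈ A.no, F i x = some false := fun x hx => by
      have := hval x 0 (h.2.1 x hx) (by norm_num)
      rcases h : F i x with _ | _ | _ <;> simp_all [code]
    have hn : ∀ x, x ∉ A.yes ∪ A.no → F i x = none := fun x hx => by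
      have := hval x 2 (h.2.2 x hx) (by norm_num)
      rcases h : F i x with _ | _ | _ <;> simp_all [code]
    ext x
    · refine ⟨h1 x, fun hx => ?_⟩
      have hx : F i x = some true := hx
      by_contra hy
      by_cases hz : x ∈ A.no
      · simp_all
      · simp_all
    · refine ⟨h0 x, fun hx => ?_⟩
      have hx : F i x = some false := hx
      by_contra hy
      by_cases hz : x ∈ A.yes
      · simp_all
      · simp_all

/-- A class is recursively presentable if it consists of the problems `problemOf (val i)` for those
indices `i` that pass all checks `chk i n`, and contains the finite restrictions of
all problems `problemOf (val i)`. -/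
theorem presentable_of_checked {C : Set PromiseProblem} {I : Type*} [Inhabited I] [Primcodable I]
    {chk : I → ℕ → Bool} {val : I → List Bool → Option Bool}
    (hchk : Primrec fun p : I × ℕ => chk p.1 p.2)
    (hval : Primrec fun p : I × List Bool => val p.1 p.2)
    (h1 : ∀ i, (∀ n, chk i n = true) → problemOf (val i) ∈ C)
    (h2 : ∀ A ∈ C, ∃ i, (∀ n, chk i n = true) ∧ A = problemOf (val i))
    (h3 : ∀ (i : I) (N : ℕ),
      problemOf (fun x => if x.length < N then val i x else some false) ∈ C) :
    RecursivelyPresentable C := by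
  -- Only finitely many checks are made for each input, which keeps `G` computable; if check `N` is
  -- the first to fail, exactly the inputs of length at least `N` are affected.
  let G : I → List Bool → Option Bool := fun i x =>
    bif (List.range (x.length + 1)).all (chk i) then val i x else some false
  let F : ℕ → List Bool → Option Bool := fun n x =>
    ((Encodable.decode (α := I) n).map fun i => G i x).getD (some false)
  have hG : Primrec fun p : I × List Bool => G p.1 p.2 := by
    have a : Primrec fun p : (I × List Bool) × ℕ => chk p.1.1 p.2 :=
      hchk.comp (g := fun p : (I × List Bool) × ℕ => (p.1.1, p.2)) (by fun_prop)
    simp only [G]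
    fun_prop
  have hF : Primrec fun p : ℕ × List Bool => F p.1 p.2 := by
    have a : Primrec fun p : (ℕ × List Bool) × I => G p.2 p.1.2 :=
      hG.comp (g := fun p : (ℕ × List Bool) × I => (p.2, p.1.2)) (by fun_prop)
    have b : Primrec fun p : ℕ × List Bool => Encodable.decode (α := I) p.1 :=
      Primrec.decode.comp (by fun_prop)
    simp only [F]
    fun_prop
  have hG1 : ∀ i, (∀ n, chk i n = true) → G i = val i := fun i h => by
    funext x
    have : (List.range (x.length + 1)).all (chk i) = true := List.all_eq_true.2 fun n _ => h n
    simp [G, this]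
  refine presentable_of_primrec hF fun A => ⟨fun hA => ?_, ?_⟩
  · obtain ⟨i, hi, rfl⟩ := h2 A hA
    refine ⟨Encodable.encode i, ?_⟩
    simp [F, hG1 i hi]
  · rintro ⟨n, rfl⟩
    rcases hn : Encodable.decode (α := I) n with _ | i
    -- Numbers that encode no index give the problem without yes-instances, which is the restriction
    -- of any problem to `N = 0`.
    · have : F n = fun x => if x.length < 0 then val default x else some false := by
        funext x
        simp [F, hn]
      rw [this]
      exact h3 default 0
    · have hFG : F n = G i := by
        funext x
        simp [F, hn]
      rw [hFG]
      by_cases h : ∀ n, chk i n = true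
      · rw [hG1 i h]
        exact h1 i h
      · have hex : ∃ n, chk i n ≠ true := by push Not at h; exact h
        -- With the least failing check `N`, the values are unchanged below length `N` and `no` from
        -- there on, as covered by `h3`.
        have hN := Nat.find_spec hex
        have hlt : ∀ n < Nat.find hex, chk i n = true := fun n hn =>
          not_not.1 (Nat.find_min hex hn)
        generalize Nat.find hex = N at hN hlt
        have : G i = fun x => if x.length < N then val i x else some false := by
          funext x
          split_ifs with hx
          · have : (List.range (x.length + 1)).all (chk i) = true :=
              List.all_eq_true.2 fun n hn => hlt n (by rw [List.mem_range] at hn; omega)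
            simp [G, this]
          · have : (List.range (x.length + 1)).all (chk i) = false := by
              simp only [List.all_eq_false, List.mem_range]
              exact ⟨N, by omega, hN⟩
            simp [G, this]
        rw [this]
        exact h3 _ _

/-! Turing machines as data. -/

@[fun_prop] theorem primrec_tapeInput {α} [Primcodable α] {f : α → List Bool} (hf : Primrec f) :
    Primrec fun a => tapeInput (f a) := by
  unfold tapeInput
  fun_prop

@[fun_prop] theorem primrec_tapeInput₂ {α} [Primcodable α] {f g : α → List Bool} (hf : Primrec f)
    (hg : Primrec g) : Primrec fun a => tapeInput₂ (f a) (g a) := by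
  unfold tapeInput₂
  fun_prop

/-- All words of length `n`. -/
def strings (n : ℕ) : List (List Bool) :=
  (fun l => l.flatMap fun s : List Bool => [false :: s, true :: s])^[n] [[]]

theorem mem_strings {n : ℕ} {x : List Bool} : x ∈ strings n ↔ x.length = n := by
  induction n generalizing x with
  | zero => simp [strings]
  | succ n ih =>
    have : strings (n + 1) = (strings n).flatMap fun s => [false :: s, true :: s] :=
      Function.iterate_succ_apply' _ _ _
    rw [this, List.mem_flatMap]
    constructor
    · rintro ⟨s, hs, h⟩
      rw [ih] at hs
      rcases (by simpa using h : x = false :: s ∨ x = true :: s) with rfl | rfl <;> simp [hs]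
    · intro h
      rcases x with _ | ⟨b, s⟩
      · simp at h
      · exact ⟨s, ih.2 (by simpa using h), by cases b <;> simp⟩

@[fun_prop] theorem primrec_strings {α} [Primcodable α] {f : α → ℕ} (hf : Primrec f) :
    Primrec fun a => strings (f a) := by
  unfold strings
  fun_prop

/-- The base `n + 2` is at least `2`, so its powers absorb constant factors even at `n = 0`, and one
natural number can encode a time bound. -/
theorem Polynomial.exists_eval_le (p : Polynomial ℕ) : ∃ c, ∀ n, p.eval n ≤ (n + 2) ^ c := by
  induction p using Polynomial.induction_on' with
  | add p q hp hq =>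
    obtain ⟨c, hc⟩ := hp
    obtain ⟨d, hd⟩ := hq
    refine ⟨max c d + 1, fun n => ?_⟩
    have h1 : (n + 2) ^ c ≤ (n + 2) ^ max c d := Nat.pow_le_pow_right (by omega) (le_max_left _ _)
    have h2 : (n + 2) ^ d ≤ (n + 2) ^ max c d := Nat.pow_le_pow_right (by omega) (le_max_right _ _)
    have := hc n
    have := hd n
    rw [Polynomial.eval_add, pow_succ]
    nlinarith
  | monomial k a =>
    refine ⟨a + k, fun n => ?_⟩
    rw [Polynomial.eval_monomial, pow_add]
    gcongr
    · calc a ≤ 2 ^ a := Nat.lt_two_pow_self.le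
        _ ≤ _ := Nat.pow_le_pow_left (by omega) _
    · omega

theorem polyBound_mono {c d n : ℕ} (h : c ≤ d) : (n + 2) ^ c ≤ (n + 2) ^ d :=
  Nat.pow_le_pow_right (by omega) h

theorem Polynomial.eval_polyBound (c n : ℕ) :
    ((Polynomial.X + 2) ^ c : Polynomial ℕ).eval n = (n + 2) ^ c := by
  simp

/-- A transition as data. -/
abbrev RawTransition : Type := ℕ × Option Bool × Option Bool

/-- A configuration as data: the state, the cells to the left of the head, the scanned symbol, and
the cells to the right of the head. -/
abbrev RawConfig : Type := ℕ × List (Option Bool) × Option Bool × List (Option Bool)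

namespace RawConfig

/-- States are reduced modulo `n + 1`, so that all raw data denote a machine and nothing has to be
validated. -/
def toTransition (n : ℕ) (t : RawTransition) : Transition n :=
  (Fin.ofNat (n + 1) t.1, t.2.1, t.2.2.map fun b => bif b then .right else .left)

def toConfig (n : ℕ) (c : RawConfig) : TMConfig n :=
  ⟨Fin.ofNat (n + 1) c.1, ⟨c.2.2.1, .mk c.2.1, .mk c.2.2.2⟩⟩

def act (c : RawConfig) (t : RawTransition) : RawConfig :=
  (t.2.2.map fun b => bif b then (t.1, t.2.1 :: c.2.1, c.2.2.2.headI, c.2.2.2.tail)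
    else (t.1, c.2.1.tail, c.2.1.headI, t.2.1 :: c.2.2.2)).getD (t.1, c.2.1, t.2.1, c.2.2.2)

@[fun_prop] theorem primrec_act {α} [Primcodable α] {f : α → RawConfig} {g : α → RawTransition}
    (hf : Primrec f) (hg : Primrec g) : Primrec fun a => act (f a) (g a) := by
  have : Primrec fun p : RawConfig × RawTransition => act p.1 p.2 := by
    unfold act
    fun_prop
  exact this.comp (hf.pair hg)

theorem toConfig_act (n : ℕ) (c : RawConfig) (t : RawTransition) :
    toConfig n (c.act t) = (toConfig n c).act (toTransition n t) := by
  obtain ⟨q, l, a, r⟩ := c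
  obtain ⟨q', b, d⟩ := t
  rcases d with _ | _ | _
  · simp [toConfig, act, toTransition, TMConfig.act, Turing.Tape.write]
  · simp [toConfig, act, toTransition, TMConfig.act, Turing.Tape.write, Turing.Tape.move]
  · simp [toConfig, act, toTransition, TMConfig.act, Turing.Tape.write, Turing.Tape.move]

theorem exists_toTransition {n : ℕ} (t : Transition n) :
    ∃ r : RawTransition, r.1 < n + 1 ∧ toTransition n r = t := by
  obtain ⟨q, a, d⟩ := t
  refine ⟨(q, a, d.map fun d => decide (d = .right)), q.2, ?_⟩
  rcases d with _ | _ | _ <;> simp [toTransition]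

/-- The initial configuration. -/
def init (u : List (Option Bool)) : RawConfig := (0, [], u.headI, u.tail)

@[fun_prop] theorem primrec_init {α} [Primcodable α] {f : α → List (Option Bool)}
    (hf : Primrec f) : Primrec fun a => init (f a) := by
  unfold init
  fun_prop

theorem toConfig_init (n u) : toConfig n (init u) = TMConfig.init n u := by
  simp [toConfig, init, TMConfig.init, Turing.Tape.mk₁, Turing.Tape.mk₂, Turing.Tape.mk']

/-- The string up to the first blank. -/
def untilBlank (l : List (Option Bool)) : List Bool :=
  l.foldr (fun o w => (o.map fun b => b :: w).getD []) []

/-- The output string. -/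
def out (c : RawConfig) : List Bool := untilBlank (c.2.2.1 :: c.2.2.2)

@[fun_prop] theorem primrec_out {α} [Primcodable α] {f : α → RawConfig} (hf : Primrec f) :
    Primrec fun a => out (f a) := by
  unfold out untilBlank
  fun_prop

theorem getI_untilBlank (l : List (Option Bool)) :
    ∀ i ≤ (untilBlank l).length, l.getI i = (untilBlank l)[i]? := by
  induction l with
  | nil => simp [untilBlank]; rfl
  | cons o l ih =>
    rcases o with _ | b
    · intro i hi
      obtain rfl : i = 0 := by simpa [untilBlank] using hi
      rfl
    · intro i hi
      have h : untilBlank (some b :: l) = b :: untilBlank l := rfl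
      rw [h] at hi ⊢
      rcases i with _ | i
      · rfl
      · simpa using ih i (by simpa using hi)

theorem output_iff {n : ℕ} {c : RawConfig} {w : List Bool} :
    (toConfig n c).Output w ↔ c.out = w := by
  have h : (toConfig n c).Output c.out := by
    intro i hi
    rw [out, ← getI_untilBlank _ i hi]
    rcases i with _ | i
    · rfl
    · exact Turing.ListBlank.nth_mk _ _
  exact ⟨fun h' => h.unique h', fun h' => h' ▸ h⟩

/-- The index of the scanned symbol in a row of a transition table. -/
def symIndex (a : Option Bool) : ℕ := (a.map fun b => bif b then 2 else 1).getD 0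

@[fun_prop] theorem primrec_symIndex {α} [Primcodable α] {f : α → Option Bool} (hf : Primrec f) :
    Primrec fun a => symIndex (f a) := by
  unfold symIndex
  fun_prop

/-- Three consecutive entries per state, in the order of `symIndex`, whose inverse is `s`. -/
theorem exists_table {n : ℕ} {α : Type*} (d : α) (g : Fin (n + 1) → Option Bool → α) :
    ∃ tbl : List α, ∀ (q : Fin (n + 1)) a, tbl.getD (3 * (q : ℕ) + symIndex a) d = g q a := by
  let s : ℕ → Option Bool := fun k => if k = 0 then none else some (decide (k = 2))
  refine ⟨(List.range (3 * (n + 1))).map fun k => g (Fin.ofNat (n + 1) (k / 3)) (s (k % 3)), ?_⟩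
  intro q a
  have h3 : symIndex a < 3 := by rcases a with _ | _ | _ <;> decide
  have h1 : (3 * (q : ℕ) + symIndex a) / 3 = q := by omega
  have h2 : (3 * (q : ℕ) + symIndex a) % 3 = symIndex a := by omega
  have h4 : s (symIndex a) = a := by rcases a with _ | _ | _ <;> rfl
  have := q.2
  rw [List.getD_eq_getElem?_getD, List.getElem?_map, List.getElem?_range (by omega)]
  simp [h1, h2, h4]

theorem exists_flags {n : ℕ} (g : Fin (n + 1) → Bool) :
    ∃ fl : List Bool, ∀ q : Fin (n + 1), fl.getD q false = g q :=
  ⟨(List.finRange (n + 1)).map g, fun q => by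
    rw [List.getD_eq_getElem _ _ (by simpa using q.is_le)]; simp⟩

end RawConfig

/-! ### Simulation of deterministic machines given as data -/

open RawConfig

/-- A deterministic machine as data: the number of states, the final states, and the table of
transitions. -/
abbrev RawDTM : Type := ℕ × List Bool × List RawTransition

namespace RawDTM

def toDTM (D : RawDTM) : DTM where
  n := D.1
  final q := D.2.1.getD q false
  δ q a := toTransition D.1 (D.2.2.getD (3 * (q : ℕ) + symIndex a) default)

theorem exists_toDTM (M : DTM) : ∃ D : RawDTM, D.toDTM = M := by
  obtain ⟨n, final, δ⟩ := M
  obtain ⟨fl, hfl⟩ := exists_flags final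
  choose f _ hf using fun q a => exists_toTransition (δ q a)
  obtain ⟨tbl, htbl⟩ := exists_table default f
  exact ⟨(n, fl, tbl), by simp only [toDTM, hfl, htbl, hf]⟩

def step (D : RawDTM) (c : RawConfig) : RawConfig :=
  bif D.2.1.getD (c.1 % (D.1 + 1)) false then c
  else c.act (D.2.2.getD (3 * (c.1 % (D.1 + 1)) + symIndex c.2.2.1) default)

theorem toConfig_step (D : RawDTM) (c : RawConfig) :
    toConfig D.toDTM.n (D.step c) = D.toDTM.step (toConfig D.toDTM.n c) := by
  unfold step DTM.step
  have h : D.toDTM.final (toConfig D.toDTM.n c).state =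
    D.2.1.getD (c.1 % (D.1 + 1)) false := rfl
  rw [h]
  cases D.2.1.getD (c.1 % (D.1 + 1)) false
  · exact toConfig_act _ _ _
  · rfl

/-- The output after at most `t` steps. -/
def out (D : RawDTM) (u : List (Option Bool)) (t : ℕ) : Option (List Bool) :=
  let c := D.step^[t] (init u)
  bif D.2.1.getD (c.1 % (D.1 + 1)) false then some c.out else none

theorem primrec_out' : Primrec fun p : RawDTM × List (Option Bool) × ℕ => out p.1 p.2.1 p.2.2 := by
  have h : Primrec fun p : RawDTM × RawConfig => step p.1 p.2 := by
    unfold step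
    fun_prop
  have h' : Primrec fun p : RawDTM × List (Option Bool) × ℕ => p.1.step^[p.2.2] (init p.2.1) :=
    Primrec.iterate' (h := fun (p : RawDTM × List (Option Bool) × ℕ) c => p.1.step c)
      (by fun_prop) (by fun_prop) (h.comp (g := fun q : (RawDTM × List (Option Bool) × ℕ) ×
        RawConfig => (q.1.1, q.2)) (by fun_prop))
  unfold out
  fun_prop

@[fun_prop] theorem primrec_out {α} [Primcodable α] {D : α → RawDTM} {u : α → List (Option Bool)}
    {t : α → ℕ} (hD : Primrec D) (hu : Primrec u) (ht : Primrec t) :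
    Primrec fun a => out (D a) (u a) (t a) :=
  primrec_out'.comp (hD.pair (hu.pair ht))

variable {D : RawDTM} {u : List (Option Bool)} {t : ℕ} {w : List Bool}

theorem config_eq :
    D.toDTM.config u t = toConfig D.toDTM.n (D.step^[t] (init u)) := by
  have : Function.Semiconj (toConfig D.toDTM.n) D.step D.toDTM.step := toConfig_step D
  rw [(this.iterate_right t).eq, toConfig_init]
  rfl

theorem out_eq : out D u t = bif D.2.1.getD ((D.step^[t] (init u)).1 % (D.1 + 1)) false then
    some (D.step^[t] (init u)).out else none := rfl

theorem final_config :
    D.toDTM.final (toConfig D.toDTM.n (D.step^[t] (init u))).state = (out D u t).isSome := by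
  have h : D.toDTM.final (toConfig D.toDTM.n (D.step^[t] (init u))).state =
    D.2.1.getD ((D.step^[t] (init u)).1 % (D.1 + 1)) false := rfl
  rw [h, out_eq]
  cases D.2.1.getD ((D.step^[t] (init u)).1 % (D.1 + 1)) false <;> rfl

theorem haltsWithin_iff : D.toDTM.HaltsWithin u t ↔ (out D u t).isSome = true := by
  rw [DTM.HaltsWithin, config_eq, final_config]

theorem outputsWithin_iff : D.toDTM.OutputsWithin u t w ↔ out D u t = some w := by
  rw [DTM.OutputsWithin, DTM.HaltsWithin, config_eq, final_config, output_iff]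
  rw [out_eq]
  cases D.2.1.getD ((D.step^[t] (init u)).1 % (D.1 + 1)) false
  · exact ⟨fun h => absurd h.1 Bool.false_ne_true, fun h => nomatch h⟩
  · exact ⟨fun h => congrArg some h.2, fun h => ⟨rfl, Option.some.inj h⟩⟩

theorem outputs_of_out (h : out D u t = some w) : D.toDTM.Outputs u w :=
  ⟨t, outputsWithin_iff.2 h⟩

/-- Replaces an output at an unspecified time by the output of a clocked simulation, since the
configuration is constant after halting. -/
theorem out_of_outputs (h : D.toDTM.HaltsWithin u t) (h' : D.toDTM.Outputs u w) :
    out D u t = some w := by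
  obtain ⟨v, hv⟩ := Option.isSome_iff_exists.1 (haltsWithin_iff.1 h)
  rw [hv, (outputs_of_out hv).unique h']

end RawDTM

/-! The classes P and NP. -/

open RawDTM

theorem ite_take {α : Type*} (N : ℕ) (f : List Bool → α) (d : α) (x : List Bool) :
    (if (x.take N).length < N then f (x.take N) else d) = if x.length < N then f x else d := by
  have : (x.take N).length < N ↔ x.length < N := by simp
  simp only [this]
  split_ifs with h
  · rw [List.take_of_length_le h.le]
  · rfl

/-- A machine of constant runtime for a problem that is constant up to finitely many inputs. -/
theorem exists_dtm_of_finite (N : ℕ) (f : List Bool → List Bool) (d : List Bool) :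
    ∃ (M : DTM) (B : ℕ), ∀ (x : List Bool) (v), (v = [] ∨ ∃ v', v = none :: v') →
      M.OutputsWithin (x.map some ++ v) B (if x.length < N then f x else d) := by
  obtain ⟨M, B, h⟩ := DTM.exists_lookup N fun s => if s.length < N then f s else d
  refine ⟨M, B, fun x v hv => ?_⟩
  have := h x v hv
  rwa [ite_take] at this

/-- An index is a machine with an exponent. The checks verify both the clock and that the output is
`0` or `1`; only then does the value `some false` of `val` mean that the machine rejects. -/
theorem classP_presentable : RecursivelyPresentable classP := by
  let val : RawDTM × ℕ → List Bool → Option Bool := fun i x =>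
    some (decide (out i.1 (tapeInput x) ((x.length + 2) ^ i.2) = some [true]))
  let chk : RawDTM × ℕ → ℕ → Bool := fun i n => (strings n).all fun x =>
    decide (out i.1 (tapeInput x) ((n + 2) ^ i.2) = some [true]) ||
      decide (out i.1 (tapeInput x) ((n + 2) ^ i.2) = some [false])
  have hdec : ∀ f : List Bool → Option Bool, (∀ x, f x ≠ none) → (problemOf f).IsDecision := by
    intro f hf
    refine Set.eq_univ_of_forall fun x => ?_
    rcases h : f x with _ | _ | _
    · exact absurd h (hf x)
    · exact Or.inr h
    · exact Or.inl h
  refine presentable_of_checked (chk := chk) (val := val) ?_ ?_ (fun i hi => ?_) ?_ fun i N => ?_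
  · simp only [chk]; fun_prop
  · simp only [val]; fun_prop
  · have key : ∀ x, out i.1 (tapeInput x) ((x.length + 2) ^ i.2) = some [true] ∨
        out i.1 (tapeInput x) ((x.length + 2) ^ i.2) = some [false] := fun x => by
      simpa using List.all_eq_true.1 (hi x.length) x (mem_strings.2 rfl)
    refine ⟨hdec _ fun x => by simp [val], i.1.toDTM, ⟨(Polynomial.X + 2) ^ i.2, fun x => ?_⟩,
      fun x hx => ?_, fun x hx => ?_⟩
    · rw [Polynomial.eval_polyBound, haltsWithin_iff]
      rcases key x with h | h <;> simp [h]
    · have hx : val i x = some true := hx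
      exact outputs_of_out (by simpa [val] using hx)
    · have hx : val i x = some false := hx
      refine outputs_of_out ((key x).resolve_left (by simpa [val] using hx))
  · rintro A ⟨hA, M, ⟨p, hp⟩, hy, hn⟩
    obtain ⟨D, rfl⟩ := exists_toDTM M
    obtain ⟨c, hc⟩ := p.exists_eval_le
    have hh := fun x => (hp x).mono (hc _)
    have h1 := fun x hx => out_of_outputs (hh x) (hy x hx)
    have h0 := fun x hx => out_of_outputs (hh x) (hn x hx)
    have hx : ∀ x, x ∈ A.yes ∨ x ∈ A.no := fun x => (hA ▸ Set.mem_univ x : x ∈ A.yes ∪ A.no)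
    refine ⟨(D, c), fun n => List.all_eq_true.2 fun x hxn => ?_, ?_⟩
    · obtain rfl := mem_strings.1 hxn
      rcases hx x with h | h
      · simp [h1 x h]
      · simp [h0 x h]
    · ext x
      · change _ ↔ val (D, c) x = some true
        refine ⟨fun h => by simp [val, h1 x h], fun h => (hx x).resolve_right fun h' => ?_⟩
        simp [val, h0 x h'] at h
      · change _ ↔ val (D, c) x = some false
        refine ⟨fun h => by simp [val, h0 x h], fun h => (hx x).resolve_left fun h' => ?_⟩
        simp [val, h1 x h'] at h
  -- A finite table of answers, with `0` beyond it, needs only constant time.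
  · obtain ⟨M, B, h⟩ := exists_dtm_of_finite N (fun x => [(val i x).getD false]) [false]
    refine ⟨hdec _ fun x => by split_ifs <;> simp [val], M, ⟨Polynomial.C B, fun x => ?_⟩,
      fun x hx => ⟨B, ?_⟩, fun x hx => ⟨B, ?_⟩⟩
    · simpa [tapeInput] using (h x [] (.inl rfl)).1
    · have := h x [] (.inl rfl)
      have hx : (if x.length < N then val i x else some false) = some true := hx
      rw [List.append_nil] at this
      split_ifs at hx this <;> simp_all [tapeInput]
    · have := h x [] (.inl rfl)
      have hx : (if x.length < N then val i x else some false) = some false := hx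
      rw [List.append_nil] at this
      split_ifs at hx this <;> simp_all [tapeInput]

/-! Functions in `poly`, as data. -/

/-- The value at `n` of the function that the machine is to output in binary. -/
def polyVal (i : RawDTM × ℕ) (n : ℕ) : ℕ :=
  bitsVal ((out i.1 (tapeInput (List.replicate n false)) ((n + 2) ^ i.2)).getD [])

/-- The function `polyVal i` is output for all inputs of length `n` and bounded. -/
def polyCheck (i : RawDTM × ℕ) (n : ℕ) : Bool :=
  (polyVal i n).ble ((n + 2) ^ i.2) && (strings n).all fun x =>
    decide (out i.1 (tapeInput x) ((n + 2) ^ i.2) = some (binaryRep (polyVal i n)))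

@[fun_prop] theorem primrec_polyVal {α} [Primcodable α] {i : α → RawDTM × ℕ} {n : α → ℕ}
    (hi : Primrec i) (hn : Primrec n) : Primrec fun a => polyVal (i a) (n a) := by
  unfold polyVal
  fun_prop

@[fun_prop] theorem primrec_polyCheck {α} [Primcodable α] {i : α → RawDTM × ℕ} {n : α → ℕ}
    (hi : Primrec i) (hn : Primrec n) : Primrec fun a => polyCheck (i a) (n a) := by
  unfold polyCheck
  fun_prop

theorem inPoly_polyVal {i : RawDTM × ℕ} (h : ∀ n, polyCheck i n = true) : InPoly (polyVal i) := by
  simp only [polyCheck, Bool.and_eq_true, Nat.ble_eq, decide_eq_true_eq, List.all_eq_true, mem_strings] at h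
  refine ⟨⟨(Polynomial.X + 2) ^ i.2, fun n => ?_⟩, i.1.toDTM, (Polynomial.X + 2) ^ i.2, fun x => ?_⟩
  · rw [Polynomial.eval_polyBound]
    exact (h n).1
  · rw [Polynomial.eval_polyBound, outputsWithin_iff]
    exact (h _).2 x rfl

/-- All sufficiently large exponents work, so that one exponent can be shared with another machine
in the same index. -/
theorem exists_polyVal {m : ℕ → ℕ} (h : InPoly m) : ∃ (D : RawDTM) (c₀ : ℕ), ∀ c ≥ c₀,
    (∀ n, polyVal (D, c) n = m n) ∧ ∀ n, polyCheck (D, c) n = true := by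
  obtain ⟨⟨p, hp⟩, M, q, hq⟩ := h
  obtain ⟨D, rfl⟩ := exists_toDTM M
  obtain ⟨c, hc⟩ := p.exists_eval_le
  obtain ⟨d, hd⟩ := q.exists_eval_le
  refine ⟨D, max c d, fun e he => ?_⟩
  have hout : ∀ x : List Bool, out D (tapeInput x) ((x.length + 2) ^ e) =
      some (binaryRep (m x.length)) := fun x =>
    outputsWithin_iff.1 ((hq x).mono ((hd _).trans (polyBound_mono (by omega))))
  have h1 : ∀ n, polyVal (D, e) n = m n := fun n => by
    have := hout (List.replicate n false)
    rw [List.length_replicate] at this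
    simp [polyVal, this, bitsVal_binaryRep]
  refine ⟨h1, fun n => ?_⟩
  simp only [polyCheck, Bool.and_eq_true, Nat.ble_eq, decide_eq_true_eq, List.all_eq_true, mem_strings, h1]
  refine ⟨(hp n).trans ((hc n).trans (polyBound_mono (by omega))), fun x hx => ?_⟩
  subst hx
  exact hout x

/-- The checks must also ensure that every `x` has an accepted witness or has all witnesses rejected
with output `0`; other outputs would violate the definition of a verifier for a decision problem. -/
theorem classNP_presentable : RecursivelyPresentable classNP := by
  let o : (RawDTM × RawDTM) × ℕ → List Bool → List Bool → Option (List Bool) := fun i x y =>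
    out i.1.1 (tapeInput₂ x y) ((x.length + y.length + 2) ^ i.2)
  let m : (RawDTM × RawDTM) × ℕ → ℕ → ℕ := fun i n => polyVal (i.1.2, i.2) n
  let acc : (RawDTM × RawDTM) × ℕ → List Bool → Bool := fun i x =>
    (strings (m i x.length)).any fun y => decide (o i x y = some [true])
  let rej : (RawDTM × RawDTM) × ℕ → List Bool → Bool := fun i x =>
    (strings (m i x.length)).all fun y => decide (o i x y = some [false])
  let val : (RawDTM × RawDTM) × ℕ → List Bool → Option Bool := fun i x => some (acc i x)
  -- The time bound concerns all pairs and not only witnesses of the right length; check `n` covers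
  -- the finitely many pairs of total length `n`.
  let hlt : (RawDTM × RawDTM) × ℕ → ℕ → Bool := fun i n => (List.range (n + 1)).all fun k =>
    (strings k).all fun x => (strings (n - k)).all fun y => (o i x y).isSome
  let chk : (RawDTM × RawDTM) × ℕ → ℕ → Bool := fun i n => polyCheck (i.1.2, i.2) n && hlt i n &&
    (strings n).all fun x => acc i x || rej i x
  have hdec : ∀ f : List Bool → Option Bool, (∀ x, f x ≠ none) → (problemOf f).IsDecision := by
    intro f hf
    refine Set.eq_univ_of_forall fun x => ?_
    rcases h : f x with _ | _ | _
    · exact absurd h (hf x)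
    · exact Or.inr h
    · exact Or.inl h
  refine presentable_of_checked (chk := chk) (val := val) ?_ ?_ (fun i hi => ?_) ?_ fun i N => ?_
  · simp only [chk, hlt, acc, rej, o, m]; fun_prop
  · simp only [val, acc, o, m]; fun_prop
  · have h : ∀ n, _ := fun n => hi n
    simp only [chk, Bool.and_eq_true, forall_and, List.all_eq_true, mem_strings,
      Bool.or_eq_true] at h
    obtain ⟨⟨h1, h2⟩, h3⟩ := h
    refine ⟨hdec _ fun x => by simp [val], i.1.1.toDTM, m i,
      ⟨(Polynomial.X + 2) ^ i.2, fun x y => ?_⟩, inPoly_polyVal h1, fun x hx => ?_, fun x hx => ?_⟩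
    · rw [Polynomial.eval_polyBound, haltsWithin_iff]
      have := h2 (x.length + y.length)
      simp only [hlt, List.all_eq_true, mem_strings, List.mem_range] at this
      exact this x.length (by omega) x rfl y (by omega)
    · have hx : val i x = some true := hx
      simp only [val, acc, Option.some.injEq, List.any_eq_true, mem_strings,
        decide_eq_true_eq] at hx
      obtain ⟨y, hy, h⟩ := hx
      exact ⟨y, hy, outputs_of_out h⟩
    · have hx : val i x = some false := hx
      simp only [val, Option.some.injEq] at hx
      have := (h3 _ x rfl).resolve_left (by simp [hx])
      simp only [rej, List.all_eq_true, mem_strings, decide_eq_true_eq] at this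
      exact fun y hy => outputs_of_out (this y hy)
  · rintro A ⟨hA, M, m', ⟨p, hp⟩, hm, hy, hn⟩
    obtain ⟨M, rfl⟩ := exists_toDTM M
    obtain ⟨D, c₀, hD⟩ := exists_polyVal hm
    obtain ⟨c, hc⟩ := p.exists_eval_le
    let i : (RawDTM × RawDTM) × ℕ := ((M, D), max c c₀)
    have hh : ∀ x y, M.toDTM.HaltsWithin (tapeInput₂ x y) ((x.length + y.length + 2) ^ max c c₀) :=
      fun x y => (hp x y).mono ((hc _).trans (polyBound_mono (le_max_left _ _)))
    obtain ⟨hm', hpc⟩ := hD (max c c₀) (le_max_right _ _)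
    have h1 : ∀ x ∈ A.yes, acc i x = true := fun x hx => by
      obtain ⟨y, hyl, h⟩ := hy x hx
      simp only [acc, List.any_eq_true, mem_strings, decide_eq_true_eq]
      exact ⟨y, hyl.trans (hm' _).symm, out_of_outputs (hh x y) h⟩
    have h0 : ∀ x ∈ A.no, rej i x = true := fun x hx => by
      simp only [rej, List.all_eq_true, mem_strings, decide_eq_true_eq]
      exact fun y hyl => out_of_outputs (hh x y) (hn x hx y (hyl.trans (hm' _)))
    have h0' : ∀ x ∈ A.no, acc i x = false := fun x hx => by
      have := h0 x hx
      simp only [rej, List.all_eq_true, decide_eq_true_eq] at this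
      simp only [acc, List.any_eq_false]
      intro y hyl
      simp [this y hyl]
    have hx : ∀ x, x ∈ A.yes ∨ x ∈ A.no := fun x => (hA ▸ Set.mem_univ x : x ∈ A.yes ∪ A.no)
    refine ⟨i, fun n => ?_, ?_⟩
    · simp only [chk, hlt, Bool.and_eq_true, List.all_eq_true, mem_strings, Bool.or_eq_true]
      refine ⟨⟨hpc n, fun k _ x _ y _ => haltsWithin_iff.1 (hh x y)⟩, fun x _ => ?_⟩
      exact (hx x).imp (h1 x) (h0 x)
    · ext x
      · change _ ↔ val i x = some true
        refine ⟨fun h => by simp [val, h1 x h], fun h => (hx x).resolve_right fun h' => ?_⟩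
        simp [val, h0' x h'] at h
      · change _ ↔ val i x = some false
        refine ⟨fun h => by simp [val, h0' x h], fun h => (hx x).resolve_left fun h' => ?_⟩
        simp [val, h1 x h'] at h
  -- The lookup machine stops at the blank between the inputs and so ignores the witness; witness
  -- length `0` is chosen.
  · obtain ⟨M, B, h⟩ := exists_dtm_of_finite N (fun x => [(val i x).getD false]) [false]
    have h := fun x y : List Bool => h x (none :: y.map some) (.inr ⟨_, rfl⟩)
    refine ⟨hdec _ fun x => by split_ifs <;> simp [val], M, fun _ => 0,
      ⟨Polynomial.C B, fun x y => ?_⟩, inPoly_const 0, fun x hx => ⟨[], rfl, B, ?_⟩,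
      fun x hx y _ => ⟨B, ?_⟩⟩
    · simpa [tapeInput₂] using (h x y).1
    · have := h x []
      have hx : (if x.length < N then val i x else some false) = some true := hx
      split_ifs at hx this <;> simp_all [tapeInput₂]
    · have := h x y
      have hx : (if x.length < N then val i x else some false) = some false := hx
      split_ifs at hx this <;> simp_all [tapeInput₂]

/-! Sums over the branches of a probabilistic machine. -/

namespace PTM

/-- The weight of a sequence of choices if a choice among `k` transitions has weight `f k`. -/
def weight (M : PTM) (f : ℕ → ℚ) : TMConfig M.n → List (Transition M.n) → ℚ
  | _, [] => 1
  | c, a :: l => f (M.choices c).card * M.weight f (c.act a) l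

/-- The branches from `c` that end in a configuration with the property `p`. -/
def branchesFrom (M : PTM) (p : TMConfig M.n → Prop) (c : TMConfig M.n) :
    Set (List (Transition M.n)) := {l | ∃ c', M.BranchFrom c l c' ∧ p c'}

/-- The total weight of the branches from `c` that end in a configuration with the property `p`. -/
noncomputable def total (M : PTM) (f : ℕ → ℚ) (p : TMConfig M.n → Prop) (c : TMConfig M.n) : ℚ :=
  ∑ᶠ l ∈ M.branchesFrom p c, M.weight f c l

variable {M : PTM} {f : ℕ → ℚ} {p : TMConfig M.n → Prop} {c : TMConfig M.n}

theorem branchesFrom_final (h : M.final c.state = true) :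
    M.branchesFrom p c = {l | l = [] ∧ p c} := by
  ext l
  rcases l with _ | ⟨a, l⟩ <;> simp [branchesFrom, BranchFrom, h]

theorem branchesFrom_step (h : M.final c.state = false) : M.branchesFrom p c =
    ⋃ a ∈ (M.choices c : Set (Transition M.n)), List.cons a '' M.branchesFrom p (c.act a) := by
  ext l
  rcases l with _ | ⟨a, l⟩
  · simp [branchesFrom, BranchFrom, h]
  · simp only [branchesFrom, BranchFrom, h, true_and, Set.mem_ofPred_eq, Set.mem_iUnion,
      Set.mem_image, List.cons.injEq, exists_prop, Finset.mem_coe]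
    constructor
    · rintro ⟨c', ⟨ha, hb⟩, hp⟩
      exact ⟨a, ha, l, ⟨c', hb, hp⟩, rfl, rfl⟩
    · rintro ⟨_, ha, _, ⟨c', hb, hp⟩, rfl, rfl⟩
      exact ⟨c', ⟨ha, hb⟩, hp⟩

theorem finite_branchesFrom {t : ℕ} (h : M.HaltsWithinFrom t c) : (M.branchesFrom p c).Finite := by
  have h0 : ∀ c, M.final c.state = true → (M.branchesFrom p c).Finite := fun c hf => by
    rw [branchesFrom_final hf]
    exact (Set.finite_singleton []).subset fun l hl => hl.1
  induction t generalizing c with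
  | zero => exact h0 c h
  | succ t ih =>
    by_cases hf : M.final c.state = true
    · exact h0 c hf
    · rw [branchesFrom_step (by simpa using hf)]
      obtain ⟨-, h⟩ := h.resolve_left hf
      exact (M.choices c).finite_toSet.biUnion fun a ha => (ih (h a ha)).image _

open Classical in
theorem total_final (h : M.final c.state = true) : M.total f p c = if p c then 1 else 0 := by
  rw [total, branchesFrom_final h]
  split_ifs with hp
  · have : {l : List (Transition M.n) | l = [] ∧ p c} = {[]} := by ext; simp [hp]
    rw [this, finsum_mem_singleton, weight]
  · have : {l : List (Transition M.n) | l = [] ∧ p c} = ∅ := by ext; simp [hp]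
    rw [this, finsum_mem_empty]

/-- The branches are sorted by their first choice. Finiteness is required because a finite sum over
an infinite support would be `0` by convention. -/
theorem total_step (h : M.final c.state = false)
    (hfin : ∀ a ∈ M.choices c, (M.branchesFrom p (c.act a)).Finite) :
    M.total f p c = f (M.choices c).card * ∑ a ∈ M.choices c, M.total f p (c.act a) := by
  rw [total, branchesFrom_step h, finsum_mem_biUnion, finsum_mem_coe_finset, Finset.mul_sum]
  · refine Finset.sum_congr rfl fun a _ => ?_
    rw [finsum_mem_image fun _ _ _ _ h => (List.cons.inj h).2, total, mul_finsum_mem]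
    rfl
  · intro a _ b _ hab
    refine Set.disjoint_left.2 ?_
    rintro _ ⟨l, -, rfl⟩ ⟨l', -, h⟩
    exact hab (List.cons.inj h).1.symm
  · exact Finset.finite_toSet _
  · exact fun a ha => (hfin a ha).image _

/-- Both readings of acceptance are instances of `total`: weight `1 / k` for a choice among `k`
transitions gives the probability, and constant weight `1` counts the branches. -/
theorem acceptProbability_eq (u : List (Option Bool)) : M.acceptProbability u =
    M.total (fun k => 1 / (k : ℚ)) (fun c => c.Output [true]) (TMConfig.init M.n u) := by
  have : ∀ c l, M.branchWeight c l = M.weight (fun k => 1 / (k : ℚ)) c l := fun c l => by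
    induction l generalizing c with
    | nil => rfl
    | cons a l ih => rw [branchWeight, weight, ih]
  rw [acceptProbability, total]
  simp only [this]
  rfl

theorem total_one {t : ℕ} (h : M.HaltsWithinFrom t c) :
    M.total (fun _ => 1) p c = (M.branchesFrom p c).ncard := by
  have : ∀ c l, M.weight (fun _ => 1) c l = 1 := fun c l => by
    induction l generalizing c with
    | nil => rfl
    | cons a l ih => rw [weight, ih, one_mul]
  have hfin := finite_branchesFrom (p := p) h
  simp only [total, this]
  rw [finsum_mem_eq_finite_toFinset_sum _ hfin, Set.ncard_eq_toFinset_card _ hfin]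
  simp

theorem acceptFraction_eq {u : List (Option Bool)} {t : ℕ} (h : M.HaltsWithin u t) :
    M.acceptFraction u =
      M.total (fun _ => 1) (fun c => c.Output [true]) (TMConfig.init M.n u) /
        M.total (fun _ => 1) (fun _ => True) (TMConfig.init M.n u) := by
  rw [total_one h, total_one h, acceptFraction]
  congr 3
  ext l
  simp [branches, branchesFrom]

theorem HaltsWithinFrom.mono {t t' : ℕ} (h : M.HaltsWithinFrom t c) (ht : t ≤ t') :
    M.HaltsWithinFrom t' c := by
  induction t generalizing c t' with
  | zero =>
    rcases t' with _ | t'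
    · exact h
    · exact Or.inl h
  | succ t ih =>
    obtain ⟨t', rfl⟩ : ∃ s, t' = s + 1 := ⟨t' - 1, by omega⟩
    exact h.imp id fun ⟨hn, h⟩ => ⟨hn, fun a ha => ih (h a ha) (by omega)⟩

end PTM

/-! Probabilistic machines as data. -/

open RawConfig

instance : DecidableEq Turing.Dir := fun a b => by
  cases a <;> cases b <;> first | exact isTrue rfl | exact isFalse (by simp)

/-- A probabilistic machine as data. -/
abbrev RawPTM : Type := ℕ × List Bool × List (List RawTransition)

/-- Remove repetitions. -/
def List.withoutRepetitions {α : Type*} [DecidableEq α] (l : List α) : List α :=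
  l.foldr List.insert []

theorem List.mem_withoutRepetitions {α : Type*} [DecidableEq α] {l : List α} {a : α} :
    a ∈ l.withoutRepetitions ↔ a ∈ l := by
  induction l with
  | nil => simp [withoutRepetitions]
  | cons b l ih =>
    rw [List.mem_cons, ← ih]
    exact List.mem_insert_iff

theorem List.nodup_withoutRepetitions {α : Type*} [DecidableEq α] (l : List α) :
    l.withoutRepetitions.Nodup := by
  induction l with
  | nil => exact List.nodup_nil
  | cons b l ih => exact ih.insert

@[fun_prop] theorem Primrec.withoutRepetitions' {α β : Type*} [Primcodable α] [Primcodable β]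
    [DecidableEq β] {f : α → List β} (hf : Primrec f) :
    Primrec fun a => (f a).withoutRepetitions := by
  have h : Primrec fun a => (f a).foldr
      (fun b l => bif l.any (fun c => decide (c = b)) then l else b :: l) [] := by fun_prop
  refine h.of_eq fun a => ?_
  unfold List.withoutRepetitions
  congr 1
  funext b l
  have : (l.any fun c => decide (c = b)) = decide (b ∈ l) := by
    rw [Bool.eq_iff_iff]
    simp
  rw [this]
  by_cases hb : b ∈ l <;> simp [hb]

namespace RawPTM

/-- The possible transitions. -/
def choices (R : RawPTM) (c : RawConfig) : List RawTransition :=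
  ((R.2.2.getD (3 * (c.1 % (R.1 + 1)) + symIndex c.2.2.1) []).map
    fun t => (t.1 % (R.1 + 1), t.2)).withoutRepetitions

def toPTM (R : RawPTM) : PTM where
  n := R.1
  final q := R.2.1.getD q false
  δ q a := ((R.2.2.getD (3 * (q : ℕ) + symIndex a) []).map (toTransition R.1)).toFinset

theorem exists_toPTM (M : PTM) : ∃ R : RawPTM, R.toPTM = M := by
  obtain ⟨n, final, δ⟩ := M
  obtain ⟨fl, hfl⟩ := exists_flags final
  choose f _ hf using fun t : Transition n => exists_toTransition t
  obtain ⟨tbl, htbl⟩ := exists_table [] fun q a => (δ q a).toList.map f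
  refine ⟨(n, fl, tbl), ?_⟩
  simp only [toPTM, hfl, htbl, List.map_map]
  congr
  funext q a
  ext t
  simp [hf]

theorem choices_toPTM (R : RawPTM) (c : RawConfig) :
    R.toPTM.choices (toConfig R.toPTM.n c) = ((R.choices c).map (toTransition R.toPTM.n)).toFinset := by
  ext t
  have h : R.toPTM.choices (toConfig R.toPTM.n c) =
    ((R.2.2.getD (3 * (c.1 % (R.1 + 1)) + symIndex c.2.2.1) []).map
      (toTransition R.toPTM.n)).toFinset := rfl
  rw [h]
  simp only [choices, List.mem_toFinset, List.mem_map, List.mem_withoutRepetitions,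
    exists_exists_and_eq_and]
  refine exists_congr fun r => and_congr_right fun _ => ?_
  have : toTransition R.toPTM.n (r.1 % (R.1 + 1), r.2) = toTransition R.toPTM.n r := by
    simp [toTransition, Fin.ofNat, toPTM]
  rw [this]

/-- In `choices` the states are reduced before repetitions are removed; otherwise raw transitions
that denote the same transition would be counted twice. -/
theorem nodup_choices (R : RawPTM) (c : RawConfig) :
    ((R.choices c).map (toTransition R.toPTM.n)).Nodup := by
  refine List.Nodup.map_on ?_ (List.nodup_withoutRepetitions _)
  have key : ∀ r ∈ R.choices c, r.1 < R.1 + 1 := by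
    intro r hr
    simp only [choices, List.mem_withoutRepetitions, List.mem_map] at hr
    obtain ⟨s, -, rfl⟩ := hr
    exact Nat.mod_lt _ (by omega)
  intro r hr s hs h
  obtain ⟨q, a, d⟩ := r
  obtain ⟨q', a', d'⟩ := s
  have h1 := key _ hr
  have h2 := key _ hs
  simp only [toTransition, Prod.mk.injEq] at h
  obtain ⟨h, rfl, hd⟩ := h
  have h := congrArg Fin.val h
  simp only [Fin.ofNat, toPTM, Nat.mod_eq_of_lt h1, Nat.mod_eq_of_lt h2] at h
  subst h
  rcases d with _ | _ | _ <;> rcases d' with _ | _ | _ <;> simp_all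

theorem card_choices (R : RawPTM) (c : RawConfig) :
    (R.toPTM.choices (toConfig R.toPTM.n c)).card = (R.choices c).length := by
  rw [choices_toPTM]
  exact (List.toFinset_card_of_nodup (R.nodup_choices c)).trans (List.length_map _)

def isFinal (R : RawPTM) (c : RawConfig) : Bool := R.2.1.getD (c.1 % (R.1 + 1)) false

theorem final_toPTM (R : RawPTM) (c : RawConfig) :
    R.toPTM.final (toConfig R.toPTM.n c).state = R.isFinal c := rfl

/-- Expand a node of the tree of configurations; the second component of a node is the product of
the numbers of choices on the path that leads to it. Final and stuck nodes are not changed. -/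
def expand (R : RawPTM) (x : RawConfig × ℕ) : List (RawConfig × ℕ) :=
  bif R.isFinal x.1 || decide ((R.choices x.1).length = 0) then [x]
  else (R.choices x.1).map fun t => (x.1.act t, x.2 * (R.choices x.1).length)

/-- The nodes of the tree after `t` steps. -/
def frontier (R : RawPTM) (t : ℕ) (l : List (RawConfig × ℕ)) : List (RawConfig × ℕ) :=
  (fun l => l.flatMap R.expand)^[t] l

@[fun_prop] theorem primrec_choices {α} [Primcodable α] {R : α → RawPTM} {c : α → RawConfig}
    (hR : Primrec R) (hc : Primrec c) : Primrec fun a => choices (R a) (c a) := by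
  unfold choices
  fun_prop

@[fun_prop] theorem primrec_isFinal {α} [Primcodable α] {R : α → RawPTM} {c : α → RawConfig}
    (hR : Primrec R) (hc : Primrec c) : Primrec fun a => isFinal (R a) (c a) := by
  unfold isFinal
  fun_prop

@[fun_prop] theorem primrec_expand {α} [Primcodable α] {R : α → RawPTM} {x : α → RawConfig × ℕ}
    (hR : Primrec R) (hx : Primrec x) : Primrec fun a => expand (R a) (x a) := by
  unfold expand
  fun_prop

@[fun_prop] theorem primrec_frontier {α} [Primcodable α] {R : α → RawPTM} {t : α → ℕ}
    {l : α → List (RawConfig × ℕ)} (hR : Primrec R) (ht : Primrec t) (hl : Primrec l) :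
    Primrec fun a => frontier (R a) (t a) (l a) := by
  have h : Primrec fun p : α × List (RawConfig × ℕ) => p.2.flatMap (R p.1).expand :=
    Primrec.flatMap' (g := fun p : α × List (RawConfig × ℕ) => (R p.1).expand)
      (by fun_prop) (by fun_prop)
  exact Primrec.iterate' (h := fun a l => l.flatMap (R a).expand) ht hl h

variable {R : RawPTM}

theorem frontier_flatMap (t : ℕ) (l : List (RawConfig × ℕ)) :
    R.frontier t l = l.flatMap fun x => R.frontier t [x] := by
  induction t generalizing l with
  | zero => simp [frontier]
  | succ t ih =>
    have h : ∀ l, R.frontier (t + 1) l = R.frontier t (l.flatMap R.expand) := fun _ => rfl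
    simp only [h]
    rw [ih, List.flatMap_assoc]
    congr 1
    funext x
    rw [ih ([x].flatMap _)]
    simp

theorem frontier_succ (t : ℕ) (x : RawConfig × ℕ) :
    R.frontier (t + 1) [x] = (R.expand x).flatMap fun y => R.frontier t [y] := by
  have h : R.frontier (t + 1) [x] = R.frontier t ([x].flatMap R.expand) := rfl
  rw [h, frontier_flatMap]
  simp

theorem frontier_stop {x : RawConfig × ℕ} (h : R.isFinal x.1 = true ∨ R.choices x.1 = []) (t : ℕ) :
    R.frontier t [x] = [x] := by
  induction t with
  | zero => rfl
  | succ t ih =>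
    have : R.expand x = [x] := by
      rcases h with h | h <;> simp [expand, h]
    rw [frontier_succ, this]
    simpa using ih

theorem frontier_branch {x : RawConfig × ℕ} (h : R.isFinal x.1 = false) (h' : R.choices x.1 ≠ [])
    (t : ℕ) : R.frontier (t + 1) [x] = (R.choices x.1).flatMap fun a =>
      R.frontier t [(x.1.act a, x.2 * (R.choices x.1).length)] := by
  rw [frontier_succ]
  simp [expand, h, h', List.flatMap_map]

theorem forall_choices {c : RawConfig} {P : TMConfig R.toPTM.n → Prop} :
    (∀ a ∈ R.toPTM.choices (toConfig R.toPTM.n c), P ((toConfig R.toPTM.n c).act a)) ↔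
      ∀ r ∈ R.choices c, P (toConfig R.toPTM.n (c.act r)) := by
  rw [choices_toPTM]
  simp only [List.mem_toFinset, List.mem_map, forall_exists_index, and_imp,
    forall_apply_eq_imp_iff₂]
  refine forall₂_congr fun r _ => ?_
  rw [toConfig_act]

theorem sum_choices {c : RawConfig} {g : TMConfig R.toPTM.n → ℚ} :
    ∑ a ∈ R.toPTM.choices (toConfig R.toPTM.n c), g ((toConfig R.toPTM.n c).act a) =
      ((R.choices c).map fun r => g (toConfig R.toPTM.n (c.act r))).sum := by
  rw [choices_toPTM]
  refine (List.sum_toFinset _ (R.nodup_choices c)).trans ?_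
  rw [List.map_map]
  congr 2
  funext r
  rw [toConfig_act]
  rfl

theorem nonempty_choices {c : RawConfig} :
    (R.toPTM.choices (toConfig R.toPTM.n c)).Nonempty ↔ R.choices c ≠ [] := by
  rw [← Finset.card_pos, card_choices, List.length_pos_iff]

/-- Final nodes stay in the frontier. Nodes without choices stay as well, and falsify the test
unless they are final. -/
theorem haltsWithinFrom_iff (t : ℕ) (c : RawConfig) (w : ℕ) :
    R.toPTM.HaltsWithinFrom t (toConfig R.toPTM.n c) ↔
      ∀ x ∈ R.frontier t [(c, w)], R.isFinal x.1 = true := by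
  induction t generalizing c w with
  | zero =>
    rw [PTM.HaltsWithinFrom, final_toPTM]
    simp [frontier]
  | succ t ih =>
    rw [PTM.HaltsWithinFrom, final_toPTM, nonempty_choices, forall_choices]
    by_cases hf : R.isFinal c = true
    · simp [hf, frontier_stop (R := R) (x := (c, w)) (.inl hf)]
    by_cases hc : R.choices c = []
    · simp [hf, hc, frontier_stop (R := R) (x := (c, w)) (.inr hc)]
    rw [frontier_branch (by simpa using hf) hc]
    simp only [List.mem_flatMap, forall_exists_index, and_imp]
    simp only [hf, hc, ne_eq, not_false_eq_true, true_and, false_or, Bool.false_eq_true]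
    rw [forall_comm]
    refine forall_congr' fun r => ?_
    rw [forall_comm, ih (c.act r) (w * (R.choices c).length)]

theorem pos_frontier {t : ℕ} {l : List (RawConfig × ℕ)} (hl : ∀ x ∈ l, 0 < x.2) :
    ∀ x ∈ R.frontier t l, 0 < x.2 := by
  induction t generalizing l with
  | zero => exact hl
  | succ t ih =>
    refine ih (l := l.flatMap R.expand) fun y hy => ?_
    obtain ⟨x, hx, hy⟩ := List.mem_flatMap.1 hy
    unfold expand at hy
    cases h : R.isFinal x.1 || decide ((R.choices x.1).length = 0)
    · rw [h] at hy
      obtain ⟨r, -, rfl⟩ := List.mem_map.1 hy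
      simp only [Bool.or_eq_false_iff, decide_eq_false_iff_not] at h
      exact Nat.mul_pos (hl x hx) (Nat.pos_of_ne_zero h.2)
    · rw [h] at hy
      rw [List.mem_singleton.1 hy]
      exact hl x hx

/-- For multiplicative `f`, the weight of a path is `f` of the product of its branching numbers,
which is what the nodes carry. The initial factor `w` is there for the induction. -/
theorem total_eq {f : ℕ → ℚ} (hf : ∀ a b, f (a * b) = f a * f b) {p : TMConfig R.toPTM.n → Prop}
    {q : RawConfig → Bool} (hpq : ∀ c, p (toConfig R.toPTM.n c) ↔ q c = true) {t : ℕ}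
    {c : RawConfig} (h : R.toPTM.HaltsWithinFrom t (toConfig R.toPTM.n c)) (w : ℕ) :
    f w * R.toPTM.total f p (toConfig R.toPTM.n c) =
      (((R.frontier t [(c, w)]).filter fun x => q x.1).map fun x => f x.2).sum := by
  classical
  have h0 : ∀ t c w, R.isFinal c = true → f w * R.toPTM.total f p (toConfig R.toPTM.n c) =
      (((R.frontier t [(c, w)]).filter fun x => q x.1).map fun x => f x.2).sum := by
    intro t c w hc
    rw [PTM.total_final hc, frontier_stop (.inl hc)]
    simp only [hpq, List.filter_cons]
    cases q c <;> simp
  induction t generalizing c w with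
  | zero => exact h0 _ _ _ h
  | succ t ih =>
    by_cases hc : R.isFinal c = true
    · exact h0 _ _ _ hc
    have hh := h.resolve_left hc
    have hc : R.isFinal c = false := by simpa using hc
    rw [nonempty_choices, forall_choices] at hh
    rw [PTM.total_step hc, frontier_branch hc hh.1, sum_choices, card_choices, ← mul_assoc, ← hf,
      ← List.sum_map_mul_left, List.filter_flatMap, List.map_flatMap, List.flatMap, List.sum_flatten,
      List.map_map]
    · congr 1
      refine List.map_congr_left fun r hr => ?_
      exact ih (hh.2 r hr) _
    · refine (forall_choices (P := fun c => (R.toPTM.branchesFrom p c).Finite)).2 ?_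
      exact fun r hr => PTM.finite_branchesFrom (hh.2 r hr)

end RawPTM

/-! Probabilistic machines with finitely many nontrivial inputs. -/

namespace DTM

/-- Write a random bit in front of the input and then run `D`. -/
def withCoin (D : DTM) : PTM where
  n := D.n + 2
  final q := if h : q.1 < 2 then false else D.final ⟨q.1 - 2, by omega⟩
  δ q a := if h : q.1 < 2 then
      if q.1 = 0 then {(1, a, some .left)} else {(2, some false, none), (2, some true, none)}
    else
      let r := D.δ ⟨q.1 - 2, by omega⟩ a
      {(⟨r.1.1 + 2, by omega⟩, r.2)}

variable (D : DTM)

/-- A configuration of `D` as a configuration of `D.withCoin`. -/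
def coinShift (c : TMConfig D.n) : TMConfig D.withCoin.n :=
  ⟨⟨c.state.1 + 2, Nat.succ_lt_succ (Nat.succ_lt_succ c.state.2)⟩, c.tape⟩

theorem withCoin_final (c : TMConfig D.n) :
    D.withCoin.final (D.coinShift c).state = D.final c.state := by
  simp [withCoin, coinShift]

theorem withCoin_choices (c : TMConfig D.n) : D.withCoin.choices (D.coinShift c) =
    {(⟨(D.δ c.state c.tape.head).1.1 + 2, by simp only [withCoin]; omega⟩,
      (D.δ c.state c.tape.head).2)} := by
  simp [PTM.choices, withCoin, coinShift]
  rfl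

theorem withCoin_act (c : TMConfig D.n) (h : D.final c.state = false) :
    (D.coinShift c).act (⟨(D.δ c.state c.tape.head).1.1 + 2, by simp only [withCoin]; omega⟩,
      (D.δ c.state c.tape.head).2) = D.coinShift (D.step c) := by
  simp only [DTM.step, h, TMConfig.act, coinShift]
  rfl

theorem withCoin_halts {t : ℕ} {c : TMConfig D.n} (h : D.final (D.step^[t] c).state = true) :
    D.withCoin.HaltsWithinFrom t (D.coinShift c) := by
  induction t generalizing c with
  | zero => rwa [PTM.HaltsWithinFrom, withCoin_final]
  | succ t ih =>
    rw [PTM.HaltsWithinFrom, withCoin_final, withCoin_choices]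
    rcases hc : D.final c.state
    · refine Or.inr ⟨Finset.singleton_nonempty _, fun a ha => ?_⟩
      rw [Finset.mem_singleton.1 ha, withCoin_act _ _ hc]
      exact ih h
    · exact Or.inl rfl

open Classical in
theorem withCoin_total {f : ℕ → ℚ} (hf : f 1 = 1) {p : TMConfig D.withCoin.n → Prop} {t : ℕ}
    {c : TMConfig D.n} (h : D.final (D.step^[t] c).state = true) :
    D.withCoin.total f p (D.coinShift c) = if p (D.coinShift (D.step^[t] c)) then 1 else 0 := by
  induction t generalizing c with
  | zero => exact PTM.total_final (by rw [withCoin_final]; exact h)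
  | succ t ih =>
    rcases hc : D.final c.state
    · rw [PTM.total_step (by rw [withCoin_final, hc]), withCoin_choices, Finset.card_singleton, hf,
        one_mul, Finset.sum_singleton, withCoin_act _ _ hc, ih h]
      · rfl
      · rw [withCoin_choices]
        intro a ha
        rw [Finset.mem_singleton.1 ha, withCoin_act _ _ hc]
        exact PTM.finite_branchesFrom (D.withCoin_halts (t := t) h)
    · rw [PTM.total_final (by rw [withCoin_final, hc]), DTM.iterate_final _ hc]

/-- The configuration in which the coin is thrown. -/
def coinConfig (u : List (Option Bool)) : TMConfig D.withCoin.n :=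
  (TMConfig.init _ u).act (1, (TMConfig.init D.withCoin.n u).tape.head, some .left)

theorem choices_init (u : List (Option Bool)) : D.withCoin.choices (TMConfig.init _ u) =
    {(1, (TMConfig.init D.withCoin.n u).tape.head, some .left)} := by
  simp [PTM.choices, withCoin, TMConfig.init]
  rfl

theorem choices_coinConfig (u : List (Option Bool)) : D.withCoin.choices (D.coinConfig u) =
    {(2, some false, none), (2, some true, none)} := by
  simp [PTM.choices, withCoin, coinConfig, TMConfig.act]
  rfl

theorem coinConfig_act (u : List (Option Bool)) (b : Bool) : (D.coinConfig u).act (2, some b, none) =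
    D.coinShift (TMConfig.init _ (some b :: u)) := by
  have hs : (2 : Fin (D.withCoin.n + 1)) = ⟨0 + 2, by simp only [withCoin]; omega⟩ :=
    Fin.ext (Nat.mod_eq_of_lt (by simp only [withCoin]; omega))
  obtain ⟨a, r, hr⟩ := exists_cons_of_tp [] u
  have h : tp [] (some b :: u) = tp [] (some b :: a :: r) := by
    have h' : Turing.ListBlank.mk u = Turing.ListBlank.mk (a :: r) := by
      have := congrArg Turing.Tape.right₀ hr
      simpa [tp, Turing.Tape.mk₂] using this
    simp only [tp, Turing.Tape.mk₂]
    rw [← Turing.ListBlank.cons_mk, h', Turing.ListBlank.cons_mk]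
  have h0 : (D.coinConfig u).tape = tp [] (none :: a :: r) := by
    simp only [coinConfig, TMConfig.act, init_eq_tp, hr]
    exact actTape_left_nil _ _ _
  have h1 := actTape_stay [] none (a :: r) (some b)
  rw [← h0] at h1
  have h2 : (D.coinConfig u).act (2, some b, none) = ⟨2, tp [] (some b :: a :: r)⟩ :=
    congrArg (TMConfig.mk 2) h1
  have h3 : D.coinShift (TMConfig.init _ (some b :: u)) =
      ⟨⟨0 + 2, by simp only [withCoin]; omega⟩, tp [] (some b :: a :: r)⟩ :=
    congrArg (TMConfig.mk _) h
  rw [h2, h3, hs]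

theorem final_init (u : List (Option Bool)) :
    D.withCoin.final (TMConfig.init D.withCoin.n u).state = false := by
  simp [withCoin, TMConfig.init]

theorem final_coinConfig (u : List (Option Bool)) :
    D.withCoin.final (D.coinConfig u).state = false := by
  simp [withCoin, coinConfig, TMConfig.act]

variable {D} {u : List (Option Bool)} {t : ℕ}

theorem withCoin_haltsWithin (h : ∀ b, D.HaltsWithin (some b :: u) t) :
    D.withCoin.HaltsWithinFrom (t + 1) (D.coinConfig u) ∧ D.withCoin.HaltsWithin u (t + 2) := by
  have h1 : D.withCoin.HaltsWithinFrom (t + 1) (D.coinConfig u) := by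
    refine Or.inr ?_
    rw [choices_coinConfig]
    refine ⟨⟨_, Finset.mem_insert_self _ _⟩, fun a ha => ?_⟩
    obtain ⟨b, rfl⟩ : ∃ b, a = (2, some b, none) := by
      rcases Finset.mem_insert.1 ha with rfl | ha
      · exact ⟨false, rfl⟩
      · exact ⟨true, Finset.mem_singleton.1 ha⟩
    rw [coinConfig_act]
    exact D.withCoin_halts (h b)
  refine ⟨h1, Or.inr ?_⟩
  rw [choices_init]
  refine ⟨Finset.singleton_nonempty _, fun a ha => ?_⟩
  rw [Finset.mem_singleton.1 ha]
  exact h1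

-- Only the coin toss branches. All other steps have a single choice, of weight `f 1 = 1`, and so
-- both branches have weight `f 2`.
open Classical in
theorem withCoin_total_init (h : ∀ b, D.HaltsWithin (some b :: u) t) {f : ℕ → ℚ} (hf : f 1 = 1)
    (p : TMConfig D.withCoin.n → Prop) : D.withCoin.total f p (TMConfig.init _ u) =
      f 2 * ((if p (D.coinShift (D.config (some false :: u) t)) then 1 else 0) +
        if p (D.coinShift (D.config (some true :: u) t)) then 1 else 0) := by
  have h1 := (withCoin_haltsWithin h).1
  have hc : D.withCoin.total f p (D.coinConfig u) =
      f 2 * ((if p (D.coinShift (D.config (some false :: u) t)) then 1 else 0) +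
        if p (D.coinShift (D.config (some true :: u) t)) then 1 else 0) := by
    rw [PTM.total_step (D.final_coinConfig u), choices_coinConfig, Finset.card_pair (by simp),
      Finset.sum_pair (by simp), coinConfig_act, coinConfig_act, D.withCoin_total hf (h false),
      D.withCoin_total hf (h true)]
    · rfl
    · intro a ha
      exact PTM.finite_branchesFrom ((h1.resolve_left (by simp [final_coinConfig])).2 a ha)
  rw [PTM.total_step (D.final_init u), choices_init, Finset.card_singleton, hf, one_mul,
    Finset.sum_singleton]
  · exact hc
  · rw [choices_init]
    intro a ha
    rw [Finset.mem_singleton.1 ha]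
    exact PTM.finite_branchesFrom h1

end DTM

/-! Acceptance measures. -/

namespace AcceptanceMeasure

/-- The measure is rational, and numerator and denominator can be computed. -/
def IsComputable (P : AcceptanceMeasure) : Prop :=
  ∃ g : RawPTM → List (Option Bool) → ℕ → ℕ × ℕ,
    (Primrec fun p : RawPTM × List (Option Bool) × ℕ => g p.1 p.2.1 p.2.2) ∧
    ∀ R u t, R.toPTM.HaltsWithin u t →
      0 < (g R u t).2 ∧ P R.toPTM u = ((g R u t).1 : ℚ) / ((g R u t).2 : ℚ)

/-- The acceptance of an input with the given answer. -/
def ofAnswer : Option Bool → ℚ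
  | some true => 1
  | some false => 0
  | none => 1 / 2

/-- Problems that are constant up to finitely many inputs are solved by machines of constant
runtime. -/
def HasLookup (P : AcceptanceMeasure) : Prop :=
  ∀ (N : ℕ) (g : List Bool → Option Bool), ∃ (M : PTM) (B : ℕ), ∀ (x : List Bool) (v),
    (v = [] ∨ ∃ v', v = none :: v') → M.HaltsWithin (x.map some ++ v) B ∧
      P M (x.map some ++ v) = ofAnswer (if x.length < N then g x else some false)

open RawConfig RawPTM

theorem isComputable_acceptFraction : IsComputable PTM.acceptFraction := by
  refine ⟨fun R u t => (((R.frontier t [(RawConfig.init u, 1)]).filter fun x =>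
    decide (x.1.out = [true])).length, (R.frontier t [(RawConfig.init u, 1)]).length),
    by fun_prop, fun R u t h => ?_⟩
  have h' := h
  rw [PTM.HaltsWithin, ← toConfig_init] at h'
  have h1 := total_eq (R := R) (f := fun _ => 1) (by simp) (p := fun c => c.Output [true])
    (q := fun c => decide (c.out = [true])) (by simp [output_iff]) h' 1
  have h2 := total_eq (R := R) (f := fun _ => 1) (by simp) (p := fun _ => True)
    (q := fun _ => true) (by simp) h' 1
  -- Stuck nodes are kept and all others have successors or are final, so a frontier never becomes
  -- empty.
  have hpos : 0 < (R.frontier t [(RawConfig.init u, 1)]).length := by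
    rw [List.length_pos_iff]
    clear h h' h1 h2
    have : ∀ l : List (RawConfig × ℕ), l ≠ [] → R.frontier t l ≠ [] := by
      induction t with
      | zero => exact fun l hl => hl
      | succ t ih =>
        intro l hl
        refine ih (l.flatMap R.expand) fun h => ?_
        obtain ⟨x, hx⟩ := List.exists_mem_of_ne_nil l hl
        have := List.flatMap_eq_nil_iff.1 h x hx
        unfold expand at this
        cases h : R.isFinal x.1 || decide ((R.choices x.1).length = 0)
        · rw [h] at this
          simp_all
        · rw [h] at this
          exact List.cons_ne_nil _ _ this
    exact this _ (List.cons_ne_nil _ _)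
  refine ⟨hpos, ?_⟩
  rw [PTM.acceptFraction_eq h, ← toConfig_init, ← one_mul (PTM.total _ _ _ _), h1,
    ← one_mul (PTM.total _ _ (fun _ => True) _), h2]
  simp

theorem isComputable_acceptProbability : IsComputable PTM.acceptProbability := by
  -- A common denominator: the product of the numbers carried by all leaves, each of which divides
  -- it.
  let den : List (RawConfig × ℕ) → ℕ := fun l => (l.map Prod.snd).foldr (fun a b => a * b) 1
  refine ⟨fun R u t =>
    ((((R.frontier t [(RawConfig.init u, 1)]).filter fun x => decide (x.1.out = [true])).map
      fun x => den (R.frontier t [(RawConfig.init u, 1)]) / x.2).sum,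
      den (R.frontier t [(RawConfig.init u, 1)])), ?_, fun R u t h => ?_⟩
  · simp only [den]
    fun_prop
  · rw [PTM.HaltsWithin, ← toConfig_init] at h
    have h1 := total_eq (R := R) (f := fun k => 1 / (k : ℚ)) (by intro a b; push_cast; ring)
      (p := fun c => c.Output [true])
      (q := fun c => decide (c.out = [true])) (by simp [output_iff]) h 1
    rw [PTM.acceptProbability_eq, ← toConfig_init]
    rw [Nat.cast_one, div_one, one_mul] at h1
    rw [h1]
    have hpos := pos_frontier (R := R) (t := t) (l := [(RawConfig.init u, 1)]) (by simp)
    dsimp only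
    generalize R.frontier t [(RawConfig.init u, 1)] = l at hpos
    have hden : den l = (l.map Prod.snd).prod := rfl
    have hden0 : 0 < den l := by
      rw [hden]
      exact List.prod_pos fun a ha => by
        obtain ⟨x, hx, rfl⟩ := List.mem_map.1 ha
        exact hpos x hx
    refine ⟨hden0, ?_⟩
    simp only [Nat.cast_list_sum, List.map_map]
    rw [eq_div_iff (by positivity), ← List.sum_map_mul_right]
    congr 1
    refine List.map_congr_left fun x hx => ?_
    have hxl := (List.mem_filter.1 hx).1
    have hdvd : x.2 ∣ den l := by
      rw [hden]
      exact List.dvd_prod (List.mem_map_of_mem hxl)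
    have := hpos x hxl
    rw [Function.comp, Nat.cast_div hdvd (by positivity)]
    ring

/-- The values of both measures for machines that run on a random bit and the input. -/
theorem hasLookup_of_coin {P : AcceptanceMeasure}
    (h : ∀ (D : DTM) (u t) (g : Bool → List Bool), (∀ b, D.OutputsWithin (some b :: u) t (g b)) →
      P D.withCoin u = ((if g false = [true] then 1 else 0) + if g true = [true] then 1 else 0) / 2) :
    HasLookup P := by
  intro N g
  -- Where the promise fails the coin itself is the output, which gives acceptance `1/2`; otherwise
  -- the coin is ignored.
  let g' : List Bool → List Bool := fun s =>
    [((if s.tail.length < N then g s.tail else some false)).getD s.headI]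
  obtain ⟨D, B, hD⟩ := DTM.exists_lookup (N + 1) g'
  refine ⟨D.withCoin, B + 2, fun x v hv => ?_⟩
  have hD' : ∀ b, D.OutputsWithin (some b :: (x.map some ++ v)) B
      [((if x.length < N then g x else some false)).getD b] := fun b => by
    have := hD (b :: x) v hv
    have e : g' ((b :: x).take (N + 1)) = [(if x.length < N then g x else some false).getD b] :=
      congrArg (fun o : Option Bool => [o.getD b]) (ite_take N g (some false) x)
    rwa [e] at this
  refine ⟨(DTM.withCoin_haltsWithin fun b => (hD' b).1).2, ?_⟩
  rw [h D _ B _ hD']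
  rcases (if x.length < N then g x else some false) with _ | _ | _ <;> simp [ofAnswer]

theorem coinShift_output {D : DTM} {u t w} (h : D.OutputsWithin u t w) :
    (D.coinShift (D.config u t)).Output [true] ↔ w = [true] :=
  ⟨fun h' => h.2.unique h', fun h' => h' ▸ h.2⟩

theorem hasLookup_acceptFraction : HasLookup PTM.acceptFraction := by
  classical
  refine hasLookup_of_coin fun D u t g h => ?_
  have hh := fun b => (h b).1
  rw [PTM.acceptFraction_eq (DTM.withCoin_haltsWithin hh).2, DTM.withCoin_total_init hh rfl,
    DTM.withCoin_total_init hh rfl]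
  simp only [coinShift_output (h _)]
  norm_num

theorem hasLookup_acceptProbability : HasLookup PTM.acceptProbability := by
  classical
  refine hasLookup_of_coin fun D u t g h => ?_
  have hh := fun b => (h b).1
  rw [PTM.acceptProbability_eq, DTM.withCoin_total_init hh (by simp)]
  simp only [coinShift_output (h _)]
  push_cast
  ring

end AcceptanceMeasure

/-! Extremal problems. -/

/-- If the problems decided by `M` are exactly those below `e M`, then `e M` is the greatest of
them, and greatest elements are unique. -/
theorem extremalClass_eq {Mach : Type} {dec : Mach → PromiseProblem → Prop}
    (e : Mach → PromiseProblem) (h : ∀ M A, dec M A ↔ A ≤ e M) :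
    extremalClass dec = Set.range e := by
  have hg : ∀ M, IsExtremalProblem dec M (e M) := fun M =>
    ⟨(h M _).2 le_rfl, fun B hB => (h M B).1 hB⟩
  ext A
  constructor
  · rintro ⟨-, M, hM⟩
    exact ⟨M, (hg M).unique hM⟩
  · rintro ⟨M, rfl⟩
    exact ⟨⟨M, (hg M).1⟩, M, hg M⟩

/-- Two tests, the second of which is only relevant if the first one fails. -/
def ofTests (y n : Bool) : Option Bool := bif y then some true else bif n then some false else none

@[fun_prop] theorem primrec_ofTests {α} [Primcodable α] {y n : α → Bool} (hy : Primrec y)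
    (hn : Primrec n) : Primrec fun a => ofTests (y a) (n a) := by
  unfold ofTests
  fun_prop

theorem eq_problemOf_ofTests {A : PromiseProblem} {y n : List Bool → Bool}
    (hy : ∀ x, x ∈ A.yes ↔ y x = true) (hn : ∀ x, x ∈ A.no ↔ n x = true) :
    A = problemOf fun x => ofTests (y x) (n x) := by
  have hd : ∀ x, y x = true → n x = true → False := fun x h h' =>
    Set.disjoint_left.1 A.disj ((hy x).2 h) ((hn x).2 h')
  ext x
  · rw [hy]
    change _ ↔ ofTests (y x) (n x) = some true
    unfold ofTests
    cases y x <;> cases n x <;> simp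
  · rw [hn]
    change _ ↔ ofTests (y x) (n x) = some false
    have := hd x
    unfold ofTests
    revert this
    cases y x <;> cases n x <;> simp

/-! PromiseBPP and PromiseMA. -/

/-- The extremal problem of a machine. -/
def BPPMachine.extremal (P : AcceptanceMeasure) (V : BPPMachine) : PromiseProblem where
  yes := {x | P V.M (tapeInput x) ≥ 2 / 3}
  no := {x | P V.M (tapeInput x) ≤ 1 / 3}
  disj := Set.disjoint_left.2 fun x h h' => by
    have h : P V.M (tapeInput x) ≥ 2 / 3 := h
    have h' : P V.M (tapeInput x) ≤ 1 / 3 := h'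
    linarith

theorem promiseBPPStar_eq (P : AcceptanceMeasure) :
    PromiseBPPStar P = Set.range (BPPMachine.extremal P) :=
  extremalClass_eq _ fun _ _ => Iff.rfl

/-- The extremal problem of a machine. -/
def MAMachine.extremal (P : AcceptanceMeasure) (V : MAMachine) : PromiseProblem where
  yes := {x | ∃ y : List Bool, y.length = V.m x.length ∧ P V.M (tapeInput₂ x y) ≥ 2 / 3}
  no := {x | ∀ y : List Bool, y.length = V.m x.length → P V.M (tapeInput₂ x y) ≤ 1 / 3}
  disj := Set.disjoint_left.2 fun x ⟨y, hy, h⟩ h' => by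
    have := h' y hy
    linarith

theorem promiseMAStar_eq (P : AcceptanceMeasure) :
    PromiseMAStar P = Set.range (MAMachine.extremal P) :=
  extremalClass_eq _ fun _ _ => Iff.rfl

namespace AcceptanceMeasure

theorem div_ge_iff {a b : ℕ} (hb : 0 < b) : (a : ℚ) / b ≥ 2 / 3 ↔ (2 * b).ble (3 * a) = true := by
  have : (0 : ℚ) < b := by exact_mod_cast hb
  rw [Nat.ble_eq, ge_iff_le, div_le_div_iff₀ (by norm_num) this, ← Nat.cast_le (α := ℚ)]
  push_cast
  rw [mul_comm (a : ℚ)]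

theorem div_le_iff {a b : ℕ} (hb : 0 < b) : (a : ℚ) / b ≤ 1 / 3 ↔ (3 * a).ble b = true := by
  have : (0 : ℚ) < b := by exact_mod_cast hb
  rw [Nat.ble_eq, div_le_div_iff₀ this (by norm_num), ← Nat.cast_le (α := ℚ)]
  push_cast
  rw [mul_comm (a : ℚ), one_mul]

theorem haltsWithin_iff {R : RawPTM} {u : List (Option Bool)} {t : ℕ} : R.toPTM.HaltsWithin u t ↔
    ((R.frontier t [(RawConfig.init u, 1)]).all fun x => R.isFinal x.1) = true := by
  rw [PTM.HaltsWithin, ← RawConfig.toConfig_init, RawPTM.haltsWithinFrom_iff t _ 1,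
    List.all_eq_true]

theorem ofAnswer_ge {o : Option Bool} : ofAnswer o ≥ 2 / 3 ↔ o = some true := by
  rcases o with _ | _ | _ <;> simp [ofAnswer] <;> norm_num

theorem ofAnswer_le {o : Option Bool} : ofAnswer o ≤ 1 / 3 ↔ o = some false := by
  rcases o with _ | _ | _ <;> simp [ofAnswer] <;> norm_num

/-- Every machine that respects the clock is legal, because no gap between the thresholds is
demanded. The checks therefore test only the runtime, and the thresholds become inequalities between
natural numbers. -/
theorem promiseBPPStar_presentable {P : AcceptanceMeasure} (hP : P.IsComputable)
    (hP' : P.HasLookup) : RecursivelyPresentable (PromiseBPPStar P) := by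
  obtain ⟨g, hg, hgP⟩ := hP
  let q : RawPTM × ℕ → List Bool → ℕ × ℕ := fun i x =>
    g i.1 (tapeInput x) ((x.length + 2) ^ i.2)
  have hq : ∀ {α : Type} [Primcodable α] {i : α → RawPTM × ℕ} {x : α → List Bool}, Primrec i →
      Primrec x → Primrec fun a => q (i a) (x a) := fun hi hx =>
    hg.comp (g := fun a => (_, _, _)) (by fun_prop)
  let val : RawPTM × ℕ → List Bool → Option Bool := fun i x =>
    ofTests ((2 * (q i x).2).ble (3 * (q i x).1)) ((3 * (q i x).1).ble (q i x).2)
  let chk : RawPTM × ℕ → ℕ → Bool := fun i n => (strings n).all fun x =>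
    (i.1.frontier ((n + 2) ^ i.2) [(RawConfig.init (tapeInput x), 1)]).all fun x => i.1.isFinal x.1
  have hval : ∀ (i : RawPTM × ℕ) (V : BPPMachine), V.M = i.1.toPTM →
      (∀ x, i.1.toPTM.HaltsWithin (tapeInput x) ((x.length + 2) ^ i.2)) →
      V.extremal P = problemOf (val i) := by
    intro i V hV h
    refine eq_problemOf_ofTests (fun x => ?_) fun x => ?_
    · change P V.M (tapeInput x) ≥ 2 / 3 ↔ _
      rw [hV, (hgP _ _ _ (h x)).2, div_ge_iff (hgP _ _ _ (h x)).1]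
    · change P V.M (tapeInput x) ≤ 1 / 3 ↔ _
      rw [hV, (hgP _ _ _ (h x)).2, div_le_iff (hgP _ _ _ (h x)).1]
  rw [promiseBPPStar_eq]
  refine presentable_of_checked (chk := chk) (val := val) ?_ ?_ (fun i hi => ?_) ?_ fun i N => ?_
  · simp only [chk]
    fun_prop
  · have := hq (α := (RawPTM × ℕ) × List Bool) (i := fun p => p.1) (x := fun p => p.2)
      (by fun_prop) (by fun_prop)
    simp only [val]
    fun_prop
  · have h : ∀ x, i.1.toPTM.HaltsWithin (tapeInput x) ((x.length + 2) ^ i.2) := fun x =>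
      haltsWithin_iff.2 (List.all_eq_true.1 (hi x.length) x (mem_strings.2 rfl))
    exact ⟨⟨i.1.toPTM, (Polynomial.X + 2) ^ i.2, fun x => by
      rw [Polynomial.eval_polyBound]; exact h x⟩, hval i _ rfl h⟩
  · rintro _ ⟨⟨M, p, hp⟩, rfl⟩
    obtain ⟨R, rfl⟩ := RawPTM.exists_toPTM M
    obtain ⟨c, hc⟩ := p.exists_eval_le
    have h := fun x => (hp x).mono (hc _)
    refine ⟨(R, c), fun n => List.all_eq_true.2 fun x hx => ?_, hval (R, c) _ rfl h⟩
    obtain rfl := mem_strings.1 hx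
    exact haltsWithin_iff.1 (h x)
  · obtain ⟨M, B, h⟩ := hP' N (val i)
    have h := fun x => h x [] (.inl rfl)
    simp only [List.append_nil] at h
    refine ⟨⟨M, Polynomial.C B, fun x => by simpa [tapeInput] using (h x).1⟩, ?_⟩
    ext x
    · change P M (tapeInput x) ≥ 2 / 3 ↔ _
      rw [tapeInput, (h x).2, ofAnswer_ge]
      rfl
    · change P M (tapeInput x) ≤ 1 / 3 ↔ _
      rw [tapeInput, (h x).2, ofAnswer_le]
      rfl

/-- As for PromiseBPP, with a search over witnesses. In addition to the runtime on all pairs, the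
checks test the machine that outputs the witness length. -/
theorem promiseMAStar_presentable {P : AcceptanceMeasure} (hP : P.IsComputable)
    (hP' : P.HasLookup) : RecursivelyPresentable (PromiseMAStar P) := by
  obtain ⟨g, hg, hgP⟩ := hP
  let q : (RawPTM × RawDTM) × ℕ → List Bool → List Bool → ℕ × ℕ := fun i x y =>
    g i.1.1 (tapeInput₂ x y) ((x.length + y.length + 2) ^ i.2)
  have hq : Primrec fun a : ((RawPTM × RawDTM) × ℕ) × List Bool × List Bool =>
      q a.1 a.2.1 a.2.2 := hg.comp (g := fun a => (_, _, _)) (by fun_prop)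
  let m : (RawPTM × RawDTM) × ℕ → ℕ → ℕ := fun i n => polyVal (i.1.2, i.2) n
  let val : (RawPTM × RawDTM) × ℕ → List Bool → Option Bool := fun i x =>
    ofTests ((strings (m i x.length)).any fun y => (2 * (q i x y).2).ble (3 * (q i x y).1))
      ((strings (m i x.length)).all fun y => (3 * (q i x y).1).ble (q i x y).2)
  let hlt : (RawPTM × RawDTM) × ℕ → ℕ → Bool := fun i n => (List.range (n + 1)).all fun k =>
    (strings k).all fun x => (strings (n - k)).all fun y =>
      (i.1.1.frontier ((x.length + y.length + 2) ^ i.2) [(RawConfig.init (tapeInput₂ x y), 1)]).all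
        fun x => i.1.1.isFinal x.1
  let chk : (RawPTM × RawDTM) × ℕ → ℕ → Bool := fun i n => polyCheck (i.1.2, i.2) n && hlt i n
  have hval : ∀ (i : (RawPTM × RawDTM) × ℕ) (V : MAMachine), V.M = i.1.1.toPTM →
      (∀ n, V.m n = m i n) → (∀ x y, i.1.1.toPTM.HaltsWithin (tapeInput₂ x y)
        ((x.length + y.length + 2) ^ i.2)) → V.extremal P = problemOf (val i) := by
    intro i V hV hm h
    refine eq_problemOf_ofTests (fun x => ?_) fun x => ?_
    · change (∃ y : List Bool, y.length = V.m x.length ∧ P V.M (tapeInput₂ x y) ≥ 2 / 3) ↔ _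
      simp only [List.any_eq_true, mem_strings, ← hm]
      refine exists_congr fun y => and_congr_right fun _ => ?_
      rw [hV, (hgP _ _ _ (h x y)).2, div_ge_iff (hgP _ _ _ (h x y)).1]
    · change (∀ y : List Bool, y.length = V.m x.length → P V.M (tapeInput₂ x y) ≤ 1 / 3) ↔ _
      simp only [List.all_eq_true, mem_strings, ← hm]
      refine forall₂_congr fun y _ => ?_
      rw [hV, (hgP _ _ _ (h x y)).2, div_le_iff (hgP _ _ _ (h x y)).1]
  rw [promiseMAStar_eq]
  refine presentable_of_checked (chk := chk) (val := val) ?_ ?_ (fun i hi => ?_) ?_ fun i N => ?_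
  · simp only [chk, hlt]
    fun_prop
  · simp only [val, m]
    clear_value q
    fun_prop
  · have h : ∀ n, _ := fun n => hi n
    simp only [chk, Bool.and_eq_true, forall_and] at h
    obtain ⟨h1, h2⟩ := h
    have h2 : ∀ x y, i.1.1.toPTM.HaltsWithin (tapeInput₂ x y)
        ((x.length + y.length + 2) ^ i.2) := fun x y => by
      have := h2 (x.length + y.length)
      simp only [hlt] at this
      rw [List.all_eq_true] at this
      have := this x.length (by rw [List.mem_range]; omega)
      rw [List.all_eq_true] at this
      have := this x (mem_strings.2 rfl)
      rw [List.all_eq_true] at this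
      exact haltsWithin_iff.2 (this y (mem_strings.2 (by omega)))
    exact ⟨⟨i.1.1.toPTM, m i, ⟨(Polynomial.X + 2) ^ i.2, fun x y => by
      rw [Polynomial.eval_polyBound]; exact h2 x y⟩, inPoly_polyVal h1⟩,
      hval i _ rfl (fun _ => rfl) h2⟩
  · rintro _ ⟨⟨M, m', ⟨p, hp⟩, hm⟩, rfl⟩
    obtain ⟨R, rfl⟩ := RawPTM.exists_toPTM M
    obtain ⟨c, hc⟩ := p.exists_eval_le
    obtain ⟨D, c₀, hD⟩ := exists_polyVal hm
    obtain ⟨hm', hpc⟩ := hD (max c c₀) (le_max_right _ _)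
    have h : ∀ x y, R.toPTM.HaltsWithin (tapeInput₂ x y)
        ((x.length + y.length + 2) ^ max c c₀) :=
      fun x y => (hp x y).mono ((hc _).trans (polyBound_mono (le_max_left _ _)))
    refine ⟨((R, D), max c c₀), fun n => ?_, hval _ _ rfl (fun n => (hm' n).symm) h⟩
    simp only [chk, hlt, Bool.and_eq_true]
    exact ⟨hpc n, List.all_eq_true.2 fun k _ => List.all_eq_true.2 fun x _ =>
      List.all_eq_true.2 fun y _ => haltsWithin_iff.1 (h x y)⟩
  · obtain ⟨M, B, h⟩ := hP' N (val i)
    have h := fun x y : List Bool => h x (none :: y.map some) (.inr ⟨_, rfl⟩)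
    refine ⟨⟨M, fun _ => 0, ⟨Polynomial.C B, fun x y => by simpa [tapeInput₂] using (h x y).1⟩,
      inPoly_const 0⟩, ?_⟩
    ext x
    · change (∃ y : List Bool, y.length = 0 ∧ P M (tapeInput₂ x y) ≥ 2 / 3) ↔ _
      simp only [tapeInput₂, (h x _).2, ofAnswer_ge]
      exact ⟨fun ⟨_, _, h⟩ => h, fun h => ⟨[], rfl, h⟩⟩
    · change (∀ y : List Bool, y.length = 0 → P M (tapeInput₂ x y) ≤ 1 / 3) ↔ _
      simp only [tapeInput₂, (h x _).2, ofAnswer_le]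
      exact ⟨fun h => h [] rfl, fun h _ _ => h⟩

theorem presentable_of_mem {P : AcceptanceMeasure}
    (h : P ∈ ({PTM.acceptFraction, PTM.acceptProbability} : Set AcceptanceMeasure)) :
    RecursivelyPresentable (PromiseBPPStar P) ∧ RecursivelyPresentable (PromiseMAStar P) := by
  rcases h with rfl | rfl
  · exact ⟨promiseBPPStar_presentable isComputable_acceptFraction hasLookup_acceptFraction,
      promiseMAStar_presentable isComputable_acceptFraction hasLookup_acceptFraction⟩
  · exact ⟨promiseBPPStar_presentable isComputable_acceptProbability hasLookup_acceptProbability,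
      promiseMAStar_presentable isComputable_acceptProbability hasLookup_acceptProbability⟩

end AcceptanceMeasure

/-! Matrices over the ring that is generated by an eighth root of unity, as data. -/

namespace PathSum

/-- The primitive eighth root of unity. -/
noncomputable def ω : ℂ := Complex.exp (Complex.I * (Real.pi : ℂ) / 4)

theorem ω_eq : ω = ((Real.sqrt 2 / 2 : ℝ) : ℂ) + ((Real.sqrt 2 / 2 : ℝ) : ℂ) * Complex.I := by
  have : Complex.I * (Real.pi : ℂ) / 4 = ((Real.pi / 4 : ℝ) : ℂ) * Complex.I := by
    push_cast
    ring
  rw [ω, this, Complex.exp_mul_I, ← Complex.ofReal_cos, ← Complex.ofReal_sin, Real.cos_pi_div_four,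
    Real.sin_pi_div_four]

theorem ω_sq : ω ^ 2 = Complex.I := by
  have h : Real.sqrt 2 * Real.sqrt 2 = 2 := Real.mul_self_sqrt (by norm_num)
  rw [ω_eq]
  apply Complex.ext
  · simp [pow_two]
  · simp [pow_two]
    nlinarith

theorem ω_pow_four : ω ^ 4 = -1 := by
  rw [show 4 = 2 * 2 from rfl, pow_mul, ω_sq, Complex.I_sq]

theorem ω_pow_eight : ω ^ 8 = 1 := by
  rw [show 8 = 4 * 2 from rfl, pow_mul, ω_pow_four]
  norm_num

theorem star_ω : star ω = ω ^ 7 := by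
  have h1 : star ω * ω = 1 := by
    have h : Real.sqrt 2 * Real.sqrt 2 = 2 := Real.mul_self_sqrt (by norm_num)
    rw [ω_eq]
    apply Complex.ext
    · simp
      nlinarith
    · simp
      try nlinarith
  calc star ω = star ω * ω * ω ^ 7 := by rw [mul_assoc, ← pow_succ', ω_pow_eight, mul_one]
    _ = ω ^ 7 := by rw [h1, one_mul]

theorem star_ω_pow (e : ℕ) : star (ω ^ e) = ω ^ (7 * e) := by
  rw [star_pow, star_ω, pow_mul]

/-- The basis state with the given bits. -/
def toBasis (K : ℕ) (l : List Bool) : QBasis K := fun i => l.getD i false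

theorem toBasis_inj {K : ℕ} {l l' : List Bool} (h : l.length = K) (h' : l'.length = K)
    (he : toBasis K l = toBasis K l') : l = l' := by
  refine List.ext_getElem (h.trans h'.symm) fun i hi hi' => ?_
  have := congrFun he ⟨i, h ▸ hi⟩
  simpa [toBasis, List.getD_eq_getElem?_getD, hi, hi'] using this

theorem exists_toBasis {K : ℕ} (b : QBasis K) : ∃ l : List Bool, l.length = K ∧ toBasis K l = b :=
  ⟨List.ofFn b, List.length_ofFn, by
    funext i
    simp [toBasis, List.getD_eq_getElem?_getD]⟩

theorem toBasis_bit {K : ℕ} {l : List Bool} (h : l.length = K) (i : ℕ) :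
    (toBasis K l).bit i = l.getD i false := by
  unfold QBasis.bit
  split_ifs with hi
  · rfl
  · rw [List.getD_eq_default _ _ (by omega)]

/-- Replace a bit. -/
def setBit (l : List Bool) (i : ℕ) (v : Bool) : List Bool :=
  (List.range l.length).map fun j => bif decide (j = i) then v else l.getD j false

theorem length_setBit (l i v) : (setBit l i v).length = l.length := by simp [setBit]

theorem toBasis_setBit {K : ℕ} {l : List Bool} (h : l.length = K) {i : ℕ} (hi : i < K) (v : Bool) :
    toBasis K (setBit l i v) = Function.update (toBasis K l) ⟨i, hi⟩ v := by
  subst h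
  funext j
  by_cases hj : j = ⟨i, hi⟩
  · subst hj
    simp [toBasis, setBit, List.getD_eq_getElem?_getD, hi]
  · have : (j : ℕ) ≠ i := fun h => hj (Fin.ext h)
    simp [toBasis, setBit, List.getD_eq_getElem?_getD, Function.update_of_ne hj, this]

/-- An entry of a sparse matrix: row, column, and an exponent of the root of unity. -/
abbrev Entry : Type := List Bool × List Bool × ℕ

/-- The matrix with the given entries. -/
noncomputable def toMat (K n : ℕ) (L : List Entry) : Matrix (QBasis K) (QBasis n) ℂ :=
  (L.map fun p => Matrix.single (toBasis K p.1) (toBasis n p.2.1) (ω ^ p.2.2)).sum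

variable {K n : ℕ}

@[simp] theorem toMat_nil : toMat K n [] = 0 := rfl

theorem toMat_cons (p : Entry) (L : List Entry) : toMat K n (p :: L) =
    Matrix.single (toBasis K p.1) (toBasis n p.2.1) (ω ^ p.2.2) + toMat K n L := by
  simp [toMat]

theorem toMat_append (L L' : List Entry) : toMat K n (L ++ L') = toMat K n L + toMat K n L' := by
  simp [toMat]

/-- Conjugate transpose. -/
def adj (L : List Entry) : List Entry := L.map fun p => (p.2.1, p.1, 7 * p.2.2)

theorem toMat_adj (L : List Entry) : toMat n K (adj L) = (toMat K n L)ᴴ := by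
  induction L with
  | nil => simp [adj]
  | cons p L ih =>
    rw [toMat_cons, Matrix.conjTranspose_add, ← ih, Matrix.conjTranspose_single, star_ω_pow]
    exact toMat_cons _ _

/-- Matrix multiplication. -/
def mul (L L' : List Entry) : List Entry := L.flatMap fun p =>
  (L'.filter fun p' => decide (p.2.1 = p'.1)).map fun p' => (p.1, p'.2.1, p.2.2 + p'.2.2)

/-- Inner indices are compared as bit lists; the length conditions guarantee that distinct lists are
distinct basis states. -/
theorem toMat_mul {m : ℕ} {L L' : List Entry} (h : ∀ p ∈ L, p.2.1.length = n)
    (h' : ∀ p ∈ L', p.1.length = n) : toMat K m (mul L L') = toMat K n L * toMat n m L' := by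
  have key : ∀ (p : Entry), p.2.1.length = n → ∀ L' : List Entry, (∀ p ∈ L', p.1.length = n) →
      toMat K m ((L'.filter fun p' => decide (p.2.1 = p'.1)).map
        fun p' => (p.1, p'.2.1, p.2.2 + p'.2.2)) =
        Matrix.single (toBasis K p.1) (toBasis n p.2.1) (ω ^ p.2.2) * toMat n m L' := by
    intro p hp L' h'
    induction L' with
    | nil => simp
    | cons q L' ih =>
      have hq := h' q (by simp)
      have ih := ih fun p hp => h' p (by simp [hp])
      rw [toMat_cons, Matrix.mul_add, ← ih, List.filter_cons]
      by_cases hpq : p.2.1 = q.1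
      · rw [if_pos (by simpa using hpq), List.map_cons, toMat_cons, hpq, pow_add,
          Matrix.single_mul_single_same]
      · rw [if_neg (by simpa using hpq), Matrix.single_mul_single_of_ne, zero_add]
        exact fun h => hpq (toBasis_inj hp hq h)
  induction L with
  | nil => simp [mul]
  | cons p L ih =>
    have hm : mul (p :: L) L' = (L'.filter fun p' => decide (p.2.1 = p'.1)).map
      (fun p' => (p.1, p'.2.1, p.2.2 + p'.2.2)) ++ mul L L' := rfl
    rw [hm, toMat_append, toMat_cons, Matrix.add_mul, key p (h p (by simp)) L' h',
      ih fun p hp => h p (by simp [hp])]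

theorem mem_mul {L L' : List Entry} {p : Entry} (h : p ∈ mul L L') :
    (∃ q ∈ L, q.1 = p.1) ∧ ∃ q ∈ L', q.2.1 = p.2.1 := by
  obtain ⟨q, hq, h⟩ := List.mem_flatMap.1 h
  obtain ⟨q', hq', rfl⟩ := List.mem_map.1 h
  exact ⟨⟨q, hq, rfl⟩, q', (List.mem_filter.1 hq').1, rfl⟩

/-! Gates. -/

/-- A gate as data. -/
def rawGate : QGate → ℕ × ℕ × ℕ
  | .H i => (0, i, 0)
  | .T i => (1, i, 0)
  | .CNOT i j _ => (2, i, j)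

/-- The effect of a gate on an entry, up to a scalar for Hadamard gates. -/
def gateStep (g : ℕ × ℕ × ℕ) (p : Entry) : List Entry :=
  bif decide (g.1 = 0) then [(setBit p.1 g.2.1 false, p.2),
    (setBit p.1 g.2.1 true, p.2.1, p.2.2 + bif p.1.getD g.2.1 false then 4 else 0)]
  else bif decide (g.1 = 1) then [(p.1, p.2.1, p.2.2 + bif p.1.getD g.2.1 false then 1 else 0)]
  else [(setBit p.1 g.2.2 (xor (p.1.getD g.2.2 false) (p.1.getD g.2.1 false)), p.2)]

/-- The scalar of a gate. -/
noncomputable def gateScalar (g : ℕ × ℕ × ℕ) : ℂ := if g.1 = 0 then 1 / (Real.sqrt 2 : ℂ) else 1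

theorem length_gateStep {g p q} (h : q ∈ gateStep g p) : q.1.length = p.1.length := by
  unfold gateStep at h
  by_cases h0 : g.1 = 0
  · simp [h0] at h
    rcases h with rfl | rfl <;> simp [length_setBit]
  by_cases h1 : g.1 = 1
  · simp [h1] at h
    rw [h]
  · simp [h0, h1] at h
    simp [h, length_setBit]

theorem column_gateStep {g p q} (h : q ∈ gateStep g p) : q.2.1 = p.2.1 := by
  unfold gateStep at h
  by_cases h0 : g.1 = 0
  · simp [h0] at h
    rcases h with rfl | rfl <;> rfl
  by_cases h1 : g.1 = 1
  · simp [h1] at h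
    rw [h]
  · simp [h0, h1] at h
    simp [h]

theorem mul_single_apply {α β γ : Type*} [Fintype β] [DecidableEq β] [DecidableEq γ]
    (M : Matrix α β ℂ) (i : β) (j : γ) (c : ℂ) (a : α) (b : γ) :
    (M * Matrix.single i j c) a b = if j = b then M a i * c else 0 := by
  split_ifs with h
  · subst h
    simp
  · exact Matrix.mul_single_apply_of_ne _ _ _ _ _ (Ne.symm h) _

theorem forall_ne_iff {i : ℕ} (hi : i < K) {b y : QBasis K} :
    (∀ l : Fin K, (l : ℕ) ≠ i → b l = y l) ↔ Function.update y ⟨i, hi⟩ (b ⟨i, hi⟩) = b := by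
  constructor
  · intro h
    funext l
    by_cases hl : l = ⟨i, hi⟩
    · subst hl; simp
    · rw [Function.update_of_ne hl, h l fun h => hl (Fin.ext h)]
  · intro h l hl
    rw [← h, Function.update_of_ne fun h => hl (congrArg Fin.val h)]

theorem update_eq_iff {i : Fin K} {b y : QBasis K} {v : Bool} :
    Function.update y i v = b ↔ Function.update y i (b i) = b ∧ b i = v := by
  constructor
  · rintro rfl
    simp
  · rintro ⟨h, rfl⟩
    exact h

/-- Without its factor `1 / √2`, a Hadamard gate has the entries `1 = ω^0` and `-1 = ω^4`; a `T`
gate contributes `ω`, and a CNOT gate permutes basis states. Hence only exponents need to be stored.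
-/
theorem gate_mul_single {g : QGate} (hg : g.ActsOn K) {p : Entry} (hp : p.1.length = K) :
    g.matrix K * Matrix.single (toBasis K p.1) (toBasis n p.2.1) (ω ^ p.2.2) =
      gateScalar (rawGate g) • toMat K n (gateStep (rawGate g) p) := by
  ext b c
  rw [mul_single_apply, Matrix.smul_apply]
  by_cases hc : toBasis n p.2.1 = c
  swap
  -- Gates act on rows only, so both sides vanish outside of the column of `p`.
  · have : toMat K n (gateStep (rawGate g) p) b c = 0 := by
      have : ∀ L : List Entry, (∀ q ∈ L, q.2.1 = p.2.1) → toMat K n L b c = 0 := by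
        intro L hL
        induction L with
        | nil => rfl
        | cons q L ih =>
          rw [toMat_cons, Matrix.add_apply, ih fun q hq => hL q (by simp [hq]),
            hL q (by simp), Matrix.single_apply, if_neg fun h => hc h.2, zero_add]
      exact this _ fun q hq => column_gateStep hq
    rw [if_neg hc, this, smul_zero]
  subst hc
  rw [if_pos rfl]
  cases g with
  | H i =>
    have hi : i < K := hg
    have hb : ∀ y : QBasis K, y.bit i = y ⟨i, hi⟩ := fun y => dif_pos hi
    have hbit := toBasis_bit hp i
    rw [hb] at hbit
    simp only [QGate.matrix, rawGate, gateStep, gateScalar, onQubit, Matrix.of_apply, hb,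
      forall_ne_iff hi, hbit, toMat_cons, toMat_nil, decide_true, cond_true, if_true, add_zero,
      Matrix.add_apply, Matrix.single_apply, and_true, toBasis_setBit hp hi, hadamardMatrix,
      update_eq_iff (v := false), update_eq_iff (v := true), smul_eq_mul]
    by_cases hu : Function.update (toBasis K p.1) ⟨i, hi⟩ (b ⟨i, hi⟩) = b
    · cases h1 : b ⟨i, hi⟩ <;> cases h2 : p.1.getD i false <;>
        simp [pow_add, ω_pow_four, h1 ▸ hu]
    · simp [hu]
  | T i =>
    have hi : i < K := hg
    have hb : ∀ y : QBasis K, y.bit i = y ⟨i, hi⟩ := fun y => dif_pos hi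
    have hbit := toBasis_bit hp i
    rw [hb] at hbit
    simp only [QGate.matrix, rawGate, gateStep, gateScalar, onQubit, Matrix.of_apply, hb,
      forall_ne_iff hi, hbit, one_ne_zero, decide_false, decide_true, cond_false, cond_true,
      if_false, toMat_cons, toMat_nil, add_zero, Matrix.single_apply, and_true, tMatrix,
      Matrix.diagonal_apply, smul_eq_mul, one_mul]
    by_cases hu : toBasis K p.1 = b
    · subst hu
      rw [Function.update_eq_self, if_pos rfl, if_pos rfl, if_pos hbit, hbit]
      cases p.1.getD i false
      · simp
      · simp [pow_succ', ω]
    · rw [if_neg hu]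
      by_cases h1 : Function.update (toBasis K p.1) ⟨i, hi⟩ (b ⟨i, hi⟩) = b
      · rw [if_pos h1, if_neg, zero_mul]
        intro h2
        rw [h2, ← hbit, Function.update_eq_self] at h1
        exact hu h1
      · rw [if_neg h1, zero_mul]
  | CNOT i j hij =>
    have hj : j < K := hg.2
    have hiff : (∀ l : Fin K, b l = if (l : ℕ) = j then
        xor (toBasis K p.1 l) (p.1.getD i false) else toBasis K p.1 l) ↔
        Function.update (toBasis K p.1) ⟨j, hj⟩ (xor (p.1.getD j false) (p.1.getD i false)) = b := by
      constructor
      · intro h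
        funext l
        rw [h l]
        by_cases hl : l = ⟨j, hj⟩
        · subst hl; simp [toBasis]
        · rw [Function.update_of_ne hl, if_neg fun h => hl (Fin.ext h)]
      · rintro rfl l
        by_cases hl : l = ⟨j, hj⟩
        · subst hl; simp [toBasis]
        · rw [Function.update_of_ne hl, if_neg fun h => hl (Fin.ext h)]
    simp only [QGate.matrix, rawGate, gateStep, gateScalar, cnotMatrix, Matrix.of_apply,
      toBasis_bit hp, hiff, smul_eq_mul]
    simp [toMat_cons, Matrix.single_apply, toBasis_setBit hp hj]

/-- Apply a series of gates to all columns. -/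
def run (gs : List (ℕ × ℕ × ℕ)) (L : List Entry) : List Entry :=
  gs.foldl (fun L g => L.flatMap (gateStep g)) L

/-- The number of Hadamard gates. -/
def numH (gs : List (ℕ × ℕ × ℕ)) : ℕ := (gs.filter fun g => decide (g.1 = 0)).length

theorem gate_mul {g : QGate} (hg : g.ActsOn K) {L : List Entry} (hL : ∀ p ∈ L, p.1.length = K) :
    g.matrix K * toMat K n L =
      gateScalar (rawGate g) • toMat K n (L.flatMap (gateStep (rawGate g))) := by
  induction L with
  | nil => simp
  | cons p L ih =>
    rw [toMat_cons, Matrix.mul_add, gate_mul_single hg (hL p (by simp)),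
      ih fun p hp => hL p (by simp [hp]), List.flatMap_cons, toMat_append, smul_add]

theorem circuit_mul {gs : List QGate} (hg : ∀ g ∈ gs, g.ActsOn K) {L : List Entry}
    (hL : ∀ p ∈ L, p.1.length = K) : circuitMatrix K gs * toMat K n L =
      (1 / (Real.sqrt 2 : ℂ)) ^ numH (gs.map rawGate) • toMat K n (run (gs.map rawGate) L) ∧
    ∀ p ∈ run (gs.map rawGate) L, p.1.length = K ∧ ∃ q ∈ L, q.2.1 = p.2.1 := by
  induction gs generalizing L with
  | nil => exact ⟨by simp [circuitMatrix, run, numH], fun p hp => ⟨hL p hp, p, hp, rfl⟩⟩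
  | cons g gs ih =>
    have hL' : ∀ p ∈ L.flatMap (gateStep (rawGate g)), p.1.length = K := fun p hp => by
      obtain ⟨q, hq, h⟩ := List.mem_flatMap.1 hp
      rw [length_gateStep h, hL q hq]
    obtain ⟨h1, h2⟩ := ih (fun g hg' => hg g (by simp [hg'])) hL'
    refine ⟨?_, fun p hp => ?_⟩
    · rw [circuitMatrix, Matrix.mul_assoc, gate_mul (hg g (by simp)) hL, Matrix.mul_smul, h1,
        smul_smul]
      congr 1
      simp only [gateScalar, numH, List.map_cons, List.filter_cons]
      split_ifs <;> simp_all [pow_succ']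
    · obtain ⟨h3, q, hq, h4⟩ := h2 p hp
      obtain ⟨q', hq', h⟩ := List.mem_flatMap.1 hq
      exact ⟨h3, q', hq', by rw [← h4, column_gateStep h]⟩

/-- The entries of the Gram matrix of the accepted parts of the columns after running `gs`. -/
def gram (gs : List (ℕ × ℕ × ℕ)) (L : List Entry) : List Entry :=
  mul (adj ((run gs L).filter fun p => p.1.getD 0 false)) (run gs L)

theorem toMat_filter {L : List Entry} (hL : ∀ p ∈ L, p.1.length = K) :
    toMat K n (L.filter fun p => p.1.getD 0 false) = acceptProjection K * toMat K n L := by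
  induction L with
  | nil => simp
  | cons p L ih =>
    have hp : (toBasis K p.1).bit 0 = p.1.getD 0 false := toBasis_bit (hL p (by simp)) 0
    rw [toMat_cons, Matrix.mul_add, ← ih fun p hp => hL p (by simp [hp]), List.filter_cons]
    have : acceptProjection K * Matrix.single (toBasis K p.1) (toBasis n p.2.1) (ω ^ p.2.2) =
        if p.1.getD 0 false then Matrix.single (toBasis K p.1) (toBasis n p.2.1) (ω ^ p.2.2)
        else 0 := by
      ext b c
      rw [mul_single_apply, acceptProjection, Matrix.diagonal_apply]
      by_cases hb : b = toBasis K p.1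
      · subst hb
        rw [hp]
        cases p.1.getD 0 false <;> simp [Matrix.single_apply]
      · have hb' : toBasis K p.1 ≠ b := Ne.symm hb
        cases p.1.getD 0 false <;> simp [hb, hb']
    rw [this]
    cases p.1.getD 0 false <;> simp [toMat_cons]

/-- The circuit occurs twice, so two factors `√2 ^ h` combine to `2 ^ h` and no root is left. It
suffices to project one of the two copies. -/
theorem toMat_gram {gs : List QGate} (hg : ∀ g ∈ gs, g.ActsOn K) {L : List Entry}
    (hL : ∀ p ∈ L, p.1.length = K ∧ p.2.1.length = n) :
    toMat n n (gram (gs.map rawGate) L) = (2 ^ numH (gs.map rawGate) : ℂ) •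
      ((toMat K n L)ᴴ * ((circuitMatrix K gs)ᴴ * acceptProjection K * circuitMatrix K gs) *
        toMat K n L) := by
  obtain ⟨h1, h2⟩ := circuit_mul (n := n) hg fun p hp => (hL p hp).1
  set h := numH (gs.map rawGate)
  set W := toMat K n (run (gs.map rawGate) L)
  have hs : (Real.sqrt 2 : ℂ) ≠ 0 := by simp
  have hW : W = (Real.sqrt 2 : ℂ) ^ h • (circuitMatrix K gs * toMat K n L) := by
    rw [h1, smul_smul, ← mul_pow, mul_one_div_cancel hs, one_pow, one_smul]
  have hPi : (acceptProjection K)ᴴ = acceptProjection K := by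
    rw [acceptProjection, Matrix.diagonal_conjTranspose]
    congr 1
    funext b
    simp only [Pi.star_apply]
    split_ifs <;> simp
  rw [gram, toMat_mul (n := K), toMat_adj, toMat_filter fun p hp => (h2 p hp).1]
  · rw [Matrix.conjTranspose_mul, hPi]
    change Wᴴ * _ * W = _
    rw [hW, Matrix.conjTranspose_smul, Matrix.conjTranspose_mul]
    simp only [Matrix.smul_mul, Matrix.mul_smul, smul_smul, Matrix.mul_assoc]
    congr 1
    rw [star_pow, ← mul_pow]
    congr 1
    have : star (Real.sqrt 2 : ℂ) = (Real.sqrt 2 : ℂ) := Complex.conj_ofReal _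
    rw [this, ← Complex.ofReal_mul, Real.mul_self_sqrt (by norm_num)]
    norm_num
  · intro p hp
    obtain ⟨q, hq, rfl⟩ := List.mem_map.1 hp
    exact (h2 q (List.mem_filter.1 hq).1).1
  · exact fun p hp => (h2 p hp).1

theorem length_gram {gs : List QGate} (hg : ∀ g ∈ gs, g.ActsOn K) {L : List Entry}
    (hL : ∀ p ∈ L, p.1.length = K ∧ p.2.1.length = n) {p : Entry}
    (hp : p ∈ gram (gs.map rawGate) L) : p.1.length = n ∧ p.2.1.length = n := by
  obtain ⟨-, h2⟩ := circuit_mul (n := n) hg fun p hp => (hL p hp).1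
  obtain ⟨⟨q, hq, h⟩, q', hq', h'⟩ := mem_mul hp
  obtain ⟨r, hr, rfl⟩ := List.mem_map.1 hq
  obtain ⟨s, hs, h3⟩ := (h2 r (List.mem_filter.1 hr).1).2
  obtain ⟨s', hs', h4⟩ := (h2 q' hq').2
  rw [← h, ← h', ← h3, ← h4]
  exact ⟨by rw [h3]; exact h3 ▸ (hL s hs).2, (hL s' hs').2⟩

end PathSum

/-! Signs of elements of the ring that is generated by an eighth root of unity. -/

namespace PathSum

/-- The sum of the powers of the root of unity with the given exponents. -/
noncomputable def ev (l : List ℕ) : ℂ := (l.map fun e => ω ^ e).sum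

@[simp] theorem ev_nil : ev [] = 0 := rfl

@[simp] theorem ev_cons (e : ℕ) (l : List ℕ) : ev (e :: l) = ω ^ e + ev l := by simp [ev]

@[simp] theorem ev_append (l l' : List ℕ) : ev (l ++ l') = ev l + ev l' := by simp [ev]

theorem ev_map_add (l : List ℕ) (a : ℕ) : ev (l.map fun e => e + a) = ω ^ a * ev l := by
  induction l with
  | nil => simp
  | cons e l ih => simp [ih, pow_add, mul_add, mul_comm]

theorem ev_replicate (k e : ℕ) : ev (List.replicate k e) = k * ω ^ e := by simp [ev]

theorem ev_flatMap {α : Type*} (l : List α) (f : α → List ℕ) :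
    ev (l.flatMap f) = (l.map fun a => ev (f a)).sum := by
  induction l with
  | nil => simp
  | cons a l ih => simp [ih]

/-- The number of exponents in a residue class modulo 8. -/
def count8 (l : List ℕ) (r : ℕ) : ℕ := (l.filter fun e => decide (e % 8 = r)).length

/-- Only the residue of the exponent modulo `8` matters, and the eight real parts are `0`, `±1` and
`±√2 / 2`. -/
theorem re_ω_pow (e : ℕ) : (ω ^ e).re =
    ((if e % 8 = 0 then 1 else 0) - if e % 8 = 4 then 1 else 0) +
    (((if e % 8 = 1 then 1 else 0) + if e % 8 = 7 then 1 else 0) -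
      ((if e % 8 = 3 then 1 else 0) + if e % 8 = 5 then 1 else 0)) * (Real.sqrt 2 / 2) := by
  have h8 : ω ^ e = ω ^ (e % 8) := by
    conv_lhs => rw [← Nat.div_add_mod e 8, pow_add, pow_mul, ω_pow_eight, one_pow, one_mul]
  rw [h8]
  have hlt : e % 8 < 8 := Nat.mod_lt _ (by norm_num)
  have h3 : ω ^ 3 = Complex.I * ω := by rw [pow_succ, ω_sq]
  have h5 : ω ^ 5 = -ω := by rw [pow_succ, ω_pow_four]; ring
  have h6 : ω ^ 6 = -Complex.I := by rw [show 6 = 4 + 2 from rfl, pow_add, ω_pow_four, ω_sq]; ring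
  have h7 : ω ^ 7 = -(Complex.I * ω) := by
    rw [show 7 = 4 + 3 from rfl, pow_add, ω_pow_four, h3]; ring
  have hre : ω.re = Real.sqrt 2 / 2 := by rw [ω_eq]; simp
  have him : ω.im = Real.sqrt 2 / 2 := by rw [ω_eq]; simp
  interval_cases e % 8 <;> simp [ω_sq, h3, ω_pow_four, h5, h6, h7, hre, him]

theorem re_ev (l : List ℕ) : (ev l).re = ((count8 l 0 : ℝ) - count8 l 4) +
    ((count8 l 1 + count8 l 7 : ℝ) - (count8 l 3 + count8 l 5)) * (Real.sqrt 2 / 2) := by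
  induction l with
  | nil => simp [count8]
  | cons e l ih =>
    have h : ∀ r, (count8 (e :: l) r : ℝ) = (if e % 8 = r then 1 else 0) + count8 l r := by
      intro r
      unfold count8
      by_cases hr : e % 8 = r
      · simp [hr, add_comm]
      · simp [hr]
    rw [ev_cons, Complex.add_re, ih, re_ω_pow]
    simp only [h]
    ring

/-- Twice the square of the positive part of the rational part plus the square of the positive part
of the coefficient of `1 / √2`. -/
def posPart (l : List ℕ) : ℕ := 2 * (count8 l 0 - count8 l 4) ^ 2 +
  (count8 l 1 + count8 l 7 - (count8 l 3 + count8 l 5)) ^ 2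

/-- `posPart` of the negative. -/
def negPart (l : List ℕ) : ℕ := 2 * (count8 l 4 - count8 l 0) ^ 2 +
  (count8 l 3 + count8 l 5 - (count8 l 1 + count8 l 7)) ^ 2

/-- The two coefficients are split into positive and negative parts. If they have the same sign the
sum has it too; for opposite signs the two terms are compared by their squares. All cases are
expressed by the same inequality. -/
theorem sign_aux {x x' z z' : ℝ} (hx : 0 ≤ x) (hx' : 0 ≤ x') (hz : 0 ≤ z) (hz' : 0 ≤ z')
    (h : x = 0 ∨ x' = 0) (h' : z = 0 ∨ z' = 0) :
    0 ≤ (x - x') + (z - z') * (Real.sqrt 2 / 2) ↔ 2 * x' ^ 2 + z' ^ 2 ≤ 2 * x ^ 2 + z ^ 2 := by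
  have hs : (0 : ℝ) < Real.sqrt 2 := by positivity
  have hs2 : Real.sqrt 2 * Real.sqrt 2 = 2 := Real.mul_self_sqrt (by norm_num)
  have key : ∀ a b : ℝ, 0 ≤ a → 0 ≤ b →
      (0 ≤ a - b * (Real.sqrt 2 / 2) ↔ b ^ 2 ≤ 2 * a ^ 2) := by
    intro a b ha hb
    rw [sub_nonneg, ← abs_of_nonneg ha, ← abs_of_nonneg (by positivity : 0 ≤ b * (Real.sqrt 2 / 2)),
      ← sq_le_sq, abs_of_nonneg ha]
    constructor <;> intro h <;> nlinarith
  have key' : ∀ a b : ℝ, 0 ≤ a → 0 ≤ b →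
      (0 ≤ b * (Real.sqrt 2 / 2) - a ↔ 2 * a ^ 2 ≤ b ^ 2) := by
    intro a b ha hb
    rw [sub_nonneg, ← abs_of_nonneg ha, ← abs_of_nonneg (by positivity : 0 ≤ b * (Real.sqrt 2 / 2)),
      ← sq_le_sq, abs_of_nonneg ha]
    constructor <;> intro h <;> nlinarith
  rcases h with rfl | rfl <;> rcases h' with rfl | rfl
  · constructor
    · intro h
      have h1 : x' = 0 := by nlinarith [mul_nonneg hz' hs.le]
      have h2 : z' * (Real.sqrt 2 / 2) = 0 := by nlinarith [mul_nonneg hz' hs.le]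
      have h2 : z' = 0 := by
        rcases mul_eq_zero.1 h2 with h | h
        · exact h
        · linarith
      rw [h1, h2]
    · intro h
      have h1 : x' = 0 := by nlinarith
      have h2 : z' = 0 := by nlinarith
      rw [h1, h2]
      simp
  · have := key' x' z hx' hz
    simp only [sub_zero, zero_sub]
    rw [add_comm, ← sub_eq_add_neg, this]
    simp
  · have := key x z' hx hz'
    simp only [sub_zero, zero_sub]
    rw [neg_mul, ← sub_eq_add_neg, this]
    simp
  · refine iff_of_true ?_ ?_
    · have := mul_nonneg hz hs.le
      nlinarith
    · nlinarith [sq_nonneg x, sq_nonneg z]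

/-- The truncated differences are the positive and the negative part. -/
theorem cast_sub_sub (a b : ℕ) : (a : ℝ) - b = ((a - b : ℕ) : ℝ) - ((b - a : ℕ) : ℝ) := by
  rcases Nat.le_total a b with h | h
  · rw [Nat.sub_eq_zero_of_le h, Nat.cast_sub h]; simp
  · rw [Nat.sub_eq_zero_of_le h, Nat.cast_sub h]; simp

theorem re_ev_nonneg (l : List ℕ) : 0 ≤ (ev l).re ↔ negPart l ≤ posPart l := by
  have hz : ∀ a b : ℕ, ((a - b : ℕ) : ℝ) = 0 ∨ ((b - a : ℕ) : ℝ) = 0 := fun a b => by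
    rcases Nat.le_total a b with h | h
    · exact Or.inl (by simp [Nat.sub_eq_zero_of_le h])
    · exact Or.inr (by simp [Nat.sub_eq_zero_of_le h])
  rw [re_ev, cast_sub_sub, ← Nat.cast_add, ← Nat.cast_add, cast_sub_sub (_ + _),
    sign_aux (by positivity) (by positivity) (by positivity) (by positivity) (hz _ _) (hz _ _),
    posPart, negPart]
  exact_mod_cast Iff.rfl

theorem re_ev_neg_iff (l : List ℕ) : (ev (l.map fun e => e + 4)).re = -(ev l).re := by
  rw [ev_map_add, ω_pow_four, neg_one_mul, Complex.neg_re]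

/-- Test for a nonnegative real part. -/
def nonneg (l : List ℕ) : Bool := (negPart l).ble (posPart l)

theorem nonneg_iff {l : List ℕ} : nonneg l = true ↔ 0 ≤ (ev l).re := by
  rw [re_ev_nonneg, nonneg, Nat.ble_eq]

/-- Test for a positive real part. -/
def positive (l : List ℕ) : Bool := !nonneg (l.map fun e => e + 4)

theorem positive_iff {l : List ℕ} : positive l = true ↔ 0 < (ev l).re := by
  rw [positive, Bool.not_eq_true', Bool.eq_false_iff, ne_eq, nonneg_iff, re_ev_neg_iff,
    neg_nonneg, not_le]

@[fun_prop] theorem primrec_nonneg {α} [Primcodable α] {l : α → List ℕ} (hl : Primrec l) :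
    Primrec fun a => nonneg (l a) := by
  unfold nonneg posPart negPart count8
  fun_prop

@[fun_prop] theorem primrec_positive {α} [Primcodable α] {l : α → List ℕ} (hl : Primrec l) :
    Primrec fun a => positive (l a) := by
  unfold positive
  fun_prop

end PathSum

/-! Signs of eigenvalues. -/

/-- If all elementary symmetric polynomials are nonnegative, then `∏ (X + r)` is a monic polynomial
with nonnegative coefficients, hence positive at positive arguments; a negative element `x` would
make `-x` a positive root. -/
theorem Multiset.forall_nonneg_iff_esymm {s : Multiset ℝ} :
    (∀ x ∈ s, 0 ≤ x) ↔ ∀ j ≤ Multiset.card s, 0 ≤ s.esymm j := by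
  constructor
  · intro h j _
    refine Multiset.sum_nonneg fun x hx => ?_
    obtain ⟨t, ht, rfl⟩ := Multiset.mem_map.1 hx
    exact Multiset.prod_nonneg fun a ha =>
      h a (Multiset.mem_of_le (Multiset.mem_powersetCard.1 ht).1 ha)
  · intro h x hx
    by_contra hneg
    have hpoly := congrArg (Polynomial.eval (-x)) (Multiset.prod_X_add_C_eq_sum_esymm s)
    rw [Polynomial.eval_multiset_prod, Polynomial.eval_finsetSum, Multiset.map_map] at hpoly
    have h0 : (s.map (Polynomial.eval (-x) ∘ fun r => Polynomial.X + Polynomial.C r)).prod = 0 :=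
      Multiset.prod_eq_zero (Multiset.mem_map.2 ⟨x, hx, by simp⟩)
    rw [h0] at hpoly
    have hpos : 0 < -x := by linarith
    have : 0 < ∑ j ∈ Finset.range (Multiset.card s + 1), Polynomial.eval (-x)
        (Polynomial.C (s.esymm j) * Polynomial.X ^ (Multiset.card s - j)) := by
      refine Finset.sum_pos' (fun j hj => ?_) ⟨0, by simp, ?_⟩
      · have := h j (by rw [Finset.mem_range] at hj; omega)
        simp only [Polynomial.eval_mul, Polynomial.eval_C, Polynomial.eval_pow, Polynomial.eval_X]
        positivity
      · simp only [Polynomial.eval_mul, Polynomial.eval_C, Polynomial.eval_pow, Polynomial.eval_X]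
        have : s.esymm 0 = 1 := by simp [Multiset.esymm]
        rw [this]
        positivity
    exact absurd hpoly this.ne

theorem Multiset.esymm_card (s : Multiset ℝ) : s.esymm (Multiset.card s) = s.prod := by
  simp [Multiset.esymm, Multiset.powersetCard_self]

/-- The last elementary symmetric polynomial is the product, and its positivity excludes the element
`0`. -/
theorem Multiset.forall_pos_iff_esymm {s : Multiset ℝ} : (∀ x ∈ s, 0 < x) ↔
    (∀ j ≤ Multiset.card s, 0 ≤ s.esymm j) ∧ 0 < s.esymm (Multiset.card s) := by
  rw [← Multiset.forall_nonneg_iff_esymm, Multiset.esymm_card]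
  constructor
  · exact fun h => ⟨fun x hx => (h x hx).le, Multiset.prod_pos h⟩
  · rintro ⟨h, h'⟩ x hx
    refine lt_of_le_of_ne (h x hx) fun h0 => ?_
    rw [Multiset.prod_eq_zero (h0 ▸ hx)] at h'
    exact lt_irrefl _ h'

/-- Newton's identities. -/
theorem newton_identity {ι : Type*} [Fintype ι] (f : ι → ℝ) (k : ℕ) :
    ((k + 1 : ℕ) : ℝ) * (Finset.univ.val.map f).esymm (k + 1) =
      ∑ j ∈ Finset.range (k + 1), (-1) ^ j * (Finset.univ.val.map f).esymm (k - j) *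
        ∑ i, f i ^ (j + 1) := by
  have h := congrArg (MvPolynomial.aeval f) (MvPolynomial.mul_esymm_eq_sum ι ℝ (k + 1))
  simp only [map_mul, map_natCast, MvPolynomial.aeval_esymm_eq_multiset_esymm, map_pow, map_neg,
    map_one, map_sum, MvPolynomial.psum, MvPolynomial.aeval_X] at h
  rw [h, Finset.sum_filter, Finset.Nat.sum_antidiagonal_eq_sum_range_succ_mk,
    Finset.sum_range_succ, if_neg (by simp), add_zero, ← Finset.sum_range_reflect, Finset.mul_sum]
  refine Finset.sum_congr rfl fun j hj => ?_
  rw [Finset.mem_range] at hj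
  have h1 : k + 1 - 1 - j = k - j := by omega
  have h2 : k + 1 - (k - j) = j + 1 := by omega
  have h3 : (-1 : ℝ) ^ (k + 1 + 1) * (-1) ^ (k - j) = (-1) ^ j := by
    rw [← pow_add, show k + 1 + 1 + (k - j) = j + 2 * (k - j + 1) by omega, pow_add, pow_mul]
    simp
  rw [if_pos (by omega), h1, h2, ← mul_assoc, ← mul_assoc, h3]

theorem Matrix.IsHermitian.trace_pow {n : Type*} [Fintype n] [DecidableEq n] {A : Matrix n n ℂ}
    (hA : A.IsHermitian) (k : ℕ) : (A ^ k).trace = ((∑ i, hA.eigenvalues i ^ k : ℝ) : ℂ) := by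
  conv_lhs => rw [hA.spectral_theorem]
  rw [← map_pow, Unitary.conjStarAlgAut_apply, Matrix.trace_mul_cycle, Unitary.coe_star_mul_self,
    one_mul, Matrix.diagonal_pow, Matrix.trace_diagonal]
  simp

/-! Definiteness of sparse matrices. -/

namespace PathSum

theorem nodup_strings (n : ℕ) : (strings n).Nodup := by
  induction n with
  | zero => simp [strings]
  | succ n ih =>
    have : strings (n + 1) = (strings n).flatMap fun s => [false :: s, true :: s] :=
      Function.iterate_succ_apply' _ _ _
    rw [this, List.nodup_flatMap]
    refine ⟨fun s _ => by simp, ih.imp fun {a b} hab => ?_⟩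
    simp [Function.onFun, hab.symm]

theorem sum_strings {M : Type*} [AddCommMonoid M] (m : ℕ) (f : QBasis m → M) :
    ((strings m).map fun l => f (toBasis m l)).sum = ∑ y, f y := by
  have hn : ((strings m).map (toBasis m)).Nodup := List.Nodup.map_on (fun x hx y hy h =>
    toBasis_inj (mem_strings.1 hx) (mem_strings.1 hy) h) (nodup_strings m)
  have hu : ((strings m).map (toBasis m)).toFinset = Finset.univ := by
    refine Finset.eq_univ_of_forall fun b => ?_
    obtain ⟨l, hl, rfl⟩ := exists_toBasis b
    exact List.mem_toFinset.2 (List.mem_map_of_mem (mem_strings.2 hl))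
  rw [← hu, List.sum_toFinset _ hn, List.map_map]
  rfl

variable {m : ℕ}

/-- The identity matrix. -/
def ident (m : ℕ) : List Entry := (strings m).map fun l => (l, l, 0)

theorem toMat_ident (m : ℕ) : toMat m m (ident m) = 1 := by
  have : toMat m m (ident m) = ∑ y : QBasis m, Matrix.single y y 1 := by
    rw [← sum_strings, toMat, ident, List.map_map]
    simp [Function.comp_def]
  rw [this, Matrix.sum_single_one]

/-- Entries of a square matrix of size `2 ^ m`. -/
def IsSquare (m : ℕ) (B : List Entry) : Prop := ∀ p ∈ B, p.1.length = m ∧ p.2.1.length = m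

theorem isSquare_ident : IsSquare m (ident m) := fun p hp => by
  obtain ⟨l, hl, rfl⟩ := List.mem_map.1 hp
  exact ⟨mem_strings.1 hl, mem_strings.1 hl⟩

/-- Powers of a matrix. -/
def power (m : ℕ) (B : List Entry) (j : ℕ) : List Entry := (mul B)^[j] (ident m)

theorem toMat_power {B : List Entry} (hB : IsSquare m B) (j : ℕ) :
    toMat m m (power m B j) = toMat m m B ^ j ∧ IsSquare m (power m B j) := by
  induction j with
  | zero => exact ⟨by rw [pow_zero]; exact toMat_ident m, isSquare_ident⟩
  | succ j ih =>
    rw [power, Function.iterate_succ_apply', ← power, pow_succ',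
      toMat_mul (fun p hp => (hB p hp).2) fun p hp => (ih.2 p hp).1, ih.1]
    refine ⟨rfl, fun p hp => ?_⟩
    obtain ⟨⟨q, hq, h⟩, q', hq', h'⟩ := mem_mul hp
    exact ⟨h ▸ (hB q hq).1, h' ▸ (ih.2 q' hq').2⟩

/-- The exponents of the entry at a diagonal position. -/
def diagExps (l : List Bool) (B : List Entry) : List ℕ :=
  (B.filter fun p => decide (p.1 = l) && decide (p.2.1 = l)).map fun p => p.2.2

theorem ev_diagExps {B : List Entry} (hB : IsSquare m B) {l : List Bool} (hl : l.length = m) :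
    ev (diagExps l B) = toMat m m B (toBasis m l) (toBasis m l) := by
  induction B with
  | nil => rfl
  | cons p B ih =>
    have hp := hB p (by simp)
    rw [toMat_cons, Matrix.add_apply, ← ih fun p hp => hB p (by simp [hp]), diagExps,
      List.filter_cons, Matrix.single_apply]
    by_cases h : p.1 = l ∧ p.2.1 = l
    · rw [if_pos (by simp [h]), if_pos (by simp [h]), List.map_cons, ev_cons]
      rfl
    · rw [if_neg (by simpa using h), if_neg, zero_add]
      · rfl
      · exact fun h' => h ⟨toBasis_inj hp.1 hl h'.1, toBasis_inj hp.2 hl h'.2⟩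

/-- The exponents of the trace. -/
def traceExps (B : List Entry) : List ℕ :=
  (B.filter fun p => decide (p.1 = p.2.1)).map fun p => p.2.2

theorem ev_traceExps {B : List Entry} (hB : IsSquare m B) :
    ev (traceExps B) = (toMat m m B).trace := by
  induction B with
  | nil => simp [traceExps]
  | cons p B ih =>
    have hp := hB p (by simp)
    rw [toMat_cons, Matrix.trace_add, ← ih fun p hp => hB p (by simp [hp]), traceExps,
      List.filter_cons]
    by_cases h : p.1 = p.2.1
    · rw [if_pos (by simp [h]), h, Matrix.trace_single_eq_same, List.map_cons, ev_cons]
      rfl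
    · rw [if_neg (by simpa using h), Matrix.trace_single_eq_of_ne, zero_add]
      · rfl
      · exact fun h' => h (toBasis_inj hp.1 hp.2 h')

/-- A step in the computation of the elementary symmetric polynomials from the power sums `P`. -/
def newtonStep (P : ℕ → List ℕ) (S : List (List ℕ)) : List (List ℕ) :=
  ((List.range S.length).flatMap fun j => (S.getD j []).flatMap fun a =>
    (P (j + 1)).map fun b => b + (a + 4 * j)) ::
  S.map fun l => (List.range S.length).flatMap fun _ => l

theorem ev_mul_shift (l l' : List ℕ) (c : ℕ) :
    ev (l.flatMap fun a => l'.map fun b => b + (a + c)) = ω ^ c * (ev l * ev l') := by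
  induction l with
  | nil => simp
  | cons a l ih =>
    rw [List.flatMap_cons, ev_append, ev_map_add, ih, ev_cons, pow_add]
    ring

/-- Division is avoided by keeping the multiples `k! e_(k-j)`, for `j = 0, …, k`, after `k` steps.
Old entries are multiplied by `k + 1` through repetition, and Newton's identity gives the new entry
`(k + 1)! e_(k+1)`; the sign `(-1)^j` is the exponent `4 j`. -/
theorem ev_newton {ι : Type*} [Fintype ι] {f : ι → ℝ} {P : ℕ → List ℕ}
    (hP : ∀ j, ev (P j) = ((∑ i, f i ^ j : ℝ) : ℂ)) (k : ℕ) :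
    ((newtonStep P)^[k] [[0]]).length = k + 1 ∧ ∀ j ≤ k, ev (((newtonStep P)^[k] [[0]]).getD j []) =
      ((k.factorial * (Finset.univ.val.map f).esymm (k - j) : ℝ) : ℂ) := by
  induction k with
  | zero =>
    refine ⟨rfl, fun j hj => ?_⟩
    obtain rfl : j = 0 := by omega
    simp [Multiset.esymm]
  | succ k ih =>
    rw [Function.iterate_succ_apply']
    generalize (newtonStep P)^[k] [[0]] = S at ih ⊢
    obtain ⟨hS, ih⟩ := ih
    refine ⟨by simp [newtonStep, hS], fun j hj => ?_⟩
    rcases j with _ | j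
    · rw [newtonStep, List.getD_cons_zero, ev_flatMap, hS, tsub_zero, Nat.factorial_succ,
        Nat.cast_mul, mul_comm ((k + 1 : ℕ) : ℝ), mul_assoc, newton_identity, Finset.mul_sum,
        Complex.ofReal_sum, ← List.sum_toFinset _ List.nodup_range, List.toFinset_range]
      refine Finset.sum_congr rfl fun j hj => ?_
      rw [Finset.mem_range] at hj
      rw [ev_mul_shift, ih j (by omega), hP, pow_mul, ω_pow_four]
      push_cast
      ring
    · rw [newtonStep, List.getD_cons_succ]
      have hj' : j < S.length := by omega
      have := ih j (by omega)
      rw [List.getD_eq_getElem _ _ hj'] at this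
      rw [List.getD_eq_getElem _ _ (by simpa using hj'), List.getElem_map, ev_flatMap]
      simp only [List.map_const', List.sum_replicate, List.length_range, this, hS, nsmul_eq_mul,
        Nat.factorial_succ]
      rw [show k + 1 - (j + 1) = k - j by omega]
      push_cast
      ring

/-- Multiples of the elementary symmetric polynomials of the eigenvalues. -/
def symmetric (m : ℕ) (B : List Entry) : List (List ℕ) :=
  (newtonStep fun j => traceExps (power m B j))^[2 ^ m] [[0]]

/-- Test for semidefiniteness. -/
def isPSD (m : ℕ) (B : List Entry) : Bool := (symmetric m B).all nonneg

/-- Test for definiteness. -/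
def isPD (m : ℕ) (B : List Entry) : Bool :=
  isPSD m B && positive ((symmetric m B).getD 0 [])

section
variable {B : List Entry}

theorem ev_symmetric (hB : IsSquare m B) (hH : (toMat m m B).IsHermitian) : (symmetric m B).length = 2 ^ m + 1 ∧ ∀ j ≤ 2 ^ m,
    (ev ((symmetric m B).getD j [])).re =
      (2 ^ m).factorial * (Finset.univ.val.map hH.eigenvalues).esymm (2 ^ m - j) := by
  obtain ⟨h1, h2⟩ := ev_newton (f := hH.eigenvalues) (P := fun j => traceExps (power m B j))
    (fun j => by
      rw [ev_traceExps (toMat_power hB j).2, (toMat_power hB j).1, hH.trace_pow]) (2 ^ m)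
  refine ⟨h1, fun j hj => ?_⟩
  have := congrArg Complex.re (h2 j hj)
  rwa [Complex.ofReal_re] at this

theorem isPSD_iff' (hB : IsSquare m B) (hH : (toMat m m B).IsHermitian) :
    isPSD m B = true ↔
    ∀ j ≤ 2 ^ m, 0 ≤ (Finset.univ.val.map hH.eigenvalues).esymm j := by
  obtain ⟨h1, h2⟩ := ev_symmetric hB hH
  have hf : (0 : ℝ) < (2 ^ m).factorial := by exact_mod_cast Nat.factorial_pos _
  rw [isPSD, List.all_eq_true]
  constructor
  · intro h j hj
    have h3 : 2 ^ m - j < (symmetric m B).length := by omega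
    have := nonneg_iff.1 (h _ (List.getElem_mem h3))
    rw [← List.getD_eq_getElem _ [] h3, h2 _ (by omega), Nat.sub_sub_self hj] at this
    exact nonneg_of_mul_nonneg_right this hf
  · intro h l hl
    obtain ⟨j, hj, rfl⟩ := List.mem_iff_getElem.1 hl
    rw [nonneg_iff, ← List.getD_eq_getElem _ [] hj, h2 _ (by omega)]
    exact mul_nonneg hf.le (h _ (by omega))

theorem card_eigenvalues (hH : (toMat m m B).IsHermitian) :
    Multiset.card (Finset.univ.val.map hH.eigenvalues) = 2 ^ m := by
  simp

open scoped ComplexOrder in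
theorem isPSD_iff (hB : IsSquare m B) (hH : (toMat m m B).IsHermitian) :
    isPSD m B = true ↔ (toMat m m B).PosSemidef := by
  rw [isPSD_iff' hB hH, hH.posSemidef_iff_eigenvalues_nonneg, ← card_eigenvalues hH,
    ← Multiset.forall_nonneg_iff_esymm]
  simp [Pi.le_def]

-- The entry with index `0` is a positive multiple of the product of the eigenvalues.
open scoped ComplexOrder in
theorem isPD_iff (hB : IsSquare m B) (hH : (toMat m m B).IsHermitian) :
    isPD m B = true ↔ (toMat m m B).PosDef := by
  have hf : (0 : ℝ) < (2 ^ m).factorial := by exact_mod_cast Nat.factorial_pos _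
  rw [isPD, Bool.and_eq_true, isPSD_iff' hB hH, positive_iff,
    (ev_symmetric hB hH).2 0 (Nat.zero_le _), tsub_zero, mul_pos_iff_of_pos_left hf,
    hH.posDef_iff_eigenvalues_pos, ← card_eigenvalues hH, ← Multiset.forall_pos_iff_esymm]
  simp

end

/-- The matrix `c - 3 G`. -/
def shifted (m c : ℕ) (G : List Entry) : List Entry :=
  ((strings m).flatMap fun l => List.replicate c (l, l, 0)) ++
    (List.range 3).flatMap fun _ => G.map fun p => (p.1, p.2.1, p.2.2 + 4)

theorem toMat_flatMap {α : Type*} {K n : ℕ} (l : List α) (f : α → List Entry) :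
    toMat K n (l.flatMap f) = (l.map fun a => toMat K n (f a)).sum := by
  induction l with
  | nil => simp
  | cons a l ih => simp [toMat_append, ih]

/-- Integer multiples are repetitions of entries, and adding `4` to an exponent changes the sign. -/
theorem toMat_shifted (m c : ℕ) (G : List Entry) :
    toMat m m (shifted m c G) = (c : ℂ) • (1 : Matrix (QBasis m) (QBasis m) ℂ) -
      (3 : ℂ) • toMat m m G := by
  have h1 : toMat m m ((strings m).flatMap fun l => List.replicate c (l, l, 0)) =
      (c : ℂ) • (1 : Matrix (QBasis m) (QBasis m) ℂ) := by
    rw [toMat_flatMap, ← Matrix.sum_single_one, Finset.smul_sum, ← sum_strings]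
    congr 1
    refine List.map_congr_left fun l _ => ?_
    rw [toMat, List.map_replicate, List.sum_replicate, pow_zero, Nat.cast_smul_eq_nsmul]
  have h2 : toMat m m (G.map fun p => (p.1, p.2.1, p.2.2 + 4)) = -toMat m m G := by
    induction G with
    | nil => simp
    | cons p G ih =>
      rw [List.map_cons, toMat_cons, toMat_cons, ih, pow_add, ω_pow_four, mul_neg_one, neg_add]
      congr 1
      ext i j
      simp only [Matrix.single_apply, Matrix.neg_apply]
      split_ifs <;> simp
  rw [shifted, toMat_append, h1, toMat_flatMap, h2]
  simp only [List.map_const', List.length_range, List.sum_replicate, sub_eq_add_neg, smul_neg]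
  rw [← Nat.cast_smul_eq_nsmul ℂ]
  rfl

theorem isSquare_shifted {c : ℕ} {G : List Entry} (hG : IsSquare m G) :
    IsSquare m (shifted m c G) := by
  intro p hp
  rcases List.mem_append.1 hp with hp | hp
  · obtain ⟨l, hl, hp⟩ := List.mem_flatMap.1 hp
    rw [List.eq_of_mem_replicate hp]
    exact ⟨mem_strings.1 hl, mem_strings.1 hl⟩
  · obtain ⟨-, -, hp⟩ := List.mem_flatMap.1 hp
    obtain ⟨q, hq, rfl⟩ := List.mem_map.1 hp
    exact hG q hq

end PathSum

/-! Bounds for quadratic forms on the unit sphere. -/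

section QuadraticForm
variable {ι : Type*}

theorem re_dotProduct_smul_one_sub [Fintype ι] [DecidableEq ι] (A : Matrix ι ι ℂ) (c s : ℝ) (ψ : ι → ℂ) :
    (star ψ ⬝ᵥ (((c : ℂ) • (1 : Matrix ι ι ℂ) - (s : ℂ) • A) *ᵥ ψ)).re =
      c * ∑ i, ‖ψ i‖ ^ 2 - s * (star ψ ⬝ᵥ (A *ᵥ ψ)).re := by
  have h : star ψ ⬝ᵥ ψ = ((∑ i, ‖ψ i‖ ^ 2 : ℝ) : ℂ) := by
    simp only [dotProduct, Pi.star_apply]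
    push_cast
    exact Finset.sum_congr rfl fun i _ => Complex.conj_mul' _
  rw [Matrix.sub_mulVec, dotProduct_sub, Matrix.smul_mulVec, Matrix.smul_mulVec, Matrix.one_mulVec,
    dotProduct_smul, dotProduct_smul, h, Complex.sub_re, smul_eq_mul, smul_eq_mul,
    Complex.re_ofReal_mul, Complex.re_ofReal_mul, Complex.ofReal_re]

theorem exists_unit_vector [Fintype ι] {ψ : ι → ℂ} (hψ : ψ ≠ 0) : ∃ (r : ℝ) (φ : ι → ℂ), 0 < r ∧
    ∑ i, ‖φ i‖ ^ 2 = 1 ∧ ψ = (r : ℂ) • φ := by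
  have hpos : 0 < ∑ i, ‖ψ i‖ ^ 2 := by
    obtain ⟨i, hi⟩ := Function.ne_iff.1 hψ
    exact Finset.sum_pos' (fun _ _ => by positivity) ⟨i, Finset.mem_univ _, by
      have := norm_pos_iff.2 hi
      positivity⟩
  have hr := Real.sqrt_pos.2 hpos
  have hr0 : ((Real.sqrt (∑ i, ‖ψ i‖ ^ 2) : ℝ) : ℂ) ≠ 0 := by exact_mod_cast hr.ne'
  refine ⟨Real.sqrt (∑ i, ‖ψ i‖ ^ 2), ((Real.sqrt (∑ i, ‖ψ i‖ ^ 2) : ℂ))⁻¹ • ψ, hr, ?_, ?_⟩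
  · simp only [Pi.smul_apply, smul_eq_mul, norm_mul, mul_pow, ← Finset.mul_sum, norm_inv,
      Complex.norm_real, Real.norm_eq_abs, inv_pow, sq_abs, Real.sq_sqrt hpos.le]
    exact inv_mul_cancel₀ hpos.ne'
  · rw [smul_smul, mul_inv_cancel₀ hr0, one_smul]

theorem re_dotProduct_smul [Fintype ι] (A : Matrix ι ι ℂ) (r : ℝ) (φ : ι → ℂ) :
    (star ((r : ℂ) • φ) ⬝ᵥ (A *ᵥ ((r : ℂ) • φ))).re = r ^ 2 * (star φ ⬝ᵥ (A *ᵥ φ)).re := by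
  rw [Matrix.mulVec_smul, star_smul, smul_dotProduct, dotProduct_smul]
  have : star (r : ℂ) = r := Complex.conj_ofReal r
  rw [this]
  simp [pow_two, mul_assoc]

theorem isHermitian_smul_one_sub [DecidableEq ι] {A : Matrix ι ι ℂ} (hA : A.IsHermitian) (c s : ℝ) :
    ((c : ℂ) • (1 : Matrix ι ι ℂ) - (s : ℂ) • A).IsHermitian := by
  have hc : ∀ r : ℝ, star (r : ℂ) = r := Complex.conj_ofReal
  rw [Matrix.IsHermitian, Matrix.conjTranspose_sub, Matrix.conjTranspose_smul,
    Matrix.conjTranspose_smul, hA, Matrix.conjTranspose_one, hc, hc]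

-- On unit vectors the quadratic form is `c - s ⟨ψ, A ψ⟩`; scaling a vector by `r` multiplies the
-- form by `r ^ 2`, so the unit sphere decides.
open scoped ComplexOrder in
theorem posSemidef_smul_one_sub_iff [Fintype ι] [DecidableEq ι] {A : Matrix ι ι ℂ}
    (hA : A.IsHermitian) (c s : ℝ) :
    ((c : ℂ) • (1 : Matrix ι ι ℂ) - (s : ℂ) • A).PosSemidef ↔
      ∀ ψ : ι → ℂ, ∑ i, ‖ψ i‖ ^ 2 = 1 → s * (star ψ ⬝ᵥ (A *ᵥ ψ)).re ≤ c := by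
  have hH := isHermitian_smul_one_sub hA c s
  constructor
  · intro h ψ hψ
    have := h.re_dotProduct_nonneg ψ
    rw [RCLike.re_eq_complex_re, re_dotProduct_smul_one_sub, hψ] at this
    linarith
  · intro h
    refine .of_dotProduct_mulVec_nonneg hH fun ψ => RCLike.nonneg_iff.2
      ⟨?_, hH.im_star_dotProduct_mulVec_self ψ⟩
    by_cases hψ : ψ = 0
    · simp [hψ]
    · obtain ⟨r, φ, hr, hφ, rfl⟩ := exists_unit_vector hψ
      rw [RCLike.re_eq_complex_re, re_dotProduct_smul, re_dotProduct_smul_one_sub, hφ]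
      have := h φ hφ
      exact mul_nonneg (by positivity) (by linarith)

open scoped ComplexOrder in
theorem posDef_smul_one_sub_iff [Fintype ι] [DecidableEq ι] {A : Matrix ι ι ℂ}
    (hA : A.IsHermitian) (c s : ℝ) :
    ((c : ℂ) • (1 : Matrix ι ι ℂ) - (s : ℂ) • A).PosDef ↔
      ∀ ψ : ι → ℂ, ∑ i, ‖ψ i‖ ^ 2 = 1 → s * (star ψ ⬝ᵥ (A *ᵥ ψ)).re < c := by
  have hH := isHermitian_smul_one_sub hA c s
  constructor
  · intro h ψ hψ
    have h0 : ψ ≠ 0 := by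
      rintro rfl
      simp at hψ
    have := h.re_dotProduct_pos h0
    rw [RCLike.re_eq_complex_re, re_dotProduct_smul_one_sub, hψ] at this
    linarith
  · intro h
    refine .of_dotProduct_mulVec_pos hH fun ψ hψ => RCLike.pos_iff.2
      ⟨?_, hH.im_star_dotProduct_mulVec_self ψ⟩
    obtain ⟨r, φ, hr, hφ, rfl⟩ := exists_unit_vector hψ
    rw [RCLike.re_eq_complex_re, re_dotProduct_smul, re_dotProduct_smul_one_sub, hφ]
    have := h φ hφ
    exact mul_pos (by positivity) (by linarith)

end QuadraticForm

/-! Acceptance tests for quantum circuits. -/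

namespace PathSum

section Primrec
variable {α : Type*} [Primcodable α]

@[fun_prop] theorem primrec_setBit {l : α → List Bool} {i : α → ℕ} {v : α → Bool}
    (hl : Primrec l) (hi : Primrec i) (hv : Primrec v) :
    Primrec fun a => setBit (l a) (i a) (v a) := by
  unfold setBit
  fun_prop

@[fun_prop] theorem primrec_gateStep {g : α → ℕ × ℕ × ℕ} {p : α → Entry} (hg : Primrec g)
    (hp : Primrec p) : Primrec fun a => gateStep (g a) (p a) := by
  unfold gateStep
  fun_prop

@[fun_prop] theorem primrec_run {g : α → List (ℕ × ℕ × ℕ)} {L : α → List Entry} (hg : Primrec g)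
    (hL : Primrec L) : Primrec fun a => run (g a) (L a) := by
  unfold run
  fun_prop

@[fun_prop] theorem primrec_numH {g : α → List (ℕ × ℕ × ℕ)} (hg : Primrec g) :
    Primrec fun a => numH (g a) := by
  unfold numH
  fun_prop

@[fun_prop] theorem primrec_mul {L L' : α → List Entry} (hL : Primrec L)
    (hL' : Primrec L') : Primrec fun a => mul (L a) (L' a) := by
  unfold mul
  fun_prop

@[fun_prop] theorem primrec_adj {L : α → List Entry} (hL : Primrec L) :
    Primrec fun a => adj (L a) := by
  unfold adj
  fun_prop

@[fun_prop] theorem primrec_gram {g : α → List (ℕ × ℕ × ℕ)} {L : α → List Entry} (hg : Primrec g)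
    (hL : Primrec L) : Primrec fun a => gram (g a) (L a) := by
  unfold gram
  fun_prop

@[fun_prop] theorem primrec_ident {m : α → ℕ} (hm : Primrec m) : Primrec fun a => ident (m a) := by
  unfold ident
  fun_prop

@[fun_prop] theorem primrec_power {m j : α → ℕ} {B : α → List Entry} (hm : Primrec m)
    (hB : Primrec B) (hj : Primrec j) : Primrec fun a => power (m a) (B a) (j a) := by
  unfold power
  fun_prop

@[fun_prop] theorem primrec_diagExps {l : α → List Bool} {B : α → List Entry} (hl : Primrec l)
    (hB : Primrec B) : Primrec fun a => diagExps (l a) (B a) := by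
  unfold diagExps
  fun_prop

@[fun_prop] theorem primrec_traceExps {B : α → List Entry} (hB : Primrec B) :
    Primrec fun a => traceExps (B a) := by
  unfold traceExps
  fun_prop

@[fun_prop] theorem primrec_symmetric {m : α → ℕ} {B : α → List Entry} (hm : Primrec m)
    (hB : Primrec B) : Primrec fun a => symmetric (m a) (B a) := by
  unfold symmetric newtonStep
  fun_prop

@[fun_prop] theorem primrec_isPSD {m : α → ℕ} {B : α → List Entry} (hm : Primrec m)
    (hB : Primrec B) : Primrec fun a => isPSD (m a) (B a) := by
  unfold isPSD
  fun_prop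

@[fun_prop] theorem primrec_isPD {m : α → ℕ} {B : α → List Entry} (hm : Primrec m)
    (hB : Primrec B) : Primrec fun a => isPD (m a) (B a) := by
  unfold isPD
  fun_prop

@[fun_prop] theorem primrec_shifted {m c : α → ℕ} {B : α → List Entry} (hm : Primrec m)
    (hc : Primrec c) (hB : Primrec B) : Primrec fun a => shifted (m a) (c a) (B a) := by
  unfold shifted
  fun_prop

end Primrec

/-! Comparison with the acceptance thresholds. -/

/-- Test for a value of at least `2 / 3` after division by `2 ^ h`. -/
def geTest (h : ℕ) (l : List ℕ) : Bool :=
  nonneg ((List.range 3).flatMap (fun _ => l) ++ List.replicate (2 * 2 ^ h) 4)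

/-- Test for a value of at most `1 / 3` after division by `2 ^ h`. -/
def leTest (h : ℕ) (l : List ℕ) : Bool :=
  nonneg (((List.range 3).flatMap fun _ => l.map fun e => e + 4) ++ List.replicate (2 ^ h) 0)

theorem ev_triple (l : List ℕ) : ev ((List.range 3).flatMap fun _ => l) = 3 * ev l := by
  rw [ev_flatMap]
  simp only [List.map_const', List.length_range, List.sum_replicate, nsmul_eq_mul]
  rfl

theorem geTest_iff {h : ℕ} {l : List ℕ} {a : ℝ} (ha : (ev l).re = 2 ^ h * a) :
    geTest h l = true ↔ 2 / 3 ≤ a := by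
  have h2 : (0 : ℝ) < 2 ^ h := by positivity
  have : (ev ((List.range 3).flatMap (fun _ => l) ++ List.replicate (2 * 2 ^ h) 4)).re =
      2 ^ h * (3 * a - 2) := by
    rw [ev_append, ev_triple, ev_replicate, ω_pow_four]
    have h3 : (3 * ev l).re = 3 * (ev l).re := by
      simp
    have h4 : ((2 * 2 ^ h : ℕ) : ℂ).re = 2 * 2 ^ h := by
      rw [Complex.natCast_re]; push_cast; rfl
    rw [Complex.add_re, h3, ha, mul_neg_one, Complex.neg_re, h4]
    ring
  rw [geTest, nonneg_iff, this, mul_nonneg_iff_of_pos_left h2]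
  constructor <;> intro h <;> linarith

theorem leTest_iff {h : ℕ} {l : List ℕ} {a : ℝ} (ha : (ev l).re = 2 ^ h * a) :
    leTest h l = true ↔ a ≤ 1 / 3 := by
  have h2 : (0 : ℝ) < 2 ^ h := by positivity
  have : (ev (((List.range 3).flatMap fun _ => l.map fun e => e + 4) ++
      List.replicate (2 ^ h) 0)).re = 2 ^ h * (1 - 3 * a) := by
    rw [ev_append, ev_triple, ev_map_add, ev_replicate, ω_pow_four]
    have h3 : (3 * (-1 * ev l)).re = -3 * (ev l).re := by
      rw [show 3 * (-1 * ev l) = ((-3 : ℝ) : ℂ) * ev l by push_cast; ring, Complex.re_ofReal_mul]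
    have h4 : ((2 ^ h : ℕ) : ℂ).re = 2 ^ h := by
      rw [Complex.natCast_re]; push_cast; rfl
    rw [Complex.add_re, h3, ha, pow_zero, mul_one, h4]
    ring
  rw [leTest, nonneg_iff, this, mul_nonneg_iff_of_pos_left h2]
  constructor <;> intro h <;> linarith

section
variable {α : Type*} [Primcodable α]

@[fun_prop] theorem primrec_geTest {h : α → ℕ} {l : α → List ℕ} (hh : Primrec h)
    (hl : Primrec l) : Primrec fun a => geTest (h a) (l a) := by
  unfold geTest
  fun_prop

@[fun_prop] theorem primrec_leTest {h : α → ℕ} {l : α → List ℕ} (hh : Primrec h)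
    (hl : Primrec l) : Primrec fun a => leTest (h a) (l a) := by
  unfold leTest
  fun_prop

end

/-! The matrix of acceptance probabilities. -/

variable {K n : ℕ}

/-- The quadratic form on the inputs of a circuit that gives the acceptance probability. -/
noncomputable def acceptMatrix (K : ℕ) (gs : List QGate) (E : Matrix (QBasis K) (QBasis n) ℂ) :
    Matrix (QBasis n) (QBasis n) ℂ :=
  Eᴴ * ((circuitMatrix K gs)ᴴ * acceptProjection K * circuitMatrix K gs) * E

theorem isHermitian_acceptMatrix (gs : List QGate) (E : Matrix (QBasis K) (QBasis n) ℂ) :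
    (acceptMatrix K gs E).IsHermitian := by
  have h : (acceptProjection K)ᴴ = acceptProjection K := by
    rw [acceptProjection, Matrix.diagonal_conjTranspose]
    congr 1
    funext b
    simp only [Pi.star_apply]
    split_ifs <;> simp
  simp only [acceptMatrix, Matrix.IsHermitian, Matrix.conjTranspose_mul,
    Matrix.conjTranspose_conjTranspose, h, Matrix.mul_assoc]

theorem circuitAccept_mulVec (gs : List QGate) (E : Matrix (QBasis K) (QBasis n) ℂ)
    (ψ : QBasis n → ℂ) : circuitAccept K gs (E *ᵥ ψ) =
      (star ψ ⬝ᵥ (acceptMatrix K gs E *ᵥ ψ)).re := by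
  rw [circuitAccept, Matrix.star_mulVec, Matrix.mulVec_mulVec, ← Matrix.dotProduct_mulVec,
    Matrix.mulVec_mulVec, acceptMatrix]
  simp only [Matrix.mul_assoc]

theorem circuitAccept_single (gs : List QGate) (E : Matrix (QBasis K) (QBasis n) ℂ)
    (y : QBasis n) : circuitAccept K gs (E *ᵥ Pi.single y 1) = (acceptMatrix K gs E y y).re := by
  rw [circuitAccept_mulVec]
  have : star (Pi.single y (1 : ℂ) : QBasis n → ℂ) = Pi.single y 1 := by
    rw [← Pi.single_star, star_one]
  simp [this, Matrix.col_apply]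

theorem toMat_gram_eq {gs : List QGate} (hg : ∀ g ∈ gs, g.ActsOn K) {L : List Entry}
    (hL : ∀ p ∈ L, p.1.length = K ∧ p.2.1.length = n) :
    toMat n n (gram (gs.map rawGate) L) = ((2 ^ numH (gs.map rawGate) : ℝ) : ℂ) •
      acceptMatrix K gs (toMat K n L) := by
  rw [toMat_gram hg hL]
  push_cast
  rfl

theorem re_ev_diagExps_gram {gs : List QGate} (hg : ∀ g ∈ gs, g.ActsOn K) {L : List Entry}
    (hL : ∀ p ∈ L, p.1.length = K ∧ p.2.1.length = n) {l : List Bool} (hl : l.length = n) :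
    (ev (diagExps l (gram (gs.map rawGate) L))).re = 2 ^ numH (gs.map rawGate) *
      circuitAccept K gs (toMat K n L *ᵥ Pi.single (toBasis n l) 1) := by
  have hs : IsSquare n (gram (gs.map rawGate) L) := fun p hp => length_gram hg hL hp
  rw [ev_diagExps hs hl, toMat_gram_eq hg hL, circuitAccept_single, Matrix.smul_apply, smul_eq_mul,
    Complex.re_ofReal_mul]

/-- The number of qubits that a circuit needs. -/
def rawWidth (gs : List (ℕ × ℕ × ℕ)) : ℕ :=
  (gs.map fun g => max (g.2.1 + 1) (g.2.2 + 1)).foldr max 1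

/-- The placeholder `0` in the triple of a one-qubit gate contributes only `1`, which is no more
than the width. -/
theorem rawWidth_map (gs : List QGate) : rawWidth (gs.map rawGate) = numQubits gs := by
  rw [rawWidth, numQubits, List.map_map]
  congr 1
  refine List.map_congr_left fun g _ => ?_
  cases g <;> simp [rawGate, QGate.width]

theorem actsOn_numQubits (gs : List QGate) : ∀ g ∈ gs, g.ActsOn (numQubits gs) := by
  intro g hg
  have key : g.width ≤ numQubits gs := by
    induction gs with
    | nil => simp at hg
    | cons a gs ih =>
      have : numQubits (a :: gs) = max a.width (numQubits gs) := rfl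
      rw [this]
      rcases List.mem_cons.1 hg with rfl | hg
      · exact le_max_left _ _
      · exact (ih hg).trans (le_max_right _ _)
  cases g with
  | H i => exact key
  | T i => exact key
  | CNOT i j h =>
    have := max_le_iff.1 key
    exact ⟨this.1, this.2⟩

/-- The exponents of the acceptance probability with all qubits initially `0`. -/
def zeroExps (gs : List (ℕ × ℕ × ℕ)) : List ℕ :=
  diagExps (List.replicate (rawWidth gs) false)
    (gram gs [(List.replicate (rawWidth gs) false, List.replicate (rawWidth gs) false, 0)])

theorem re_ev_zeroExps (gs : List QGate) : (ev (zeroExps (gs.map rawGate))).re =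
    2 ^ numH (gs.map rawGate) * circuitAccept (numQubits gs) gs (Pi.single (fun _ => false) 1) := by
  rw [zeroExps, rawWidth_map, re_ev_diagExps_gram (actsOn_numQubits gs) (n := numQubits gs)
    (by simp) (by simp)]
  have h : toBasis (numQubits gs) (List.replicate (numQubits gs) false) = fun _ => false := by
    funext i
    simp [toBasis, List.getD_eq_getElem?_getD]
  rw [h, toMat_cons, h, toMat_nil, add_zero, pow_zero]
  congr 2
  ext b
  simp [Matrix.single_apply, Pi.single_apply, eq_comm]

/-- The initial states for all basis states as witnesses. -/
def columns (m k : ℕ) : List Entry :=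
  (strings m).map fun l => (l ++ List.replicate k false, l, 0)

theorem length_columns {m k : ℕ} : ∀ p ∈ columns m k, p.1.length = m + k ∧ p.2.1.length = m := by
  intro p hp
  obtain ⟨l, hl, rfl⟩ := List.mem_map.1 hp
  simp [mem_strings.1 hl]

/-- The columns form the isometry `ψ ↦ ψ ⊗ 0^k`, by which the acceptance probability becomes a
quadratic form in the witness. -/
theorem toMat_columns_mulVec (m k : ℕ) (ψ : QBasis m → ℂ) :
    toMat (m + k) m (columns m k) *ᵥ ψ = withAncillas m k ψ := by
  have h1 : toMat (m + k) m (columns m k) =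
      ∑ y : QBasis m, Matrix.single (Fin.append y fun _ => false) y 1 := by
    rw [← sum_strings, toMat, columns, List.map_map]
    congr 1
    refine List.map_congr_left fun l hl => ?_
    have : toBasis (m + k) (l ++ List.replicate k false) =
        Fin.append (toBasis m l) fun _ => false := by
      have hl := mem_strings.1 hl
      funext i
      refine Fin.addCases (fun i => ?_) (fun i => ?_) i
      · simp [toBasis, List.getD_eq_getElem?_getD, hl, List.getElem?_append_left]
      · rw [Fin.append_right]
        simp [toBasis, List.getD_eq_getElem?_getD, hl]
    simp [this]
  rw [h1]
  funext b
  rw [Matrix.mulVec, dotProduct]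
  have h3 : ∀ y, (∑ z : QBasis m, Matrix.single (Fin.append z fun _ : Fin k => false) z (1 : ℂ)) b y =
      if (Fin.append y fun _ => false) = b then 1 else 0 := by
    intro y
    rw [Matrix.sum_apply, Finset.sum_eq_single y]
    · simp [Matrix.single_apply]
    · intro z _ hz
      rw [Matrix.single_apply, if_neg fun h => hz h.2]
    · simp
  simp only [h3, withAncillas]
  have h2 : ∀ y : QBasis m, (Fin.append y (fun _ : Fin k => false) = b) ↔
      (∀ j : Fin k, b (Fin.natAdd m j) = false) ∧ y = fun i => b (Fin.castAdd k i) := by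
    intro y
    constructor
    · rintro rfl
      simp
    · rintro ⟨h, rfl⟩
      funext i
      refine Fin.addCases (fun i => ?_) (fun i => ?_) i <;> simp [h]
  simp only [h2]
  split_ifs with h
  · rw [Finset.sum_eq_single fun i => b (Fin.castAdd k i)]
    · simp [h]
    · intro y _ hy
      simp [hy]
    · simp
  · simp [h]

/-- The entries of the matrix of acceptance probabilities for a circuit with witnesses. -/
def witnessGram (m k : ℕ) (gs : List (ℕ × ℕ × ℕ)) : List Entry := gram gs (columns m k)

theorem re_ev_witness {m k : ℕ} {gs : List QGate} (hg : ∀ g ∈ gs, g.ActsOn (m + k))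
    {l : List Bool} (hl : l.length = m) :
    (ev (diagExps l (witnessGram m k (gs.map rawGate)))).re = 2 ^ numH (gs.map rawGate) *
      circuitAccept (m + k) gs (withAncillas m k (Pi.single (toBasis m l) 1)) := by
  rw [witnessGram, re_ev_diagExps_gram hg length_columns hl, toMat_columns_mulVec]

/-- Some basis state is accepted. -/
def classicalYes (m k : ℕ) (gs : List (ℕ × ℕ × ℕ)) : Bool :=
  (strings m).any fun l => geTest (numH gs) (diagExps l (witnessGram m k gs))

/-- All basis states are rejected. -/
def classicalNo (m k : ℕ) (gs : List (ℕ × ℕ × ℕ)) : Bool :=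
  (strings m).all fun l => leTest (numH gs) (diagExps l (witnessGram m k gs))

/-- Some state is accepted. -/
def quantumYes (m k : ℕ) (gs : List (ℕ × ℕ × ℕ)) : Bool :=
  !isPD m (shifted m (2 * 2 ^ numH gs) (witnessGram m k gs))

/-- All states are rejected. -/
def quantumNo (m k : ℕ) (gs : List (ℕ × ℕ × ℕ)) : Bool :=
  isPSD m (shifted m (2 ^ numH gs) (witnessGram m k gs))

section
variable {m k : ℕ} {gs : List QGate}

theorem classicalYes_iff (hg : ∀ g ∈ gs, g.ActsOn (m + k)) :
    classicalYes m k (gs.map rawGate) = true ↔ ∃ y : QBasis m,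
      2 / 3 ≤ circuitAccept (m + k) gs (withAncillas m k (Pi.single y 1)) := by
  rw [classicalYes, List.any_eq_true]
  constructor
  · rintro ⟨l, hl, h⟩
    exact ⟨_, (geTest_iff (re_ev_witness hg (mem_strings.1 hl))).1 h⟩
  · rintro ⟨y, hy⟩
    obtain ⟨l, hl, rfl⟩ := exists_toBasis y
    exact ⟨l, mem_strings.2 hl, (geTest_iff (re_ev_witness hg hl)).2 hy⟩

theorem classicalNo_iff (hg : ∀ g ∈ gs, g.ActsOn (m + k)) :
    classicalNo m k (gs.map rawGate) = true ↔ ∀ y : QBasis m,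
      circuitAccept (m + k) gs (withAncillas m k (Pi.single y 1)) ≤ 1 / 3 := by
  rw [classicalNo, List.all_eq_true]
  constructor
  · intro h y
    obtain ⟨l, hl, rfl⟩ := exists_toBasis y
    exact (leTest_iff (re_ev_witness hg hl)).1 (h l (mem_strings.2 hl))
  · intro h l hl
    exact (leTest_iff (re_ev_witness hg (mem_strings.1 hl))).2 (h _)

theorem shifted_witnessGram (hg : ∀ g ∈ gs, g.ActsOn (m + k)) (c : ℕ) :
    IsSquare m (shifted m c (witnessGram m k (gs.map rawGate))) ∧
    toMat m m (shifted m c (witnessGram m k (gs.map rawGate))) =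
      ((c : ℝ) : ℂ) • (1 : Matrix (QBasis m) (QBasis m) ℂ) -
        ((3 * 2 ^ numH (gs.map rawGate) : ℝ) : ℂ) •
          acceptMatrix (m + k) gs (toMat (m + k) m (columns m k)) := by
  refine ⟨isSquare_shifted fun p hp => length_gram hg length_columns hp, ?_⟩
  rw [toMat_shifted, witnessGram, toMat_gram_eq hg length_columns, smul_smul]
  push_cast
  rfl

/-- The condition is the negation of a strict bound for all unit vectors, which is positive
definiteness of `2 * 2^h - 3 G`; no optimal witness has to be constructed. -/
theorem quantumYes_iff (hg : ∀ g ∈ gs, g.ActsOn (m + k)) :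
    quantumYes m k (gs.map rawGate) = true ↔ ∃ ψ : QBasis m → ℂ, ∑ b, ‖ψ b‖ ^ 2 = 1 ∧
      2 / 3 ≤ circuitAccept (m + k) gs (withAncillas m k ψ) := by
  have h2 : (0 : ℝ) < 2 ^ numH (gs.map rawGate) := by positivity
  obtain ⟨hs, he⟩ := shifted_witnessGram hg (2 * 2 ^ numH (gs.map rawGate))
  have hA := isHermitian_acceptMatrix gs (toMat (m + k) m (columns m k))
  have hH := isHermitian_smul_one_sub hA ((2 * 2 ^ numH (gs.map rawGate) : ℕ) : ℝ)
    (3 * 2 ^ numH (gs.map rawGate))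
  rw [← he] at hH
  rw [quantumYes, Bool.not_eq_true', ← Bool.not_eq_true, isPD_iff hs hH, he,
    posDef_smul_one_sub_iff hA]
  push Not
  refine exists_congr fun ψ => and_congr_right fun _ => ?_
  rw [← toMat_columns_mulVec, circuitAccept_mulVec]
  push_cast
  rw [mul_comm 2, mul_comm 3, mul_assoc, mul_le_mul_iff_right₀ h2, div_le_iff₀' (by norm_num)]

theorem quantumNo_iff (hg : ∀ g ∈ gs, g.ActsOn (m + k)) :
    quantumNo m k (gs.map rawGate) = true ↔ ∀ ψ : QBasis m → ℂ, ∑ b, ‖ψ b‖ ^ 2 = 1 →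
      circuitAccept (m + k) gs (withAncillas m k ψ) ≤ 1 / 3 := by
  have h2 : (0 : ℝ) < 2 ^ numH (gs.map rawGate) := by positivity
  obtain ⟨hs, he⟩ := shifted_witnessGram hg (2 ^ numH (gs.map rawGate))
  have hA := isHermitian_acceptMatrix gs (toMat (m + k) m (columns m k))
  have hH := isHermitian_smul_one_sub hA ((2 ^ numH (gs.map rawGate) : ℕ) : ℝ)
    (3 * 2 ^ numH (gs.map rawGate))
  rw [← he] at hH
  rw [quantumNo, isPSD_iff hs hH, he, posSemidef_smul_one_sub_iff hA]
  refine forall_congr' fun ψ => imp_congr_right fun _ => ?_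
  rw [← toMat_columns_mulVec, circuitAccept_mulVec]
  push_cast
  rw [mul_comm 3, mul_assoc, mul_le_iff_le_one_right h2, le_div_iff₀' (by norm_num)]

end

section
variable {α : Type*} [Primcodable α] {m k : α → ℕ} {g : α → List (ℕ × ℕ × ℕ)}

@[fun_prop] theorem primrec_rawWidth (hg : Primrec g) : Primrec fun a => rawWidth (g a) := by
  have hmax : ∀ {β : Type _} [Primcodable β] {u v : β → ℕ}, Primrec u → Primrec v →
      Primrec fun b => max (u b) (v b) := fun hu hv => Primrec.nat_max.comp hu hv
  unfold rawWidth
  refine Primrec.foldr' (Primrec.map' hg (hmax ?_ ?_)) (by fun_prop) (hmax ?_ ?_) <;> fun_prop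

@[fun_prop] theorem primrec_zeroExps (hg : Primrec g) : Primrec fun a => zeroExps (g a) := by
  unfold zeroExps
  fun_prop

@[fun_prop] theorem primrec_witnessGram (hm : Primrec m) (hk : Primrec k) (hg : Primrec g) :
    Primrec fun a => witnessGram (m a) (k a) (g a) := by
  unfold witnessGram columns
  fun_prop

@[fun_prop] theorem primrec_classicalYes (hm : Primrec m) (hk : Primrec k) (hg : Primrec g) :
    Primrec fun a => classicalYes (m a) (k a) (g a) := by
  unfold classicalYes
  fun_prop

@[fun_prop] theorem primrec_classicalNo (hm : Primrec m) (hk : Primrec k) (hg : Primrec g) :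
    Primrec fun a => classicalNo (m a) (k a) (g a) := by
  unfold classicalNo
  fun_prop

@[fun_prop] theorem primrec_quantumYes (hm : Primrec m) (hk : Primrec k) (hg : Primrec g) :
    Primrec fun a => quantumYes (m a) (k a) (g a) := by
  unfold quantumYes
  fun_prop

@[fun_prop] theorem primrec_quantumNo (hm : Primrec m) (hk : Primrec k) (hg : Primrec g) :
    Primrec fun a => quantumNo (m a) (k a) (g a) := by
  unfold quantumNo
  fun_prop

end

end PathSum

/-! Encodings of circuits. -/

/-- `Function.partialInv` is the noncomputable specification of decoding. A concrete decoder agrees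
with it if it is correct on encodings and fails on all other words. -/
theorem eq_map_partialInv {α β γ : Type*} {f : α → β} (hf : Function.Injective f) {g : α → γ}
    {r : β → Option γ} (h1 : ∀ a, r (f a) = some (g a)) (h2 : ∀ b c, r b = some c → ∃ a, f a = b)
    (b : β) : r b = (Function.partialInv f b).map g := by
  have h := hf.isPartialInv
  by_cases hb : ∃ a, f a = b
  · obtain ⟨a, rfl⟩ := hb
    rw [h1, (h _ _).2 rfl, Option.map_some]
  · have h3 : Function.partialInv f b = none :=
      Option.eq_none_iff_forall_ne_some.2 fun a ha => hb ⟨a, (h _ _).1 ha⟩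
    rw [h3, Option.map_none]
    exact Option.eq_none_iff_forall_ne_some.2 fun c hc => hb (h2 b c hc)

/-- An output word determines the circuit of a machine, including the case that there is none. -/
theorem eq_partialInv {α β : Type*} {f : α → β} (hf : Function.Injective f) {o : Option α} {b : β}
    (h : ∀ a, o = some a ↔ f a = b) : o = Function.partialInv f b :=
  Option.ext fun a => (h a).trans (hf.isPartialInv a b).symm

theorem replicate_append_inj {a b : ℕ} {r r' : List Bool} (hr : r.head? ≠ some true)
    (hr' : r'.head? ≠ some true)
    (h : List.replicate a true ++ r = List.replicate b true ++ r') : a = b ∧ r = r' := by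
  induction a generalizing b with
  | zero =>
    cases b with
    | zero => exact ⟨rfl, h⟩
    | succ b =>
      rw [List.replicate_zero, List.nil_append] at h
      simp [h, List.replicate_succ] at hr
  | succ a ih =>
    cases b with
    | zero =>
      rw [List.replicate_zero, List.nil_append] at h
      simp [← h, List.replicate_succ] at hr'
    | succ b =>
      simp only [List.replicate_succ, List.cons_append, List.cons.injEq, true_and] at h
      exact ⟨congrArg _ (ih h).1, (ih h).2⟩

namespace PathSum

/-- An encoded gate ends with a unary block, which is delimited only if the remaining word does not
continue with `true`. -/
theorem encode_append_inj {g g' : QGate} {r r' : List Bool} (hr : r.head? ≠ some true)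
    (hr' : r'.head? ≠ some true) (h : g.encode ++ r = g'.encode ++ r') : g = g' ∧ r = r' := by
  cases g with
  | H i =>
    cases g' with
    | H j =>
      simp only [QGate.encode, List.cons_append, List.nil_append,
        List.cons.injEq, true_and] at h
      obtain ⟨h, rfl⟩ := replicate_append_inj hr hr' h
      simp_all
    | T j => simp [QGate.encode] at h
    | CNOT j k _ => simp [QGate.encode] at h
  | T i =>
    cases g' with
    | T j =>
      simp only [QGate.encode, List.cons_append, List.nil_append,
        List.cons.injEq, true_and] at h
      obtain ⟨h, rfl⟩ := replicate_append_inj hr hr' h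
      simp_all
    | H j => simp [QGate.encode] at h
    | CNOT j k _ => simp [QGate.encode] at h
  | CNOT i i' hi =>
    cases g' with
    | H j => simp [QGate.encode] at h
    | T j => simp [QGate.encode] at h
    | CNOT j j' _ =>
      simp only [QGate.encode, List.append_assoc, List.cons_append, List.nil_append,
        List.cons.injEq, true_and] at h
      obtain ⟨h1, h⟩ := replicate_append_inj (by simp) (by simp) h
      simp only [List.cons.injEq, true_and] at h
      obtain ⟨h2, rfl⟩ := replicate_append_inj hr hr' h
      simp_all

/-- The encoding of a gate. -/
def rawEncode (g : ℕ × ℕ × ℕ) : List Bool :=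
  bif decide (g.1 = 0) then false :: true :: false :: List.replicate (g.2.1 + 1) true
  else bif decide (g.1 = 1) then true :: false :: false :: List.replicate (g.2.1 + 1) true
  else true :: true :: false :: (List.replicate (g.2.1 + 1) true ++
    false :: List.replicate (g.2.2 + 1) true)

theorem rawEncode_rawGate (g : QGate) : rawEncode (rawGate g) = g.encode := by
  cases g <;> rfl

/-- The encoding of a circuit. -/
def rawEncodeGates (gs : List (ℕ × ℕ × ℕ)) : List Bool :=
  (gs.flatMap fun g => false :: rawEncode g).tail

/-- With a separator in front of every gate the encoding is a plain concatenation, from which only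
the first separator is removed; this form suits inductions. -/
theorem encodeGates_eq (gs : List QGate) :
    encodeGates gs = (gs.flatMap fun g => false :: g.encode).tail := by
  have h : ∀ (l : List (List Bool)) (a : List Bool),
      List.intercalate [false] (a :: l) = a ++ l.flatMap fun b => false :: b := by
    intro l
    induction l with
    | nil => simp
    | cons b l ih =>
      intro a
      rw [List.intercalate_cons_cons, ih]
      simp
  cases gs with
  | nil => rfl
  | cons g gs =>
    rw [encodeGates, List.map_cons, h, List.flatMap_map]
    rfl

theorem rawEncodeGates_map (gs : List QGate) :
    rawEncodeGates (gs.map rawGate) = encodeGates gs := by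
  rw [encodeGates_eq, rawEncodeGates, List.flatMap_map]
  simp only [rawEncode_rawGate]

theorem head?_flatMap_encode (gs : List QGate) :
    (gs.flatMap fun g => false :: g.encode).head? ≠ some true := by
  cases gs <;> simp

theorem encodeGates_injective : Function.Injective encodeGates := by
  have key : ∀ gs gs' : List QGate, (gs.flatMap fun g => false :: g.encode) =
      (gs'.flatMap fun g => false :: g.encode) → gs = gs' := by
    intro gs
    induction gs with
    | nil => intro gs' h; cases gs' with
      | nil => rfl
      | cons g gs' => simp at h
    | cons g gs ih =>
      intro gs' h
      cases gs' with
      | nil => simp at h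
      | cons g' gs' =>
        simp only [List.flatMap_cons, List.cons_append, List.cons.injEq, true_and] at h
        obtain ⟨h1, h2⟩ := encode_append_inj (head?_flatMap_encode _) (head?_flatMap_encode _) h
        rw [h1, ih _ h2]
  -- Removing the first separator loses nothing, provided that the empty circuit is told apart from
  -- all others.
  have hne : ∀ (g : QGate) (r : List Bool), g.encode ++ r ≠ [] := by
    intro g r
    cases g <;> simp [QGate.encode]
  intro gs gs' h
  rw [encodeGates_eq, encodeGates_eq] at h
  refine key _ _ ?_
  cases gs with
  | nil => cases gs' with
    | nil => rfl
    | cons g' gs' => exact absurd h.symm (hne _ _)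
  | cons g gs => cases gs' with
    | nil => exact absurd h (hne _ _)
    | cons g' gs' =>
      simp only [List.flatMap_cons, List.cons_append, List.tail_cons] at h ⊢
      rw [h]

theorem encodeWitnessCircuit_injective : Function.Injective encodeWitnessCircuit := by
  intro c c' h
  obtain ⟨h1, h2⟩ := replicate_append_inj (by simp) (by simp) h
  exact Prod.ext h1 (encodeGates_injective (List.cons.inj h2).2)

/-- Triples that represent a gate. -/
def isGate (g : ℕ × ℕ × ℕ) : Bool :=
  (decide (g.1 = 2) && !decide (g.2.1 = g.2.2)) ||
    ((decide (g.1 = 0) || decide (g.1 = 1)) && decide (g.2.2 = 0))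

theorem exists_rawGate {g : ℕ × ℕ × ℕ} (h : isGate g = true) : ∃ G, rawGate G = g := by
  obtain ⟨k, i, j⟩ := g
  simp only [isGate, Bool.or_eq_true, Bool.and_eq_true, decide_eq_true_eq, Bool.not_eq_true',
    decide_eq_false_iff_not] at h
  rcases h with ⟨rfl, h⟩ | ⟨rfl | rfl, rfl⟩
  · exact ⟨.CNOT i j h, rfl⟩
  · exact ⟨.H i, rfl⟩
  · exact ⟨.T i, rfl⟩

theorem isGate_rawGate (G : QGate) : isGate (rawGate G) = true := by
  cases G with
  | H i => rfl
  | T i => rfl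
  | CNOT i j h => simp [isGate, rawGate, h]

/-- All lists of length at most `n` over an alphabet. -/
def listsUpTo {α : Type*} (A : List α) (n : ℕ) : List (List α) :=
  (fun S => [] :: S.flatMap fun l => A.map fun a => a :: l)^[n] [[]]

theorem mem_listsUpTo {α : Type*} {A : List α} {n : ℕ} {l : List α} (hl : l.length ≤ n)
    (h : ∀ a ∈ l, a ∈ A) : l ∈ listsUpTo A n := by
  induction n generalizing l with
  | zero =>
    obtain rfl : l = [] := by simpa using hl
    simp [listsUpTo]
  | succ n ih =>
    rw [listsUpTo, Function.iterate_succ_apply', ← listsUpTo]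
    cases l with
    | nil => simp
    | cons a l =>
      refine List.mem_cons_of_mem _ (List.mem_flatMap.2 ⟨l, ih (by simpa using hl)
        fun a ha => h a (by simp [ha]), List.mem_map_of_mem (h a (by simp))⟩)

/-- Triples with small entries. -/
def triples (n : ℕ) : List (ℕ × ℕ × ℕ) := (List.range 3).flatMap fun k =>
  (List.range (n + 1)).flatMap fun i => (List.range (n + 1)).map fun j => (k, i, j)

theorem mem_triples {n : ℕ} {g : QGate} (h : g.width ≤ n + 1) : rawGate g ∈ triples n := by
  have key : ∀ k i j, k < 3 → i < n + 1 → j < n + 1 → (k, i, j) ∈ triples n := by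
    intro k i j hk hi hj
    simp only [triples, List.mem_flatMap, List.mem_map, List.mem_range]
    exact ⟨k, hk, i, hi, j, hj, rfl⟩
  cases g with
  | H i => exact key _ _ _ (by simp) (by simpa [QGate.width] using h) (by simp)
  | T i => exact key _ _ _ (by simp) (by simpa [QGate.width] using h) (by simp)
  | CNOT i j _ =>
    simp only [QGate.width, max_le_iff] at h
    exact key _ _ _ (by simp) (by omega) (by omega)

/-- The circuit with a given encoding. -/
def rawDecode (s : List Bool) : Option (List (ℕ × ℕ × ℕ)) :=
  (listsUpTo (triples s.length) s.length).find? fun gs =>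
    decide (rawEncodeGates gs = s) && gs.all isGate

theorem width_le (g : QGate) : g.width ≤ g.encode.length := by
  cases g <;> grind [QGate.width, QGate.encode]

theorem length_le_encodeGates (gs : List QGate) : gs.length ≤ (encodeGates gs).length ∧
    ∀ g ∈ gs, g.width ≤ (encodeGates gs).length + 1 := by
  rw [encodeGates_eq]
  have h1 : ∀ gs : List QGate, 2 * gs.length ≤ (gs.flatMap fun g => false :: g.encode).length := by
    intro gs
    induction gs with
    | nil => simp
    | cons g gs ih =>
      have : 1 ≤ g.encode.length := by cases g <;> simp [QGate.encode]
      simp only [List.flatMap_cons, List.length_append, List.length_cons]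
      omega
  have h2 : ∀ g ∈ gs, g.width ≤ (gs.flatMap fun g => false :: g.encode).length := by
    intro g hg
    induction gs with
    | nil => simp at hg
    | cons a gs ih =>
      simp only [List.flatMap_cons, List.length_append, List.length_cons]
      rcases List.mem_cons.1 hg with rfl | hg
      · have := width_le g
        omega
      · have := ih hg
        omega
  rw [List.length_tail]
  refine ⟨?_, fun g hg => ?_⟩
  · have := h1 gs
    omega
  · have := h2 g hg
    omega

/-- Decoding is exhaustive search, which is finite because the length of an encoding bounds the
number of gates and their qubit indices. -/
theorem rawDecode_eq (s : List Bool) :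
    rawDecode s = (Function.partialInv encodeGates s).map (List.map rawGate) := by
  have h2 : ∀ s L, rawDecode s = some L →
      ∃ gs : List QGate, encodeGates gs = s ∧ L = gs.map rawGate := by
    intro s L h
    have h3 := List.find?_some h
    simp only [Bool.and_eq_true, decide_eq_true_eq, List.all_eq_true] at h3
    obtain ⟨h3, h4⟩ := h3
    have h5 : ∀ L : List (ℕ × ℕ × ℕ), (∀ g ∈ L, isGate g = true) →
        ∃ gs : List QGate, gs.map rawGate = L := by
      intro L
      induction L with
      | nil => exact fun _ => ⟨[], rfl⟩
      | cons g L ih =>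
        intro h
        obtain ⟨G, rfl⟩ := exists_rawGate (h g (by simp))
        obtain ⟨gs, rfl⟩ := ih fun g hg => h g (by simp [hg])
        exact ⟨G :: gs, rfl⟩
    obtain ⟨gs, rfl⟩ := h5 L h4
    exact ⟨gs, by rw [← h3, rawEncodeGates_map], rfl⟩
  refine eq_map_partialInv (g := List.map rawGate) encodeGates_injective (fun gs => ?_)
    (fun s L h => (h2 s L h).imp fun _ h => h.1) s
  cases h : rawDecode (encodeGates gs) with
  | none =>
    have := List.find?_eq_none.1 h (gs.map rawGate) (mem_listsUpTo
      (by simpa using (length_le_encodeGates gs).1) fun g hg => by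
        obtain ⟨G, hG, rfl⟩ := List.mem_map.1 hg
        exact mem_triples ((length_le_encodeGates gs).2 G hG))
    simp [rawEncodeGates_map, isGate_rawGate] at this
  | some L =>
    obtain ⟨gs', h', rfl⟩ := h2 _ _ h
    rw [encodeGates_injective h']

/-- The circuit and the number of witness qubits with a given encoding. -/
def rawDecodeWitness (s : List Bool) : Option (ℕ × List (ℕ × ℕ × ℕ)) :=
  ((List.range s.length).find? fun m =>
    decide (s.take (m + 1) = List.replicate m true ++ [false])).bind fun m =>
      (rawDecode (s.drop (m + 1))).map fun gs => (m, gs)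

theorem rawDecodeWitness_eq (s : List Bool) : rawDecodeWitness s =
    (Function.partialInv encodeWitnessCircuit s).map fun c => (c.1, c.2.map rawGate) := by
  refine eq_map_partialInv encodeWitnessCircuit_injective (fun c => ?_) (fun s c h => ?_) s
  · obtain ⟨m, gs⟩ := c
    have he : encodeWitnessCircuit (m, gs) =
        (List.replicate m true ++ [false]) ++ encodeGates gs := by simp [encodeWitnessCircuit]
    have hlen : (List.replicate m true ++ [false]).length = m + 1 := by simp
    have hm : (List.range (encodeWitnessCircuit (m, gs)).length).find? (fun m' =>
        decide ((encodeWitnessCircuit (m, gs)).take (m' + 1) =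
          List.replicate m' true ++ [false])) = some m := by
      cases h : (List.range (encodeWitnessCircuit (m, gs)).length).find? (fun m' =>
        decide ((encodeWitnessCircuit (m, gs)).take (m' + 1) =
          List.replicate m' true ++ [false])) with
      | none =>
        have := List.find?_eq_none.1 h m (by rw [List.mem_range, he]; simp)
        rw [he, List.take_left' hlen] at this
        simp at this
      | some m' =>
        have h3 := List.find?_some h
        rw [decide_eq_true_eq] at h3
        have h4 := List.take_append_drop (m' + 1) (encodeWitnessCircuit (m, gs))
        rw [h3, encodeWitnessCircuit, List.append_assoc] at h4
        rw [(replicate_append_inj (by simp) (by simp) h4).1]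
    rw [rawDecodeWitness, hm, Option.bind_some, he, List.drop_left' hlen, rawDecode_eq,
      (encodeGates_injective.isPartialInv gs _).2 rfl]
    rfl
  · obtain ⟨m, hm, h⟩ := Option.bind_eq_some_iff.1 h
    obtain ⟨L, hL, rfl⟩ := Option.map_eq_some_iff.1 h
    rw [rawDecode_eq] at hL
    obtain ⟨gs, hgs, rfl⟩ := Option.map_eq_some_iff.1 hL
    have h3 := List.find?_some hm
    rw [decide_eq_true_eq] at h3
    refine ⟨(m, gs), ?_⟩
    rw [← List.take_append_drop (m + 1) s, h3, encodeWitnessCircuit,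
      (encodeGates_injective.isPartialInv gs _).1 hgs]
    simp

section
variable {α : Type*} [Primcodable α]

@[fun_prop] theorem primrec_rawDecode {s : α → List Bool} (hs : Primrec s) :
    Primrec fun a => rawDecode (s a) := by
  unfold rawDecode listsUpTo triples rawEncodeGates rawEncode isGate
  fun_prop

@[fun_prop] theorem primrec_rawDecodeWitness {s : α → List Bool} (hs : Primrec s) :
    Primrec fun a => rawDecodeWitness (s a) := by
  unfold rawDecodeWitness
  fun_prop

end

end PathSum

/-! BQP. -/

/-- The extremal problem of a machine. -/
def BQPMachine.extremal (V : BQPMachine) : PromiseProblem where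
  yes := {x | V.accept x ≥ 2 / 3}
  no := {x | V.accept x ≤ 1 / 3}
  disj := Set.disjoint_left.2 fun x h h' => by
    have h : V.accept x ≥ 2 / 3 := h
    have h' : V.accept x ≤ 1 / 3 := h'
    linarith

theorem bqpStar_eq : BQPStar = Set.range BQPMachine.extremal :=
  extremalClass_eq _ fun _ _ => Iff.rfl

namespace PathSum

/-- A circuit on one qubit for every answer. -/
def answerCircuit : Option Bool → List QGate
  | some true => [.H 0, .T 0, .T 0, .T 0, .T 0, .H 0]
  | some false => []
  | none => [.H 0]

/-- The output of a machine within a polynomial time bound. -/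
def polyOut (i : RawDTM × ℕ) (x : List Bool) : Option (List Bool) :=
  RawDTM.out i.1 (tapeInput x) ((x.length + 2) ^ i.2)

@[fun_prop] theorem primrec_polyOut {α} [Primcodable α] {i : α → RawDTM × ℕ} {x : α → List Bool}
    (hi : Primrec i) (hx : Primrec x) : Primrec fun a => polyOut (i a) (x a) := by
  unfold polyOut
  fun_prop

theorem outputsWithin_polyOut {i : RawDTM × ℕ} {x : List Bool} (h : (polyOut i x).isSome) :
    i.1.toDTM.OutputsWithin (tapeInput x) (((Polynomial.X + 2) ^ i.2 : Polynomial ℕ).eval x.length)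
      ((polyOut i x).getD []) := by
  rw [Polynomial.eval_polyBound, RawDTM.outputsWithin_iff]
  obtain ⟨s, hs⟩ := Option.isSome_iff_exists.1 h
  rw [hs, Option.getD_some]
  exact hs

theorem exists_polyOut {M : DTM} {p : Polynomial ℕ} {s : List Bool → List Bool}
    (h : ∀ x, M.OutputsWithin (tapeInput x) (p.eval x.length) (s x)) :
    ∃ (D : RawDTM) (c₀ : ℕ), ∀ c ≥ c₀, ∀ x, polyOut (D, c) x = some (s x) := by
  obtain ⟨D, rfl⟩ := RawDTM.exists_toDTM M
  obtain ⟨c₀, hc⟩ := p.exists_eval_le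
  exact ⟨D, c₀, fun c h' x =>
    RawDTM.outputsWithin_iff.1 ((h x).mono ((hc _).trans (polyBound_mono h')))⟩

/-- Only the runtime has to be checked: outputs that are no encodings are allowed and stand for
circuits that never accept. -/
theorem bqpStar_presentable : RecursivelyPresentable BQPStar := by
  let o : RawDTM × ℕ → List Bool → Option (List (ℕ × ℕ × ℕ)) := fun i x =>
    rawDecode ((polyOut i x).getD [])
  let val : RawDTM × ℕ → List Bool → Option Bool := fun i x => ofTests
    -- The defaults `false` and `true` are the results of the two tests for acceptance probability
    -- `0`.
    (((o i x).map fun gs => geTest (numH gs) (zeroExps gs)).getD false)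
    (((o i x).map fun gs => leTest (numH gs) (zeroExps gs)).getD true)
  let chk : RawDTM × ℕ → ℕ → Bool := fun i n => (strings n).all fun x => (polyOut i x).isSome
  have hval : ∀ (i : RawDTM × ℕ) (V : BQPMachine),
      (∀ x, V.circuit x = Function.partialInv encodeGates ((polyOut i x).getD [])) →
      V.extremal = problemOf (val i) := by
    intro i V hV
    have ho : ∀ x, o i x = (V.circuit x).map (List.map rawGate) := fun x => by
      rw [hV]
      exact rawDecode_eq _
    refine eq_problemOf_ofTests (fun x => ?_) fun x => ?_
    · change V.accept x ≥ 2 / 3 ↔ _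
      rw [ho, BQPMachine.accept]
      rcases V.circuit x with _ | gs
      · norm_num
      · exact (geTest_iff (re_ev_zeroExps gs)).symm
    · change V.accept x ≤ 1 / 3 ↔ _
      rw [ho, BQPMachine.accept]
      rcases V.circuit x with _ | gs
      · norm_num
      · exact (leTest_iff (re_ev_zeroExps gs)).symm
  rw [bqpStar_eq]
  refine presentable_of_checked (chk := chk) (val := val) ?_ ?_ (fun i hi => ?_) ?_ fun i N => ?_
  · simp only [chk]
    fun_prop
  · simp only [val, o]
    fun_prop
  · have h : ∀ x, (polyOut i x).isSome = true := fun x =>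
      List.all_eq_true.1 (hi x.length) x (mem_strings.2 rfl)
    exact ⟨⟨fun x => Function.partialInv encodeGates ((polyOut i x).getD []), i.1.toDTM,
      (Polynomial.X + 2) ^ i.2, fun x => ⟨_, outputsWithin_polyOut (h x),
        fun gs => encodeGates_injective.isPartialInv gs _⟩⟩, hval i _ fun _ => rfl⟩
  · rintro _ ⟨V, rfl⟩
    obtain ⟨M, p, h⟩ := V.generated
    choose s hs hc using h
    obtain ⟨D, c, hD⟩ := exists_polyOut hs
    have hD := hD c le_rfl
    refine ⟨(D, c), fun n => List.all_eq_true.2 fun x _ => by rw [hD]; rfl,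
      hval _ V fun x => ?_⟩
    rw [hD, Option.getD_some]
    exact eq_partialInv encodeGates_injective (hc x)
  · let f : List Bool → Option Bool := fun x => if x.length < N then val i x else some false
    obtain ⟨M, B, h⟩ := exists_dtm_of_finite N (fun x => encodeGates (answerCircuit (val i x)))
      (encodeGates (answerCircuit (some false)))
    have h := fun x => h x [] (.inl rfl)
    simp only [List.append_nil] at h
    refine ⟨⟨fun x => some (answerCircuit (f x)), M, Polynomial.C B,
      fun x => ⟨encodeGates (answerCircuit (f x)), ?_, fun gs => ?_⟩⟩, ?_⟩
    · have := h x
      rw [Polynomial.eval_C]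
      simp only [f]
      split_ifs at this ⊢ <;> exact this
    · rw [Option.some_inj, encodeGates_injective.eq_iff, eq_comm]
    · ext x
      · refine (geTest_iff (re_ev_zeroExps (answerCircuit (f x)))).symm.trans ?_
        change _ ↔ f x = some true
        -- Acceptance is `1` for `H T^4 H`, which is a bit flip, `0` for the empty circuit, and
        -- `1/2` for a single `H`; the tests evaluate to the intended answers.
        rcases f x with _ | _ | _ <;> decide
      · refine (leTest_iff (re_ev_zeroExps (answerCircuit (f x)))).symm.trans ?_
        change _ ↔ f x = some false
        rcases f x with _ | _ | _ <;> decide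

end PathSum

/-! QCMA and QMA. -/

/-- The extremal problem of a verifier for given sets of witness states. -/
def QVerifier.extremal (W : ∀ m, Set (QBasis m → ℂ)) (V : QVerifier) : PromiseProblem where
  yes := {x | ∃ ψ ∈ W (V.m x.length), V.accept x ψ ≥ 2 / 3}
  no := {x | ∀ ψ ∈ W (V.m x.length), V.accept x ψ ≤ 1 / 3}
  disj := Set.disjoint_left.2 fun x ⟨ψ, hψ, h⟩ h' => by
    have := h' ψ hψ
    linarith

theorem qcmaStar_eq : QCMAStar =
    Set.range (QVerifier.extremal fun _ => Set.range fun y => Pi.single y 1) :=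
  extremalClass_eq _ fun V A => by
    change _ ↔ (∀ x ∈ A.yes, ∃ ψ ∈ Set.range fun y => Pi.single y 1, V.accept x ψ ≥ 2 / 3) ∧
      ∀ x ∈ A.no, ∀ ψ ∈ Set.range fun y => Pi.single y 1, V.accept x ψ ≤ 1 / 3
    simp only [QVerifier.DecidesClassical, Set.exists_range_iff, Set.forall_mem_range]

theorem qmaStar_eq : QMAStar =
    Set.range (QVerifier.extremal fun _ => {ψ | ∑ b, ‖ψ b‖ ^ 2 = 1}) :=
  extremalClass_eq _ fun _ _ => Iff.rfl

namespace PathSum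

/-- Computable tests for the acceptance of witnesses. -/
structure IsTest (W : ∀ m, Set (QBasis m → ℂ)) (Y N : ℕ → ℕ → List (ℕ × ℕ × ℕ) → Bool) : Prop where
  yes_iff : ∀ {m k : ℕ} {gs : List QGate}, (∀ g ∈ gs, g.ActsOn (m + k)) →
    (Y m k (gs.map rawGate) = true ↔
      ∃ ψ ∈ W m, 2 / 3 ≤ circuitAccept (m + k) gs (withAncillas m k ψ))
  no_iff : ∀ {m k : ℕ} {gs : List QGate}, (∀ g ∈ gs, g.ActsOn (m + k)) →
    (N m k (gs.map rawGate) = true ↔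
      ∀ ψ ∈ W m, circuitAccept (m + k) gs (withAncillas m k ψ) ≤ 1 / 3)
  primrec_yes : Primrec fun p : ℕ × ℕ × List (ℕ × ℕ × ℕ) => Y p.1 p.2.1 p.2.2
  primrec_no : Primrec fun p : ℕ × ℕ × List (ℕ × ℕ × ℕ) => N p.1 p.2.1 p.2.2
  yes_answer : ∀ o, Y 0 1 ((answerCircuit o).map rawGate) = true ↔ o = some true
  no_answer : ∀ o, N 0 1 ((answerCircuit o).map rawGate) = true ↔ o = some false

theorem isTest_classical :
    IsTest (fun _ => Set.range fun y => Pi.single y 1) classicalYes classicalNo where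
  yes_iff hg := by rw [classicalYes_iff hg, Set.exists_range_iff]
  no_iff hg := by rw [classicalNo_iff hg, Set.forall_mem_range]
  primrec_yes := by fun_prop
  primrec_no := by fun_prop
  yes_answer o := by rcases o with _ | _ | _ <;> decide
  no_answer o := by rcases o with _ | _ | _ <;> decide

theorem isTest_quantum :
    IsTest (fun _ => {ψ | ∑ b, ‖ψ b‖ ^ 2 = 1}) quantumYes quantumNo where
  yes_iff hg := quantumYes_iff hg
  no_iff hg := quantumNo_iff hg
  primrec_yes := by fun_prop
  primrec_no := by fun_prop
  -- Without witness qubits the matrices have size one, and the definiteness tests can be evaluated.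
  yes_answer o := by rcases o with _ | _ | _ <;> decide
  no_answer o := by rcases o with _ | _ | _ <;> decide

/-- The gate acts on the first `K` qubits. -/
def rawActsOn (K : ℕ) (g : ℕ × ℕ × ℕ) : Bool := (g.2.1 + 1).ble K && (g.2.2 + 1).ble K

theorem rawActsOn_iff {K : ℕ} {g : QGate} : rawActsOn K (rawGate g) = true ↔ g.ActsOn K := by
  cases g <;> simp [rawActsOn, rawGate, QGate.ActsOn, Nat.ble_eq] <;> omega

@[fun_prop] theorem primrec_rawActsOn {α} [Primcodable α] {K : α → ℕ} {g : α → ℕ × ℕ × ℕ}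
    (hK : Primrec K) (hg : Primrec g) : Primrec fun a => rawActsOn (K a) (g a) := by
  unfold rawActsOn
  fun_prop

/-! ### Verifiers as data -/

section Verifier

/-- An index of a verifier: machines for the circuits and for the number of qubits, and the degree
of a time bound. -/
abbrev RawVerifier : Type := (RawDTM × RawDTM) × ℕ

/-- The circuit of a verifier. -/
def RawVerifier.circuit (i : RawVerifier) (x : List Bool) : Option (ℕ × List (ℕ × ℕ × ℕ)) :=
  rawDecodeWitness ((polyOut (i.1.1, i.2) x).getD [])

/-- The number of qubits of a verifier. -/
def RawVerifier.qubits (i : RawVerifier) (n : ℕ) : ℕ := polyVal (i.1.2, i.2) n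

/-- The number of witness qubits of a verifier. -/
def RawVerifier.witness (i : RawVerifier) (n : ℕ) : ℕ :=
  ((((strings n).find? fun x => (i.circuit x).isSome).bind i.circuit).map Prod.fst).getD 0

/-- The check that the index belongs to a verifier. -/
def RawVerifier.check (i : RawVerifier) (n : ℕ) : Bool :=
  polyCheck (i.1.2, i.2) n && (i.witness n).ble (i.qubits n) &&
    (strings n).all fun x => (polyOut (i.1.1, i.2) x).isSome &&
      ((i.circuit x).map fun c => decide (c.1 = i.witness n) &&
        c.2.all (rawActsOn (i.qubits n))).getD true

@[fun_prop] theorem RawVerifier.primrec_circuit {α} [Primcodable α] {i : α → RawVerifier}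
    {x : α → List Bool} (hi : Primrec i) (hx : Primrec x) :
    Primrec fun a => (i a).circuit (x a) := by
  unfold RawVerifier.circuit
  fun_prop

@[fun_prop] theorem RawVerifier.primrec_qubits {α} [Primcodable α] {i : α → RawVerifier}
    {n : α → ℕ} (hi : Primrec i) (hn : Primrec n) : Primrec fun a => (i a).qubits (n a) := by
  unfold RawVerifier.qubits
  fun_prop

@[fun_prop] theorem RawVerifier.primrec_witness {α} [Primcodable α] {i : α → RawVerifier}
    {n : α → ℕ} (hi : Primrec i) (hn : Primrec n) : Primrec fun a => (i a).witness (n a) := by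
  unfold RawVerifier.witness
  fun_prop

@[fun_prop] theorem RawVerifier.primrec_check {α} [Primcodable α] {i : α → RawVerifier}
    {n : α → ℕ} (hi : Primrec i) (hn : Primrec n) : Primrec fun a => (i a).check (n a) := by
  unfold RawVerifier.check
  fun_prop

end Verifier

/-- The separate functions `m` and `k` are not part of an index; their sum is computed by a machine,
and `m` is read off from a valid circuit for an input of the given length. At lengths without valid
circuits the choice of `m` does not matter, as nothing is accepted there. -/
theorem extremal_presentable {W : ∀ m, Set (QBasis m → ℂ)}
    {Y N : ℕ → ℕ → List (ℕ × ℕ × ℕ) → Bool} (hT : IsTest W Y N) :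
    RecursivelyPresentable (Set.range (QVerifier.extremal W)) := by
  let val : RawVerifier → List Bool → Option Bool := fun i x => ofTests
    (((i.circuit x).map fun c => Y c.1 (i.qubits x.length - c.1) c.2).getD false)
    (((i.circuit x).map fun c => N c.1 (i.qubits x.length - c.1) c.2).getD true)
  have hval : ∀ (i : RawVerifier) (V : QVerifier),
      (∀ x, V.circuit x = Function.partialInv encodeWitnessCircuit
        ((polyOut (i.1.1, i.2) x).getD [])) →
      (∀ n, i.qubits n = V.k n + V.m n) → V.extremal W = problemOf (val i) := by
    intro i V hV hq
    have ho : ∀ x, i.circuit x = (V.circuit x).map fun c => (c.1, c.2.map rawGate) := fun x => by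
      rw [hV]
      exact rawDecodeWitness_eq _
    refine eq_problemOf_ofTests (fun x => ?_) fun x => ?_
    · change (∃ ψ ∈ W _, V.accept x ψ ≥ 2 / 3) ↔ _
      rw [ho, hq]
      simp only [QVerifier.accept]
      rcases hc : V.circuit x with _ | ⟨m, gs⟩
      · norm_num
      · obtain ⟨h1, h2⟩ := V.actsOn x _ hc
        simp only at h1
        subst h1
        simpa using (hT.yes_iff h2).symm
    · change (∀ ψ ∈ W _, V.accept x ψ ≤ 1 / 3) ↔ _
      rw [ho, hq]
      simp only [QVerifier.accept]
      rcases hc : V.circuit x with _ | ⟨m, gs⟩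
      · norm_num
      · obtain ⟨h1, h2⟩ := V.actsOn x _ hc
        simp only at h1
        subst h1
        simpa using (hT.no_iff h2).symm
  refine presentable_of_checked (chk := RawVerifier.check) (val := val) (by fun_prop) ?_
    (fun i hi => ?_) ?_ fun i M => ?_
  · have hY := hT.primrec_yes
    have hN := hT.primrec_no
    simp only [val]
    fun_prop
  · have h : ∀ n, _ := fun n => hi n
    simp only [RawVerifier.check, Bool.and_eq_true, forall_and, List.all_eq_true, mem_strings,
      Nat.ble_eq] at h
    obtain ⟨⟨h1, h2⟩, h3⟩ := h
    -- The checks guarantee that there are at least as many qubits as witness qubits, so the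
    -- truncated difference is a correct number of ancillas.
    have hk : (fun n => i.qubits n - i.witness n + i.witness n) = i.qubits :=
      funext fun n => Nat.sub_add_cancel (h2 n)
    refine ⟨⟨fun x => Function.partialInv encodeWitnessCircuit
      ((polyOut (i.1.1, i.2) x).getD []), i.witness, fun n => i.qubits n - i.witness n,
      by rw [hk]; exact inPoly_polyVal h1, fun x c hc => ?_, i.1.1.toDTM,
      (Polynomial.X + 2) ^ i.2, fun x => ⟨_, outputsWithin_polyOut (h3.1 x.length x rfl),
        fun c => encodeWitnessCircuit_injective.isPartialInv c _⟩⟩,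
      hval i _ (fun _ => rfl) fun n => (congrFun hk n).symm⟩
    have hx := h3.2 x.length x rfl
    rw [RawVerifier.circuit, rawDecodeWitness_eq, hc] at hx
    simp only [Option.map_some, Option.getD_some, Bool.and_eq_true, decide_eq_true_eq,
      List.all_eq_true, List.forall_mem_map, rawActsOn_iff] at hx
    rwa [Nat.add_sub_cancel' (h2 _)]
  · rintro _ ⟨V, rfl⟩
    obtain ⟨M, p, h⟩ := V.generated
    choose s hs hc using h
    obtain ⟨D, c, hD⟩ := exists_polyOut hs
    obtain ⟨S, c', hS⟩ := exists_polyVal V.inPoly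
    have hD := hD (max c c') (le_max_left _ _)
    obtain ⟨hS, hS'⟩ := hS (max c c') (le_max_right _ _)
    let i : RawVerifier := ((D, S), max c c')
    have hV : ∀ x, V.circuit x = Function.partialInv encodeWitnessCircuit
        ((polyOut (i.1.1, i.2) x).getD []) := fun x => by
      rw [hD, Option.getD_some]
      exact eq_partialInv encodeWitnessCircuit_injective (hc x)
    have ho : ∀ x, i.circuit x = (V.circuit x).map fun c => (c.1, c.2.map rawGate) := fun x => by
      rw [hV]
      exact rawDecodeWitness_eq _
    have hw : ∀ x c, i.circuit x = some c → c.1 = V.m x.length := fun x c h => by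
      rw [ho] at h
      obtain ⟨c, hc, rfl⟩ := Option.map_eq_some_iff.1 h
      exact (V.actsOn x c hc).1
    -- The value of `V.m` is visible only at lengths with some valid circuit; elsewhere the default
    -- `0` passes the checks.
    have hw' : ∀ n, i.witness n = V.m n ∨
        i.witness n = 0 ∧ ∀ x : List Bool, x.length = n → i.circuit x = none := fun n => by
      rw [RawVerifier.witness]
      cases h : (strings n).find? fun x => (i.circuit x).isSome with
      | none =>
        refine .inr ⟨rfl, fun x hx => ?_⟩
        simpa using List.find?_eq_none.1 h x (mem_strings.2 hx)
      | some x =>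
        obtain ⟨c, hc⟩ := Option.isSome_iff_exists.1 (List.find?_some (p := fun x => (i.circuit x).isSome) h)
        have hx := mem_strings.1 (List.mem_of_find?_eq_some h)
        left
        rw [Option.bind_some, hc, Option.map_some, Option.getD_some, hw x c hc, hx]
    refine ⟨i, fun n => ?_, hval i V hV hS⟩
    simp only [RawVerifier.check, Bool.and_eq_true, List.all_eq_true, mem_strings, Nat.ble_eq]
    have hq : i.qubits n = V.k n + V.m n := hS n
    refine ⟨⟨hS' n, ?_⟩, fun x hx => ⟨by rw [hD]; rfl, ?_⟩⟩
    · rcases hw' n with h | h <;> omega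
    · cases hx' : i.circuit x with
      | none => rfl
      | some c =>
        have hwn : i.witness n = V.m n := (hw' n).resolve_right fun h => by
          simp [h.2 x hx] at hx'
        rw [Option.map_some, Option.getD_some, hwn, hw x c hx', hx, hq]
        rw [ho] at hx'
        obtain ⟨c, hc, rfl⟩ := Option.map_eq_some_iff.1 hx'
        have := (V.actsOn x c hc).2
        rw [hx, add_comm] at this
        simpa [rawActsOn_iff] using this
  · let f : List Bool → Option Bool := fun x => if x.length < M then val i x else some false
    obtain ⟨D, B, h⟩ := exists_dtm_of_finite M
      (fun x => encodeWitnessCircuit (0, answerCircuit (val i x)))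
      (encodeWitnessCircuit (0, answerCircuit (some false)))
    have h := fun x => h x [] (.inl rfl)
    simp only [List.append_nil] at h
    have ha : ∀ o, ∀ g ∈ answerCircuit o, g.ActsOn (0 + 1) := by
      intro o
      rcases o with _ | _ | _ <;> simp [answerCircuit, QGate.ActsOn]
    -- No witness qubits, and one ancilla that holds the answer.
    refine ⟨⟨fun x => some (0, answerCircuit (f x)), fun _ => 0, fun _ => 1, inPoly_const 1,
      fun x c hc => ?_, D, Polynomial.C B,
      fun x => ⟨encodeWitnessCircuit (0, answerCircuit (f x)), ?_, fun gs => ?_⟩⟩, ?_⟩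
    · obtain rfl := Option.some_inj.1 hc
      exact ⟨rfl, ha _⟩
    · have := h x
      rw [Polynomial.eval_C]
      simp only [f]
      split_ifs at this ⊢ <;> exact this
    · rw [Option.some_inj, encodeWitnessCircuit_injective.eq_iff, eq_comm]
    · ext x
      · exact (hT.yes_iff (ha _)).symm.trans (hT.yes_answer (f x))
      · exact (hT.no_iff (ha _)).symm.trans (hT.no_answer (f x))

end PathSum

theorem qcmaStar_presentable : RecursivelyPresentable QCMAStar :=
  qcmaStar_eq ▸ PathSum.extremal_presentable PathSum.isTest_classical

theorem qmaStar_presentable : RecursivelyPresentable QMAStar :=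
  qmaStar_eq ▸ PathSum.extremal_presentable PathSum.isTest_quantum

theorem mainTheorem8 :
    RecursivelyPresentable classP ∧
    RecursivelyPresentable classNP ∧
    (∀ P ∈ ({PTM.acceptFraction, PTM.acceptProbability} : Set AcceptanceMeasure),
      RecursivelyPresentable (PromiseBPPStar P) ∧
      RecursivelyPresentable (PromiseMAStar P)) ∧
    RecursivelyPresentable BQPStar ∧
    RecursivelyPresentable QCMAStar ∧
    RecursivelyPresentable QMAStar :=
  ⟨classP_presentable, classNP_presentable,
    fun _ hP => AcceptanceMeasure.presentable_of_mem hP, PathSum.bqpStar_presentable,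
    qcmaStar_presentable, qmaStar_presentable⟩
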